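/- Knot diagrams are oriented, lie on the oriented sphere $S^2=\mathbb R^2\cup\{\infty\}$, and are considered up to orientation-preserving homeomorphism of $S^2$. An RI (resp. RII) move creates or deletes a monogon (resp. bigon) face; in an RII move one of the two strands runs over the other, and the move is matched if the two strands are oriented in parallel, unmatched if they are oriented oppositely. An RIII move replaces a 3-gon face, formed by an upper, a middle and a lower strand, by a new one. The sign of a 3-gon face $\Delta$ is $(-1)^q$, where $\partial\Delta$ is oriented so that its three edges are met in the same cyclic order along $\partial\Delta$ and along the knot, and $q$ is the number of edges on which the orientations of $\partial\Delta$ and of the knot agree; an RIII move is positive if the 3-gon face that it creates has sign $+1$. A crossing is positive if (direction of the upper strand, direction of the lower strand) is a positive basis of the plane. Theorem. Let $n\ge 3$, and let $D_n$ be the knot diagram whose underlying curve is given in polar coordinates by $r=2+\cos\bigl(n\theta/(n+1)\bigr)$, $0\le\theta\le 2(n+1)\pi$, oriented by increasing $\theta$, and which is ascending from the base point $\theta=0$, that is, at each crossing the subarc met second, when travelling from the base point along the orientation, goes over the subarc met first. Then: 1. $D_n$ can be deformed to the diagram with no crossings by a sequence of exactly $n(n^2+5)/6$ Reidemeister moves,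 consisting of $\binom n1$ RI moves deleting positive crossings, $\binom n2$ unmatched RII moves deleting bigons and $\binom n3$ positive RIII moves. 2. Every sequence of Reidemeister moves deforming $D_n$ to the diagram with no crossings contains, counted together, at least $n(n^2+5)/6$ moves that are RI moves deleting positive crossings, unmatched RII moves deleting bigons, or positive RIII moves. In particular every such sequence has at least $n(n^2+5)/6$ moves, so the sequence in 1 has the minimal number of moves. -/

import Mathlib

/-!
Oriented knot diagrams on the oriented sphere, up to orientation preserving homeomorphism of the
sphere, are encoded by their Gauss diagrams together with the rotation at each crossing: the knot
passes twice through each crossing, so a diagram with `N` crossings has `2 * N` passages, which are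
cyclically permuted by "go to the next passage". This data determines the faces of the diagram,
and it comes from a diagram on the sphere exactly when Euler's formula holds.
-/

/-- An oriented Gauss diagram, with over/under and crossing direction data. -/
structure GaussDiagram where
  /-- the passages of the knot through the crossings (two for each crossing) -/
  Passage : Type
  finite : Finite Passage
  /-- the next passage, when travelling along the oriented knot -/
  next : Equiv.Perm Passage
  /-- the other passage through the same crossing -/
  mate : Passage → Passage
  /-- whether the passage is the upper one at its crossing -/
  upper : Passage → Bool
  /-- `left p` says that the other strand at the crossing, with its orientation, passes from the
  right to the left of the strand of `p`, i.e. that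
  (direction at `p`, direction at `mate p`) is a positive basis -/
  left : Passage → Bool
  sameCycle : ∀ p q, next.SameCycle p q
  mate_ne : ∀ p, mate p ≠ p
  mate_mate : ∀ p, mate (mate p) = p
  upper_mate : ∀ p, upper (mate p) = !upper p
  left_mate : ∀ p, left (mate p) = !left p

namespace GaussDiagram

/-- The sign of the crossing of `p`: positive when
(direction of the upper strand, direction of the lower strand) is a positive basis. -/
def positive (D : GaussDiagram) (p : D.Passage) : Bool := D.upper p == D.left p

/-- A directed edge of the diagram: the passage where it starts, and whether it is
directed along (`true`) or against (`false`) the orientation of the knot. -/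
abbrev Dart (D : GaussDiagram) : Type := D.Passage × Bool

/-- The passage at the end of a directed edge. -/
def head (D : GaussDiagram) (d : D.Dart) : D.Passage :=
  if d.2 then D.next d.1 else D.next.symm d.1

/-- Walk along the boundary of the face on the left of a directed edge: at its end, turn left. -/
def faceNext (D : GaussDiagram) (d : D.Dart) : D.Dart :=
  (D.mate (D.head d), D.left (D.head d) == d.2)

/-- The faces: orbits of directed edges under walking along the boundary with the face on the
left. -/
def Face (D : GaussDiagram) : Type := Quot fun d e : D.Dart => D.faceNext d = e

/-- The two passages through the crossing of `p`. -/
def crossing (D : GaussDiagram) (p : D.Passage) : Set D.Passage := {p, D.mate p}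

/-- Starting at `p` and travelling along the oriented knot, one meets `q` before `r`. -/
def MeetsInOrder (D : GaussDiagram) (p q r : D.Passage) : Prop :=
  ∃ k : ℕ, (D.next ^ k) p = q ∧ ∀ j ≤ k, (D.next ^ j) p ≠ r

/-- `d` runs around a 3-gon face with three distinct corners. -/
def IsTriangle (D : GaussDiagram) (d : Fin 3 → D.Dart) : Prop :=
  (∀ i, D.faceNext (d i) = d (i + 1)) ∧ ∀ i j, i ≠ j → (d i).1 ∉ D.crossing (d j).1

open Classical in
/-- The sign `(-1) ^ q` of a 3-gon face. Its boundary is oriented so that its edges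
are met in the same cyclic order along the boundary and along the knot, and `q` is the number
of edges on which the orientations of the boundary and of the knot agree. -/
noncomputable def triangleSign (D : GaussDiagram) (d : Fin 3 → D.Dart) : ℤ :=
  (-1) ^ (Finset.univ.filter fun i : Fin 3 =>
    ((d i).2 = true ↔ D.MeetsInOrder (d 0).1 (d 1).1 (d 2).1)).card

end GaussDiagram

/-- An oriented knot diagram on the sphere. With `N > 0` crossings there are `2 * N` edges,
and `N - 2 * N + F = 2`, where `F` is the number of faces; with `N = 0` the diagram is a
simple closed curve. -/
structure KnotDiagram extends GaussDiagram where
  planar : Nonempty Passage →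
    2 * Nat.card toGaussDiagram.Face = Nat.card Passage + 4

namespace KnotDiagram

/-- The diagram `E` is obtained from `D` by deleting the passages in `S`. -/
def IsDeletion (D E : KnotDiagram) (S : Set D.Passage) : Prop :=
  ∃ f : E.Passage → D.Passage, Function.Injective f ∧ Set.range f = Sᶜ ∧
    (∀ x, f (E.mate x) = D.mate (f x)) ∧
    (∀ x, E.upper x = D.upper (f x)) ∧
    (∀ x, E.left x = D.left (f x)) ∧
    ∀ x, ∃ k : ℕ, f (E.next x) = (D.next ^ (k + 1)) (f x) ∧
      ∀ j < k, (D.next ^ (j + 1)) (f x) ∈ S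

/-- An RI move from `D` to `E` deleting a monogon face, whose crossing is positive or negative. -/
def DeletesMonogon (positive : Bool) (D E : KnotDiagram) : Prop :=
  ∃ d : D.Dart, D.faceNext d = d ∧ D.positive d.1 = positive ∧
    IsDeletion D E (D.crossing d.1)

/-- An RII move from `D` to `E` deleting a bigon face, one edge of which runs over the other one.
It is matched if the two edges are oriented in parallel, that is, if exactly one of them is
oriented along the boundary of the bigon. -/
def DeletesBigon (isMatched : Bool) (D E : KnotDiagram) : Prop :=
  ∃ d e : D.Dart, D.faceNext d = e ∧ D.faceNext e = d ∧
    D.upper d.1 = D.upper (D.head d) ∧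
    (isMatched = true ↔ d.2 ≠ e.2) ∧
    IsDeletion D E (D.crossing d.1 ∪ D.crossing e.1)

open Classical in
/-- The permutation of passages that exchanges the two ends of each of three edges. -/
noncomputable def exchange (D : KnotDiagram) (d : Fin 3 → D.Dart) : Equiv.Perm D.Passage :=
  Equiv.swap (d 0).1 (D.head (d 0)) * Equiv.swap (d 1).1 (D.head (d 1)) *
    Equiv.swap (d 2).1 (D.head (d 2))

/-- An RIII move from `D` to `E`. It is performed on a 3-gon face `d` of `D`, one edge of which
runs over, and one edge of which runs under, the other two. Each of the three strands meets its two
crossings in the opposite order afterwards. The 3-gon face that is created is made of the same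
strands, and the move is positive if its sign is `1`, and negative if its sign is `-1`. -/
def MovesTriangle (isPositive : Bool) (D E : KnotDiagram) : Prop :=
  ∃ (d : Fin 3 → D.Dart) (f : D.Passage ≃ E.Passage),
    D.IsTriangle d ∧
    (∃ i, D.upper (d i).1 = true ∧ D.upper (D.head (d i)) = true) ∧
    (∃ i, D.upper (d i).1 = false ∧ D.upper (D.head (d i)) = false) ∧
    (∀ x, E.mate (f x) = f (D.mate x)) ∧
    (∀ x, E.upper (f x) = D.upper x) ∧
    (∀ x, E.left (f x) = D.left x) ∧
    (∀ x, E.next (f (D.exchange d x)) = f (D.exchange d (D.next x))) ∧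
    E.IsTriangle (fun i => (f (d i).1, !(d i).2)) ∧
    E.triangleSign (fun i => (f (d i).1, !(d i).2)) = if isPositive then 1 else -1

/-- The kinds of Reidemeister moves. -/
inductive Move where
  | deleteI (positive : Bool)
  | createI (positive : Bool)
  | deleteII (isMatched : Bool)
  | createII (isMatched : Bool)
  | moveIII (positive : Bool)
  deriving DecidableEq

/-- `E` is obtained from `D` by a Reidemeister move of the given kind. -/
def Step : Move → KnotDiagram → KnotDiagram → Prop
  | .deleteI b, D, E => DeletesMonogon b D E
  | .createI b, D, E => DeletesMonogon b E D
  | .deleteII b, D, E => DeletesBigon b D E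
  | .createII b, D, E => DeletesBigon b E D
  | .moveIII b, D, E => MovesTriangle b D E

/-- `Unknots D ms`: some sequence of Reidemeister moves whose kinds are listed in `ms` deforms `D`
to the diagram without crossings. -/
inductive Unknots : KnotDiagram → List Move → Prop
  | nil (D : KnotDiagram) : IsEmpty D.Passage → Unknots D []
  | cons (D E : KnotDiagram) (m : Move) (ms : List Move) :
      Step m D E → Unknots E ms → Unknots D (m :: ms)

/-- The underlying curve of `D` is the closed plane curve `γ` of period `T`
(regarded as a curve on the sphere `ℂ ∪ {∞}`), where `time p` in `[0, T)` is the parameter of the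
passage `p`. The curve is a smooth immersion, and its only multiple points are finitely many
transverse double points (the condition on `left` forces the determinants to be nonzero). -/
structure HasUnderlyingCurve (D : KnotDiagram) (γ : ℝ → ℂ) (T : ℝ) (time : D.Passage → ℝ) :
    Prop where
  period_pos : 0 < T
  periodic : Function.Periodic γ T
  smooth : ContDiff ℝ (⊤ : ℕ∞) γ
  immersion : ∀ t, deriv γ t ≠ 0
  injective : Function.Injective time
  range_time : Set.range time =
    {t | t ∈ Set.Ico 0 T ∧ ∃ s ∈ Set.Ico 0 T, s ≠ t ∧ γ s = γ t}
  double : ∀ p, ∀ s ∈ Set.Ico 0 T, γ s = γ (time p) ↔ s = time p ∨ s = time (D.mate p)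
  next_of_lt : ∀ p q, time p < time q → time p < time (D.next p) ∧ time (D.next p) ≤ time q
  next_of_last : ∀ p, (∀ q, time q ≤ time p) → ∀ q, time (D.next p) ≤ time q
  left_iff : ∀ p, D.left p = true ↔
    0 < (deriv γ (time p)).re * (deriv γ (time (D.mate p))).im -
      (deriv γ (time p)).im * (deriv γ (time (D.mate p))).re

/-- The curve `r = 2 + cos (n θ / (n + 1))` in polar coordinates, parametrized by `θ`;
it closes up after `2 (n + 1) π`. -/
noncomputable def polarCurve (n : ℕ) (θ : ℝ) : ℂ :=
  ((2 + Real.cos (n * θ / (n + 1)) : ℝ) : ℂ) * Complex.exp (θ * Complex.I)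

/-- `D` is the diagram with underlying curve `r = 2 + cos (n θ / (n + 1))`,
`0 ≤ θ ≤ 2 (n + 1) π`, oriented by increasing `θ`, that is ascending from the base point `θ = 0`:
at each crossing the second passage goes over the first one. -/
def IsAscendingPolarDiagram (n : ℕ) (D : KnotDiagram) : Prop :=
  ∃ time : D.Passage → ℝ,
    D.HasUnderlyingCurve (polarCurve n) (2 * (n + 1) * Real.pi) time ∧
    ∀ p, D.upper p = true ↔ time (D.mate p) < time p

end KnotDiagram

/-! The lower bound comes from an integer invariant of diagrams that drops by the same amount under
each of the three counted kinds of moves, rises by it under their inverses, and is unchanged by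
negative RI moves and matched RII moves. Cut the knot at a base point. For two crossings that are
met in the interleaved order a, b, a', b', multiply the signs `sgn a` and `sgn b`; add these
products over all interleaved pairs, and add the number of positive crossings. The quantity
`complexity` is 8 times this number: in `linking` an interleaved pair has total contribution 8 `sgn
a` `sgn b`, any other pair of crossings 0, and a crossing paired with itself 2. The weights 3 and
-1, counted at both passages of a crossing, turn this 2 into 8 or 0.

The count is independent of the base point only because the diagram is planar. Pushing the base
point through a crossing negates the products that involve this crossing, and their sum vanishes
because the two loops into which the crossing cuts the knot have intersection number zero
(`sum_orderSign_mate`). Planarity is available only as Euler's formula. Face boundaries are cycles,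
hence orthogonal to coboundaries of functions on crossings, and Euler's formula makes the two spaces
span everything; the knot, being a cycle, is then a sum of face boundaries, which is an Alexander
numbering (`exists_numbering`). The same orthogonality gives the genus inequality
`two_mul_card_face_le`, so that planarity of a new diagram requires only a lower bound on its number
of faces.

With the base point chosen off the small face, the effect of each move is a local computation. For
RI and RII the deleted passages cancel against every other crossing. For RIII exactly the three
pairs of corners of the triangle change their order; two of the three changes cancel, and the third
is the sign of the triangle. The invariant is zero on the empty diagram, so its value on a diagram
is 8 times the signed number of moves in any unknotting sequence (`complexity_of_unknots`).

For the upper bound, cut the polar curve at its radial extrema into 2n segments, alternately inward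
and outward. Segments with indices of opposite parity cross exactly once, those of equal parity
never, and the ascending diagram is determined by this combinatorial pattern. With 2m + 2 segments,
the segment 2m is swept over the diagram by RIII moves, one for each pair a < b < m; this leaves m
bigons between the last two segments and the others, and after their removal a monogon. What is left
is the same diagram with 2m segments. Summing over m gives the binomial coefficients, and the
explicit sequence also evaluates the invariant on D_n. -/

namespace GaussDiagram

/-! ### Faces, cycles and the genus inequality. -/

instance finitePassage (D : GaussDiagram) : Finite D.Passage := D.finite

noncomputable instance fintypePassage (D : GaussDiagram) : Fintype D.Passage :=
  Fintype.ofFinite _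

instance finiteFace (D : GaussDiagram) : Finite D.Face :=
  Finite.of_surjective (Quot.mk _) Quot.mk_surjective

noncomputable instance fintypeFace (D : GaussDiagram) : Fintype D.Face :=
  Fintype.ofFinite _

/-- The face on the left of a directed edge. -/
def faceOf (D : GaussDiagram) (d : D.Dart) : D.Face := Quot.mk _ d

theorem faceOf_faceNext (D : GaussDiagram) (d : D.Dart) : D.faceOf (D.faceNext d) = D.faceOf d := by
  have : D.faceOf d = D.faceOf (D.faceNext d) := Quot.sound (r := fun d e => D.faceNext d = e) rfl
  exact this.symm

theorem faceOf_prev (D : GaussDiagram) (q : D.Passage) :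
    D.faceOf (D.next.symm q, true) = D.faceOf (D.mate q, D.left q) := by
  rw [← faceOf_faceNext]
  simp [faceNext, head]

theorem faceOf_next (D : GaussDiagram) (q : D.Passage) :
    D.faceOf (D.next q, false) = D.faceOf (D.mate q, !D.left q) := by
  rw [← faceOf_faceNext]
  simp [faceNext, head]

/-- The involution exchanging the two passages through each crossing. -/
def mateEquiv (D : GaussDiagram) : Equiv.Perm D.Passage := Function.Involutive.toPerm D.mate D.mate_mate

@[simp] theorem mateEquiv_apply (D : GaussDiagram) (p : D.Passage) : D.mateEquiv p = D.mate p := rfl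

/-- The direction in which a passage is crossed by the other strand, as a sign. -/
def sgn (D : GaussDiagram) (p : D.Passage) : ℤ := if D.left p then 1 else -1

theorem sgn_mate (D : GaussDiagram) (p : D.Passage) : D.sgn (D.mate p) = -D.sgn p := by
  simp only [sgn, D.left_mate]
  cases D.left p <;> simp

theorem sgn_mul_self (D : GaussDiagram) (p : D.Passage) : D.sgn p * D.sgn p = 1 := by
  simp only [sgn]
  cases D.left p <;> simp

theorem sum_mate {M : Type*} [AddCommMonoid M] (D : GaussDiagram) (g : D.Passage → M) :
    ∑ p, g (D.mate p) = ∑ p, g p :=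
  Equiv.sum_comp D.mateEquiv g

theorem sum_eq_zero_of_mate (D : GaussDiagram) (g : D.Passage → ℚ)
    (h : ∀ p, g (D.mate p) = -g p) : ∑ p, g p = 0 := by
  have := D.sum_mate g
  simp only [h, Finset.sum_neg_distrib] at this
  linarith

theorem sum_sgn (D : GaussDiagram) : ∑ p, D.sgn p = 0 := by
  have := D.sum_mate D.sgn
  simp only [D.sgn_mate, Finset.sum_neg_distrib] at this
  linarith

/-- Connectedness of the diagram enters through this lemma: the knot has one component, so `next`
acts transitively. -/
theorem const_of_next {α : Type*} (D : GaussDiagram) (g : D.Passage → α)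
    (h : ∀ p, g (D.next p) = g p) (p q : D.Passage) : g p = g q := by
  obtain ⟨i, hi⟩ := D.sameCycle p q
  have h' : ∀ p, g (D.next⁻¹ p) = g p := fun p => by
    rw [← h (D.next⁻¹ p)]
    exact congrArg g (Equiv.apply_symm_apply D.next p)
  have key : ∀ i : ℤ, ∀ p, g ((D.next ^ i) p) = g p := by
    intro i
    induction i with
    | zero => intro p; simp
    | succ n ih => intro p; rw [zpow_add, Equiv.Perm.mul_apply, ih, zpow_one, h]
    | pred n ih => intro p; rw [zpow_sub, Equiv.Perm.mul_apply, ih, zpow_one, h']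
  rw [← hi, key]

/-- The boundary of a chain of faces. -/
noncomputable def faceBoundary (D : GaussDiagram) : (D.Face → ℚ) →ₗ[ℚ] (D.Passage → ℚ) where
  toFun w p := w (D.faceOf (p, true)) - w (D.faceOf (D.next p, false))
  map_add' v w := by ext p; simp; ring
  map_smul' c w := by ext p; simp; ring

/-- Representatives of the crossings. -/
abbrev LeftPassage (D : GaussDiagram) : Type := {p : D.Passage // D.left p = true}

/-- The passage through the same crossing that is crossed from right to left. -/
def toLeft (D : GaussDiagram) (p : D.Passage) : D.LeftPassage :=
  if h : D.left p = true then ⟨p, h⟩ else ⟨D.mate p, by rw [D.left_mate]; simpa using h⟩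

theorem toLeft_mate (D : GaussDiagram) (p : D.Passage) : D.toLeft (D.mate p) = D.toLeft p := by
  have h1 := D.left_mate p
  by_cases h : D.left p = true
  · have h2 : ¬ D.left (D.mate p) = true := by simp [h1, h]
    simp only [toLeft, dif_pos h, dif_neg h2]
    exact Subtype.ext (D.mate_mate p)
  · have h2 : D.left (D.mate p) = true := by simpa [h1] using h
    simp only [toLeft, dif_pos h2, dif_neg h]

theorem toLeft_coe (D : GaussDiagram) (p : D.LeftPassage) : D.toLeft p = p := by
  simp [toLeft, p.2]

/-- The coboundary of a function on the crossings. -/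
noncomputable def crossingCoboundary (D : GaussDiagram) :
    (D.LeftPassage → ℚ) →ₗ[ℚ] (D.Passage → ℚ) where
  toFun g p := g (D.toLeft p) - g (D.toLeft (D.next p))
  map_add' v w := by ext p; simp; ring
  map_smul' c w := by ext p; simp; ring

theorem faceBoundary_apply (D : GaussDiagram) (w : D.Face → ℚ) (q : D.Passage) :
    D.faceBoundary w q = w (D.faceOf (q, true)) - w (D.faceOf (D.mate q, !D.left q)) := by
  simp [faceBoundary, faceOf_next]

theorem faceBoundary_prev (D : GaussDiagram) (w : D.Face → ℚ) (q : D.Passage) :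
    D.faceBoundary w (D.next.symm q) =
      w (D.faceOf (D.mate q, D.left q)) - w (D.faceOf (q, false)) := by
  simp [faceBoundary, faceOf_prev]

/-- The hypothesis says that f is a cycle: at each crossing the outgoing edges carry as much as the
incoming ones. Summation by parts leaves, at each crossing, the net flow times the value of g. -/
theorem sum_mul_crossingCoboundary (D : GaussDiagram) (f : D.Passage → ℚ)
    (h : ∀ q, f q + f (D.mate q) = f (D.next.symm q) + f (D.next.symm (D.mate q)))
    (g : D.LeftPassage → ℚ) : ∑ p, f p * D.crossingCoboundary g p = 0 := by
  have h1 : ∑ p, f p * g (D.toLeft (D.next p)) = ∑ p, f (D.next.symm p) * g (D.toLeft p) := by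
    rw [← Equiv.sum_comp D.next (fun p => f (D.next.symm p) * g (D.toLeft p))]
    simp
  have h2 : ∑ p, (f p - f (D.next.symm p)) * g (D.toLeft p) = 0 := by
    apply D.sum_eq_zero_of_mate
    intro p
    rw [D.toLeft_mate]
    have := h p
    linear_combination g (D.toLeft p) * this
  simp only [crossingCoboundary, LinearMap.coe_mk, AddHom.coe_mk, mul_sub, Finset.sum_sub_distrib]
  rw [h1, ← h2, ← Finset.sum_sub_distrib]
  simp [sub_mul]

theorem faceBoundary_conserved (D : GaussDiagram) (w : D.Face → ℚ) (q : D.Passage) :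
    D.faceBoundary w q + D.faceBoundary w (D.mate q) =
      D.faceBoundary w (D.next.symm q) + D.faceBoundary w (D.next.symm (D.mate q)) := by
  rw [faceBoundary_prev, faceBoundary_prev]
  simp only [faceBoundary_apply, D.mate_mate, D.left_mate]
  cases D.left q <;> simp

theorem ker_faceBoundary (D : GaussDiagram) :
    Module.finrank ℚ (LinearMap.ker D.faceBoundary) ≤ 1 := by
  have h : LinearMap.ker D.faceBoundary ≤ Submodule.span ℚ {(fun _ => 1 : D.Face → ℚ)} := by
    intro w hw
    rw [LinearMap.mem_ker] at hw
    have h1 : ∀ q, D.faceBoundary w q = 0 := fun q => by rw [hw]; rfl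
    -- The four edges at the crossing of q separate its four corners cyclically, so the values on
    -- all four corners agree.
    have h2 : ∀ q, w (D.faceOf (q, false)) = w (D.faceOf (q, true)) := by
      intro q
      have a1 := h1 q
      have a2 := h1 (D.mate q)
      have a3 := h1 (D.next.symm q)
      have a4 := h1 (D.next.symm (D.mate q))
      rw [faceBoundary_prev] at a3 a4
      simp only [faceBoundary_apply, D.mate_mate, D.left_mate] at a1 a2 a3 a4
      rcases h : D.left q <;> simp only [h, Bool.not_true, Bool.not_false] at a1 a2 a3 a4 <;> linarith
    have h3 : ∀ p q, w (D.faceOf (p, true)) = w (D.faceOf (q, true)) := by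
      apply D.const_of_next (fun p => w (D.faceOf (p, true)))
      intro p
      have := h1 p
      simp only [faceBoundary, LinearMap.coe_mk, AddHom.coe_mk, h2] at this
      linarith
    have h4 : ∀ x y, w x = w y := by
      rintro ⟨p, b⟩ ⟨q, c⟩
      change w (D.faceOf (p, b)) = w (D.faceOf (q, c))
      cases b <;> cases c <;> (try simp only [h2]) <;> apply h3
    rw [Submodule.mem_span_singleton]
    rcases isEmpty_or_nonempty D.Face with he | ⟨⟨x⟩⟩
    · exact ⟨0, funext fun y => he.elim y⟩
    · exact ⟨w x, funext fun y => by simp [h4 x y]⟩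
  refine (Submodule.finrank_mono h).trans ?_
  refine (finrank_span_le_card _).trans ?_
  simp

theorem ker_crossingCoboundary (D : GaussDiagram) :
    Module.finrank ℚ (LinearMap.ker D.crossingCoboundary) ≤ 1 := by
  have h : LinearMap.ker D.crossingCoboundary ≤
      Submodule.span ℚ {(fun _ => 1 : D.LeftPassage → ℚ)} := by
    intro g hg
    rw [LinearMap.mem_ker] at hg
    have h3 : ∀ p q, g (D.toLeft p) = g (D.toLeft q) := by
      apply D.const_of_next (fun p => g (D.toLeft p))
      intro p
      have := congrFun hg p
      simp only [crossingCoboundary, LinearMap.coe_mk, AddHom.coe_mk, Pi.zero_apply] at this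
      linarith
    rw [Submodule.mem_span_singleton]
    rcases isEmpty_or_nonempty D.LeftPassage with he | ⟨⟨x⟩⟩
    · exact ⟨0, funext fun y => he.elim y⟩
    · refine ⟨g x, funext fun y => ?_⟩
      have := h3 x y
      simp only [toLeft_coe] at this
      simp [this]
  refine (Submodule.finrank_mono h).trans ?_
  refine (finrank_span_le_card _).trans ?_
  simp

theorem two_mul_card_leftPassage (D : GaussDiagram) :
    2 * Fintype.card D.LeftPassage = Fintype.card D.Passage := by
  have h1 : Fintype.card D.LeftPassage = Fintype.card {p : D.Passage // ¬ D.left p = true} :=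
    Fintype.card_congr (D.mateEquiv.subtypeEquiv fun p => by simp [D.left_mate])
  have h2 := Fintype.card_subtype_compl (fun p : D.Passage => D.left p = true)
  have h3 := Fintype.card_subtype_le (fun p : D.Passage => D.left p = true)
  change Fintype.card D.LeftPassage ≤ _ at h3
  change _ = _ - Fintype.card D.LeftPassage at h2
  omega

/-- Cycles are orthogonal to coboundaries for the standard inner product, which is positive definite
over ℚ. -/
theorem disjoint_ranges (D : GaussDiagram) :
    Disjoint (LinearMap.range D.faceBoundary) (LinearMap.range D.crossingCoboundary) := by
  rw [Submodule.disjoint_def]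
  rintro f ⟨w, hw⟩ ⟨g, hg⟩
  have h := D.sum_mul_crossingCoboundary _ (D.faceBoundary_conserved w) g
  rw [hw, hg] at h
  funext p
  have h1 := (Finset.sum_eq_zero_iff_of_nonneg (fun p _ => mul_self_nonneg (f p))).1 h p
    (Finset.mem_univ p)
  simpa using h1

theorem card_face_le_finrank_range (D : GaussDiagram) :
    Fintype.card D.Face ≤ Module.finrank ℚ (LinearMap.range D.faceBoundary) + 1 := by
  have h1 := LinearMap.finrank_range_add_finrank_ker D.faceBoundary
  rw [Module.finrank_fintype_fun_eq_card] at h1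
  have := D.ker_faceBoundary
  omega

theorem card_leftPassage_le_finrank_range (D : GaussDiagram) :
    Fintype.card D.LeftPassage ≤ Module.finrank ℚ (LinearMap.range D.crossingCoboundary) + 1 := by
  have h1 := LinearMap.finrank_range_add_finrank_ker D.crossingCoboundary
  rw [Module.finrank_fintype_fun_eq_card] at h1
  have := D.ker_crossingCoboundary
  omega

theorem finrank_sup_ranges (D : GaussDiagram) :
    Module.finrank ℚ (LinearMap.range D.faceBoundary) +
      Module.finrank ℚ (LinearMap.range D.crossingCoboundary) =
    Module.finrank ℚ
      (LinearMap.range D.faceBoundary ⊔ LinearMap.range D.crossingCoboundary : Submodule ℚ _) := by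
  have h1 := Submodule.finrank_sup_add_finrank_inf_eq (LinearMap.range D.faceBoundary)
    (LinearMap.range D.crossingCoboundary)
  rw [D.disjoint_ranges.eq_bot, finrank_bot] at h1
  omega

/-- The genus of the surface of a Gauss diagram is nonnegative. -/
theorem two_mul_card_face_le (D : GaussDiagram) :
    2 * Fintype.card D.Face ≤ Fintype.card D.Passage + 4 := by
  -- With N crossings and F faces there are 2N edges, and the two independent ranges have dimensions
  -- at least F - 1 and N - 1.
  have h1 := D.finrank_sup_ranges
  have h2 := Submodule.finrank_le
    (LinearMap.range D.faceBoundary ⊔ LinearMap.range D.crossingCoboundary : Submodule ℚ _)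
  rw [Module.finrank_fintype_fun_eq_card] at h2
  have := D.card_face_le_finrank_range
  have := D.card_leftPassage_le_finrank_range
  have := D.two_mul_card_leftPassage
  omega

/-- Euler's formula needs to be verified in one direction only: a diagram is planar as soon as it
has enough faces. -/
theorem planar_of_le (D : GaussDiagram) (h : Nat.card D.Passage + 4 ≤ 2 * Nat.card D.Face) :
    2 * Nat.card D.Face = Nat.card D.Passage + 4 := by
  have := D.two_mul_card_face_le
  simp only [Nat.card_eq_fintype_card] at *
  omega

end GaussDiagram

/-! ### Alexander numbering. -/

namespace KnotDiagram

/-- Alexander numbering of the faces. -/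
theorem exists_numbering (D : KnotDiagram) (hD : Nonempty D.Passage) :
    ∃ w : D.Face → ℚ, ∀ p, D.faceBoundary w p = 1 := by
  have hp := D.planar hD
  simp only [Nat.card_eq_fintype_card] at hp
  have h1 := D.finrank_sup_ranges
  have h3 := D.card_face_le_finrank_range
  have h4 := D.card_leftPassage_le_finrank_range
  have h5 := D.two_mul_card_leftPassage
  have h2 := Submodule.finrank_le
    (LinearMap.range D.faceBoundary ⊔ LinearMap.range D.crossingCoboundary : Submodule ℚ _)
  -- Euler's formula is the case of equality in the dimension count, so every chain is a face
  -- boundary plus a coboundary.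
  have htop : (LinearMap.range D.faceBoundary ⊔ LinearMap.range D.crossingCoboundary :
      Submodule ℚ (D.Passage → ℚ)) = ⊤ := by
    apply Submodule.eq_top_of_finrank_eq
    rw [Module.finrank_fintype_fun_eq_card] at *
    omega
  have hm : (fun _ => 1 : D.Passage → ℚ) ∈
      (LinearMap.range D.faceBoundary ⊔ LinearMap.range D.crossingCoboundary) := by
    rw [htop]; trivial
  obtain ⟨a, ⟨w, rfl⟩, b, ⟨g, rfl⟩, hab⟩ := Submodule.mem_sup.1 hm
  have o1 := D.sum_mul_crossingCoboundary _ (D.faceBoundary_conserved w) g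
  have o2 := D.sum_mul_crossingCoboundary (fun _ => 1) (fun _ => rfl) g
  have hb : ∀ p, D.crossingCoboundary g p = 1 - D.faceBoundary w p := fun p => by
    have := congrFun hab p
    simp only [Pi.add_apply] at this
    linarith
  -- The constant chain 1, which is the knot itself, is also a cycle. Its coboundary component is
  -- therefore a cycle as well, is orthogonal to itself, and vanishes.
  have h6 : ∑ p, D.crossingCoboundary g p * D.crossingCoboundary g p = 0 := by
    rw [← sub_zero (0 : ℚ)]
    nth_rewrite 1 [← o2]
    rw [← o1, ← Finset.sum_sub_distrib]
    refine Finset.sum_congr rfl fun p _ => ?_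
    rw [hb]; ring
  refine ⟨w, fun p => ?_⟩
  have h7 := (Finset.sum_eq_zero_iff_of_nonneg
    (fun p _ => mul_self_nonneg (D.crossingCoboundary g p))).1 h6 p (Finset.mem_univ p)
  have h8 : D.crossingCoboundary g p = 0 := by simpa using h7
  have := hb p
  linarith

/-- The Alexander number of the face on the left of the edge that starts at a passage. -/
theorem exists_height (D : KnotDiagram) : ∃ H : D.Passage → ℚ,
    (∀ p, H (D.next p) = H p - D.sgn (D.next p)) ∧ ∀ p, H p = H (D.next.symm (D.mate p)) := by
  rcases isEmpty_or_nonempty D.Passage with he | hne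
  · exact ⟨fun _ => 0, fun p => he.elim p, fun p => he.elim p⟩
  obtain ⟨w, hw⟩ := D.exists_numbering hne
  -- In the second equation the two corners have equal numbers even when they are opposite corners,
  -- belonging to different faces.
  have key : ∀ q, w (D.faceOf (q, true)) = w (D.faceOf (D.next.symm q, true)) - D.sgn q ∧
      w (D.faceOf (q, true)) = w (D.faceOf (D.next.symm (D.mate q), true)) := by
    intro q
    have a1 := hw q
    have a2 := hw (D.mate q)
    have a3 := hw (D.next.symm q)
    have a4 := hw (D.next.symm (D.mate q))
    rw [D.faceBoundary_prev] at a3 a4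
    simp only [D.faceBoundary_apply, D.mate_mate, D.left_mate] at a1 a2 a3 a4
    rw [D.faceOf_prev, D.faceOf_prev, D.mate_mate, D.left_mate]
    rcases h : D.left q <;>
      simp only [h, Bool.not_true, Bool.not_false, GaussDiagram.sgn] at a1 a2 a3 a4 ⊢ <;>
      constructor <;> norm_num <;> linarith
  refine ⟨fun p => w (D.faceOf (p, true)), fun p => ?_, fun p => (key p).2⟩
  have := (key (D.next p)).1
  simpa using this

end KnotDiagram

/-! ### Linear and cyclic orders along the knot. -/

/-- `y` follows `x` in the cyclic order given by `k`. -/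
def IsCyclicSucc {α K : Type*} [LinearOrder K] (k : α → K) (x y : α) : Prop :=
  (k x < k y ∧ ∀ z, k z ≤ k x ∨ k y ≤ k z) ∨ ((∀ z, k z ≤ k x) ∧ ∀ z, k y ≤ k z)

theorem IsCyclicSucc.eq {α K : Type*} [LinearOrder K] {k : α → K} (hk : Function.Injective k)
    {x y z : α} (hy : IsCyclicSucc k x y) (hz : IsCyclicSucc k x z) : y = z := by
  apply hk
  rcases hy with ⟨h1, h2⟩ | ⟨h1, h2⟩ <;> rcases hz with ⟨h3, h4⟩ | ⟨h3, h4⟩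
  · rcases h2 z with h | h
    · exact absurd h3 h.not_gt
    · rcases h4 y with h' | h'
      · exact absurd h1 h'.not_gt
      · exact le_antisymm h h'
  · exact absurd h1 (h3 y).not_gt
  · exact absurd h3 (h1 z).not_gt
  · exact le_antisymm (h2 z) (h4 y)

theorem IsCyclicSucc.congr {α K L : Type*} [LinearOrder K] [LinearOrder L] {k : α → K} {l : α → L}
    (h : ∀ x y, l x < l y ↔ k x < k y) {x y : α} (hk : IsCyclicSucc k x y) :
    IsCyclicSucc l x y := by
  have h' : ∀ x y, l x ≤ l y ↔ k x ≤ k y := fun x y => by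
    rw [← not_lt, h, not_lt]
  simpa only [IsCyclicSucc, h, h'] using hk

/-- The sign of `y - x` in the linear order given by `k`. -/
def orderSign {α K : Type*} [LinearOrder K] (k : α → K) (x y : α) : ℤ :=
  if k x < k y then 1 else if k y < k x then -1 else 0

section orderSign

variable {α K : Type*} [LinearOrder K] {k : α → K}

theorem orderSign_self (x : α) : orderSign k x x = 0 := by simp [orderSign]

theorem orderSign_of_lt {x y : α} (h : k x < k y) : orderSign k x y = 1 := by simp [orderSign, h]

theorem orderSign_of_gt {x y : α} (h : k y < k x) : orderSign k x y = -1 := by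
  simp [orderSign, h, h.not_gt]

theorem orderSign_comm (x y : α) : orderSign k x y = -orderSign k y x := by
  rcases lt_trichotomy (k x) (k y) with h | h | h
  · rw [orderSign_of_lt h, orderSign_of_gt h, neg_neg]
  · simp [orderSign, h]
  · rw [orderSign_of_gt h, orderSign_of_lt h]

theorem orderSign_mul_self (hk : Function.Injective k) {x y : α} (h : x ≠ y) :
    orderSign k x y * orderSign k x y = 1 := by
  rcases lt_trichotomy (k x) (k y) with h' | h' | h'
  · rw [orderSign_of_lt h']; rfl
  · exact absurd (hk h') h
  · rw [orderSign_of_gt h']; rfl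

theorem orderSign_congr {L : Type*} [LinearOrder L] {β : Type*} {l : β → L} {x y : α} {x' y' : β}
    (h1 : k x < k y ↔ l x' < l y') (h2 : k y < k x ↔ l y' < l x') :
    orderSign k x y = orderSign l x' y' := by
  simp [orderSign, h1, h2]

end orderSign

namespace GaussDiagram

/-- The passages are met in the order of increasing `k`, when travelling along the knot
from some base point. -/
structure Linearizes {K : Type*} [LinearOrder K] (D : GaussDiagram) (k : D.Passage → K) :
    Prop where
  injective : Function.Injective k
  succ : ∀ p, IsCyclicSucc k p (D.next p)

section Linearizes

variable {K : Type*} [LinearOrder K] {D : GaussDiagram} {k : D.Passage → K}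

theorem Linearizes.next_eq (hk : D.Linearizes k) {p q : D.Passage} (h : IsCyclicSucc k p q) :
    D.next p = q :=
  (hk.succ p).eq hk.injective h

theorem exists_pow_next (D : GaussDiagram) (p q : D.Passage) : ∃ i : ℕ, (D.next ^ i) p = q :=
  (D.sameCycle p q).exists_nat_pow_eq

open Classical in
/-- The number of steps from `b` to `x` along the knot. -/
noncomputable def pos (D : GaussDiagram) (b x : D.Passage) : ℕ := Nat.find (D.exists_pow_next b x)

open Classical in
theorem pow_pos_apply (D : GaussDiagram) (b x : D.Passage) : (D.next ^ D.pos b x) b = x :=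
  Nat.find_spec (D.exists_pow_next b x)

open Classical in
theorem pos_le (D : GaussDiagram) {b x : D.Passage} {i : ℕ} (h : (D.next ^ i) b = x) :
    D.pos b x ≤ i :=
  Nat.find_min' (D.exists_pow_next b x) h

theorem pos_injective (D : GaussDiagram) (b : D.Passage) : Function.Injective (D.pos b) := by
  intro x y h
  rw [← D.pow_pos_apply b x, h, D.pow_pos_apply]

theorem pos_self (D : GaussDiagram) (b : D.Passage) : D.pos b b = 0 :=
  Nat.le_zero.1 (D.pos_le (by simp))

theorem pos_pos (D : GaussDiagram) {b x : D.Passage} (h : x ≠ b) : 0 < D.pos b x := by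
  rw [Nat.pos_iff_ne_zero]
  intro h0
  apply h
  rw [← D.pow_pos_apply b x, h0]
  rfl

theorem pos_eq_succ (D : GaussDiagram) {b x : D.Passage} (h : x ≠ b) :
    D.pos b x = D.pos (D.next b) x + 1 := by
  apply le_antisymm
  · apply D.pos_le
    rw [pow_succ, Equiv.Perm.mul_apply, D.pow_pos_apply]
  · have := D.pos_pos h
    have h1 : D.pos (D.next b) x ≤ D.pos b x - 1 := by
      apply D.pos_le
      rw [← Equiv.Perm.mul_apply, ← pow_succ, Nat.sub_add_cancel this, D.pow_pos_apply]
    omega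

theorem pos_next (D : GaussDiagram) {b p : D.Passage} (h : D.next p ≠ b) :
    D.pos b (D.next p) = D.pos b p + 1 := by
  apply le_antisymm
  · apply D.pos_le
    rw [pow_succ', Equiv.Perm.mul_apply, D.pow_pos_apply]
  · have := D.pos_pos h
    have h1 : D.pos b p ≤ D.pos b (D.next p) - 1 := by
      apply D.pos_le
      apply D.next.injective
      rw [← Equiv.Perm.mul_apply, ← pow_succ', Nat.sub_add_cancel this, D.pow_pos_apply]
    omega

theorem pos_le_of_next_eq (D : GaussDiagram) {b p : D.Passage} (h : D.next p = b)
    (q : D.Passage) : D.pos b q ≤ D.pos b p := by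
  have h1 : (D.next ^ (D.pos b p + 1)) b = b := by
    rw [pow_succ', Equiv.Perm.mul_apply, D.pow_pos_apply, h]
  have h2 : (D.next ^ (D.pos b q % (D.pos b p + 1))) b = q := by
    have := D.pow_pos_apply b q
    rw [← Nat.mod_add_div (D.pos b q) (D.pos b p + 1), pow_add, pow_mul, Equiv.Perm.mul_apply,
      Equiv.Perm.pow_apply_eq_self_of_apply_eq_self h1] at this
    exact this
  have h3 := D.pos_le h2
  have h4 : D.pos b q % (D.pos b p + 1) < D.pos b p + 1 := Nat.mod_lt _ (by omega)
  omega

theorem linearizes_pos (D : GaussDiagram) (b : D.Passage) : D.Linearizes (D.pos b) := by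
  refine ⟨D.pos_injective b, fun p => ?_⟩
  by_cases h : D.next p = b
  · right
    exact ⟨D.pos_le_of_next_eq h, fun z => by rw [h, D.pos_self]; omega⟩
  · left
    rw [D.pos_next h]
    exact ⟨by omega, fun z => by omega⟩

theorem Linearizes.lt_of_pos_lt (hk : D.Linearizes k) {b : D.Passage} (hb : ∀ q, k b ≤ k q) :
    ∀ (n : ℕ) (y : D.Passage), D.pos b y = n → ∀ x, D.pos b x < n → k x < k y := by
  intro n
  induction n with
  | zero => intro y _ x hx; omega
  | succ n ih =>
    intro y hy x hx
    obtain ⟨z, rfl⟩ := D.next.surjective y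
    have hne : D.next z ≠ b := fun h => by rw [h, D.pos_self] at hy; omega
    rw [D.pos_next hne] at hy
    have h1 : k z < k (D.next z) := by
      rcases hk.succ z with h | h
      · exact h.1
      · exact absurd (hk.injective (le_antisymm (h.2 b) (hb _))) hne
    rcases Nat.lt_or_ge (D.pos b x) n with h | h
    · exact (ih z (by omega) x h).trans h1
    · have : x = z := D.pos_injective b (by omega)
      rw [this]; exact h1

/-- Every admissible linear order is the order of counting from its least passage. Independence of
the linear order thus reduces to moving the base point by one step. -/
theorem Linearizes.lt_iff_pos_lt (hk : D.Linearizes k) {b : D.Passage} (hb : ∀ q, k b ≤ k q)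
    (x y : D.Passage) : k x < k y ↔ D.pos b x < D.pos b y := by
  refine ⟨fun h => ?_, fun h => hk.lt_of_pos_lt hb _ y rfl x h⟩
  by_contra h'
  rcases Nat.eq_or_lt_of_le (not_lt.1 h') with h1 | h1
  · rw [D.pos_injective b h1] at h; exact lt_irrefl _ h
  · exact lt_asymm h (hk.lt_of_pos_lt hb _ x rfl y h1)

end Linearizes

/-! ### The interleaving count and its independence of the base point. -/

/-- A signed count of the pairs of crossings that are interleaved along the knot, as seen from a
base point. -/
noncomputable def linking {K : Type*} [LinearOrder K] (D : GaussDiagram) (k : D.Passage → K) : ℤ :=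
  ∑ p, ∑ q, D.sgn p * D.sgn q * (orderSign k p q * orderSign k (D.mate p) (D.mate q))

theorem linking_congr {K L : Type*} [LinearOrder K] [LinearOrder L] (D : GaussDiagram)
    {k : D.Passage → K} {l : D.Passage → L} (h : ∀ x y, k x < k y ↔ l x < l y) :
    D.linking k = D.linking l := by
  unfold linking
  refine Finset.sum_congr rfl fun p _ => Finset.sum_congr rfl fun q _ => ?_
  rw [orderSign_congr (h p q) (h q p), orderSign_congr (h _ _) (h (D.mate q) (D.mate p))]

-- Between x and its successor only the comparisons with these two passages change. This is the
-- discrete analogue of the jump of an Alexander numbering.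
open Classical in
theorem Linearizes.sum_orderSign_next {K : Type*} [LinearOrder K] {D : GaussDiagram}
    {k : D.Passage → K} (hk : D.Linearizes k) (x : D.Passage) :
    ∑ y, D.sgn y * orderSign k (D.next x) y =
      ∑ y, D.sgn y * orderSign k x y - D.sgn (D.next x) - D.sgn x := by
  have hne : D.next x ≠ x := by
    intro h
    have : D.pos x (D.mate x) ≤ D.pos x x := D.pos_le_of_next_eq h _
    rw [D.pos_self] at this
    have := D.pos_pos (D.mate_ne x)
    omega
  have key : ∃ c : ℤ, ∀ y, orderSign k (D.next x) y =
      orderSign k x y + c - (if y = x then 1 else 0) - (if y = D.next x then 1 else 0) := by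
    rcases hk.succ x with ⟨h1, h2⟩ | ⟨h1, h2⟩
    · refine ⟨0, fun y => ?_⟩
      by_cases e1 : y = x
      · subst e1
        simp [orderSign_self, orderSign_of_gt h1, hne.symm]
      by_cases e2 : y = D.next x
      · subst e2
        simp [orderSign_self, orderSign_of_lt h1, hne]
      rcases h2 y with h | h
      · have h' := lt_of_le_of_ne h (hk.injective.ne e1)
        simp [e1, e2, orderSign_of_gt h', orderSign_of_gt (h'.trans h1)]
      · have h' := lt_of_le_of_ne h (hk.injective.ne (Ne.symm e2))
        simp [e1, e2, orderSign_of_lt h', orderSign_of_lt (h1.trans h')]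
    -- Going from the last passage to the first turns every comparison from -1 into 1. The common
    -- increment 2 is harmless because the signs sum to zero.
    · refine ⟨2, fun y => ?_⟩
      have h3 : k (D.next x) < k x := lt_of_le_of_ne (h2 x) (hk.injective.ne hne)
      by_cases e1 : y = x
      · subst e1
        simp [orderSign_self, orderSign_of_lt h3, hne.symm]
      by_cases e2 : y = D.next x
      · subst e2
        simp [orderSign_self, orderSign_of_gt h3, hne]
      have h4 := lt_of_le_of_ne (h1 y) (hk.injective.ne e1)
      have h5 := lt_of_le_of_ne (h2 y) (hk.injective.ne (Ne.symm e2))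
      simp [e1, e2, orderSign_of_gt h4, orderSign_of_lt h5]
  obtain ⟨c, hc⟩ := key
  simp only [hc, mul_sub, mul_add, Finset.sum_sub_distrib, Finset.sum_add_distrib, ← Finset.sum_mul,
    D.sum_sgn, zero_mul]
  simp
  ring

end GaussDiagram

namespace KnotDiagram

/-- The two loops into which a crossing divides the knot have intersection number zero. -/
theorem sum_orderSign_mate {K : Type*} [LinearOrder K] (D : KnotDiagram)
    {k : D.Passage → K} (hk : D.Linearizes k) (b : D.Passage) :
    ∑ y, D.sgn y * orderSign k (D.mate b) y = ∑ y, D.sgn y * orderSign k b y := by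
  obtain ⟨H, h1, h2⟩ := D.exists_height
  -- The sum at x and the sum of the heights of the two edges at x have the same increments along
  -- the knot, so they differ by a constant. The heights have the same sum at both passages of a
  -- crossing.
  have h3 := D.const_of_next
    (fun x => ((∑ y, D.sgn y * orderSign k x y : ℤ) : ℚ) - H x - H (D.next.symm x)) (fun x => by
      rw [hk.sum_orderSign_next, h1, Equiv.symm_apply_apply]
      have := h1 (D.next.symm x)
      rw [Equiv.apply_symm_apply] at this
      push_cast
      rw [this]
      ring) (D.mate b) b
  have h4 := h2 b
  have h5 := h2 (D.mate b)
  rw [D.mate_mate] at h5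
  beta_reduce at h3
  have h6 : ((∑ y, D.sgn y * orderSign k (D.mate b) y : ℤ) : ℚ) =
    ((∑ y, D.sgn y * orderSign k b y : ℤ) : ℚ) := by linarith
  exact_mod_cast h6

-- Passing from b to its successor as base point moves b from the first place to the last, and so
-- negates exactly the terms in which one of the two passages lies in the crossing C of b and the
-- other does not. Their total is zero by the intersection number of the two loops at b.
open Classical in
theorem linking_pos_next (D : KnotDiagram) (b : D.Passage) :
    D.linking (D.pos (D.next b)) = D.linking (D.pos b) := by
  set k := D.pos b with hk
  set C : Finset D.Passage := {b, D.mate b} with hC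
  set f : D.Passage → D.Passage → ℤ := fun p q =>
    D.sgn p * D.sgn q * (orderSign k p q * orderSign k (D.mate p) (D.mate q)) with hf
  set c : D.Passage → ℤ := fun p => if p ∈ C then 1 else 0 with hc
  have hlin : D.Linearizes k := D.linearizes_pos b
  have hmin : ∀ y, y ≠ b → orderSign k b y = 1 := fun y hy =>
    orderSign_of_lt (by rw [hk, D.pos_self]; exact D.pos_pos hy)
  have hne := D.mate_ne b
  have hU : ∑ y, D.sgn y * orderSign k (D.mate b) y = -D.sgn b := by
    rw [D.sum_orderSign_mate hlin]
    have : ∀ y, D.sgn y * orderSign k b y = D.sgn y - if y = b then D.sgn b else 0 := by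
      intro y
      by_cases h : y = b
      · simp [h, orderSign_self]
      · simp [h, hmin y h]
    simp [this, D.sum_sgn]
  -- Dropping the passages in C from the sum in `hU` removes only the term at b, which is `-D.sgn
  -- b`.
  have hR : ∑ y, (1 - c y) * (D.sgn y * orderSign k (D.mate b) y) = 0 := by
    have : ∀ y, (1 - c y) * (D.sgn y * orderSign k (D.mate b) y) =
        D.sgn y * orderSign k (D.mate b) y + if y = b then D.sgn b else 0 := by
      intro y
      by_cases h : y = b
      · subst h
        simp [hc, hC, orderSign_comm (D.mate y), hmin _ hne]
      · by_cases h' : y = D.mate b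
        · subst h'
          simp [orderSign_self, hne]
        · simp [hc, hC, h, h']
    simp [this, Finset.sum_add_distrib, hU]
  have hcm : ∀ y, c (D.mate y) = c y := by
    intro y
    have : D.mate y ∈ C ↔ y ∈ C := by
      simp only [hC, Finset.mem_insert, Finset.mem_singleton]
      constructor
      · rintro (h | h)
        · right; rw [← h, D.mate_mate]
        · left; exact D.mateEquiv.injective h
      · rintro (h | h)
        · right; rw [h]
        · left; rw [h, D.mate_mate]
    simp [hc, this]
  -- Since b comes first, one of the two order signs in each term is constant, and the row becomes a
  -- multiple of the sum in `hR`.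
  have hrow : ∀ x, c x * ∑ y, (1 - c y) * f x y = 0 := by
    intro x
    by_cases hx : x ∈ C
    · have hx' := hx
      simp only [hC, Finset.mem_insert, Finset.mem_singleton] at hx
      rw [mul_eq_zero]; right
      rcases hx with rfl | rfl
      · rw [← D.sum_mate]
        have : ∀ y, (1 - c (D.mate y)) * f x (D.mate y) =
            -D.sgn x * ((1 - c y) * (D.sgn y * orderSign k (D.mate x) y)) := by
          intro y
          rw [hcm]
          by_cases hy : y ∈ C
          · simp [hc, hy]
          · have : D.mate y ≠ x := by
              intro h
              apply hy
              rw [← D.mate_mate y, h]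
              simp [hC]
            simp only [hf, D.mate_mate, D.sgn_mate, hmin _ this]
            ring
        simp only [this, ← Finset.mul_sum, hR, mul_zero]
      · have : ∀ y, (1 - c y) * f (D.mate b) y =
            -D.sgn b * ((1 - c y) * (D.sgn y * orderSign k (D.mate b) y)) := by
          intro y
          by_cases hy : y ∈ C
          · simp [hc, hy]
          · have : D.mate y ≠ b := by
              intro h
              apply hy
              rw [← D.mate_mate y, h]
              simp [hC]
            simp only [hf, D.mate_mate, D.sgn_mate, hmin _ this]
            ring
        simp only [this, ← Finset.mul_sum, hR, mul_zero]
    · simp [hc, hx]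
  have hsymm : ∀ x y, f x y = f y x := by
    intro x y
    simp only [hf]
    rw [orderSign_comm x y, orderSign_comm (D.mate x)]
    ring
  have hsign : ∀ x y, orderSign (D.pos (D.next b)) x y =
      (if x = b then -1 else 1) * (if y = b then -1 else 1) * orderSign k x y := by
    have hlt : ∀ y, y ≠ b → D.pos (D.next b) y < D.pos (D.next b) b := fun y hy =>
      lt_of_le_of_ne (D.pos_le_of_next_eq rfl y) ((D.pos_injective _).ne hy)
    intro x y
    by_cases hx : x = b <;> by_cases hy : y = b
    · subst hx hy; simp [orderSign_self]
    · subst hx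
      simp [hy, hmin y hy, orderSign_of_gt (hlt y hy)]
    · subst hy
      simp [hx, orderSign_comm x y, hmin x hx, orderSign_of_gt (hlt x hx)]
    · simp only [hx, hy, if_false, one_mul]
      apply orderSign_congr <;> rw [hk, D.pos_eq_succ hx, D.pos_eq_succ hy] <;> omega
  have heta : ∀ x, (if x = b then -1 else 1) * (if D.mate x = b then -1 else 1) = 1 - 2 * c x := by
    intro x
    by_cases h : x = b
    · subst h
      simp [hc, hC, hne]
    · by_cases h' : D.mate x = b
      · have : x = D.mate b := by rw [← h', D.mate_mate]
        subst this
        simp [h, hc, hC, D.mate_mate]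
      · have : x ≠ D.mate b := fun e => h' (by rw [e, D.mate_mate])
        simp [h, h', hc, hC, this]
  -- The factors (1 - 2c(x))(1 - 2c(y)) are expanded for the 0-1 valued function c so that only rows
  -- as in `hrow` are subtracted.
  have hterm : ∀ x y, D.sgn x * D.sgn y * (orderSign (D.pos (D.next b)) x y *
      orderSign (D.pos (D.next b)) (D.mate x) (D.mate y)) =
      f x y - 2 * (c x * ((1 - c y) * f x y)) - 2 * (c y * ((1 - c x) * f y x)) := by
    intro x y
    rw [hsign, hsign, hsymm y x]
    have e1 := heta x
    have e2 := heta y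
    calc _ = ((if x = b then -1 else 1) * (if D.mate x = b then -1 else 1)) *
        ((if y = b then -1 else 1) * (if D.mate y = b then -1 else 1)) * f x y := by
          simp only [hf]; ring
      _ = _ := by rw [e1, e2]; ring
  unfold GaussDiagram.linking
  simp only [hterm, Finset.sum_sub_distrib]
  rw [Finset.sum_comm (f := fun x y => 2 * (c y * ((1 - c x) * f y x)))]
  simp only [← Finset.mul_sum, hrow]
  simp [hf]

/-- The interleaving count does not depend on the base point. -/
theorem linking_eq {K L : Type*} [LinearOrder K] [LinearOrder L] (D : KnotDiagram)
    {k : D.Passage → K} (hk : D.Linearizes k) {l : D.Passage → L} (hl : D.Linearizes l) :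
    D.linking k = D.linking l := by
  rcases isEmpty_or_nonempty D.Passage with he | hne
  · simp [GaussDiagram.linking]
  obtain ⟨b, hb⟩ := Finite.exists_min k
  obtain ⟨c, hc⟩ := Finite.exists_min l
  rw [D.linking_congr (hk.lt_iff_pos_lt hb), D.linking_congr (hl.lt_iff_pos_lt hc)]
  exact D.const_of_next (fun b => D.linking (D.pos b)) D.linking_pos_next b c

end KnotDiagram

/-! ### Deleting passages, and comparing the ends of an edge. -/

namespace GaussDiagram

section Return

variable {K : Type*} [LinearOrder K] {D E : GaussDiagram} {k : D.Passage → K}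
  {f : E.Passage → D.Passage} {S : Set D.Passage}

/-- Skipping a deleted passage does not alter its position relative to the passages that are kept.
By induction over the skipped passages, the first return to the kept ones is their cyclic successor.
-/
theorem Linearizes.isCyclicSucc_return (hk : D.Linearizes k) (hf : Set.range f = Sᶜ)
    {x y : E.Passage} {j : ℕ} (hy : f y = (D.next ^ (j + 1)) (f x))
    (hS : ∀ i < j, (D.next ^ (i + 1)) (f x) ∈ S) : IsCyclicSucc (k ∘ f) x y := by
  have key : ∀ i ≤ j,
      (k (f x) < k ((D.next ^ (i + 1)) (f x)) ∧
        ∀ w, k (f w) ≤ k (f x) ∨ k ((D.next ^ (i + 1)) (f x)) ≤ k (f w)) ∨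
      ((∀ w, k (f w) ≤ k (f x)) ∧ ∀ w, k ((D.next ^ (i + 1)) (f x)) ≤ k (f w)) := by
    intro i
    induction i with
    | zero =>
      intro _
      rcases hk.succ (f x) with ⟨h1, h2⟩ | ⟨h1, h2⟩
      · exact Or.inl ⟨h1, fun w => h2 _⟩
      · exact Or.inr ⟨fun w => h1 _, fun w => h2 _⟩
    | succ i ih =>
      intro hij
      have hz := hS i (by omega)
      have ih := ih (by omega)
      rw [pow_succ' D.next (i + 1), Equiv.Perm.mul_apply]
      set z := (D.next ^ (i + 1)) (f x)
      have hzw : ∀ w, k z ≠ k (f w) := by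
        intro w h
        have h1 : f w ∈ Sᶜ := by rw [← hf]; exact ⟨w, rfl⟩
        rw [← hk.injective h] at h1
        exact h1 hz
      rcases ih with ⟨h1, h2⟩ | ⟨h1, h2⟩ <;> rcases hk.succ z with ⟨h3, h4⟩ | ⟨h3, h4⟩
      · refine Or.inl ⟨h1.trans h3, fun w => ?_⟩
        rcases h2 w with h | h
        · exact Or.inl h
        · rcases h4 (f w) with h' | h'
          · exact absurd (le_antisymm h h') (hzw w)
          · exact Or.inr h'
      · refine Or.inr ⟨fun w => ?_, fun w => h4 _⟩
        rcases h2 w with h | h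
        · exact h
        · exact absurd (le_antisymm h (h3 _)) (hzw w)
      · refine Or.inr ⟨h1, fun w => ?_⟩
        rcases h4 (f w) with h' | h'
        · exact absurd (le_antisymm (h2 w) h') (hzw w)
        · exact h'
      · exact absurd (le_antisymm (h2 x) (h3 _)) (hzw x)
  have := key j le_rfl
  rw [← hy] at this
  exact this

theorem exists_return (hf : Set.range f = Sᶜ) (x : E.Passage) :
    ∃ (j : ℕ) (y : E.Passage), f y = (D.next ^ (j + 1)) (f x) ∧
      ∀ i < j, (D.next ^ (i + 1)) (f x) ∈ S := by
  classical
  have hex : ∃ j : ℕ, (D.next ^ (j + 1)) (f x) ∉ S := by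
    refine ⟨orderOf D.next - 1, ?_⟩
    rw [Nat.sub_add_cancel (orderOf_pos D.next), pow_orderOf_eq_one]
    change f x ∈ Sᶜ
    rw [← hf]
    exact ⟨x, rfl⟩
  have h1 : (D.next ^ (Nat.find hex + 1)) (f x) ∈ Sᶜ := Nat.find_spec hex
  rw [← hf] at h1
  obtain ⟨y, hy⟩ := h1
  exact ⟨Nat.find hex, y, hy, fun i hi => not_not.1 (Nat.find_min hex hi)⟩

theorem Linearizes.exists_next_eq {L : Type*} [LinearOrder L] {l : E.Passage → L}
    (hk : D.Linearizes k) (hf : Set.range f = Sᶜ)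
    (hl : E.Linearizes l) (h : ∀ x y, l x < l y ↔ k (f x) < k (f y)) (x : E.Passage) :
    ∃ j : ℕ, f (E.next x) = (D.next ^ (j + 1)) (f x) ∧
      ∀ i < j, (D.next ^ (i + 1)) (f x) ∈ S := by
  obtain ⟨j, y, hy, hS⟩ := exists_return (E := E) hf x
  have : E.next x = y := hl.next_eq ((hk.isCyclicSucc_return hf hy hS).congr h)
  exact ⟨j, by rw [this, hy], hS⟩

theorem Linearizes.comp_of_return (hk : D.Linearizes k) (hf : Set.range f = Sᶜ)
    (hinj : Function.Injective f)
    (h : ∀ x, ∃ j : ℕ, f (E.next x) = (D.next ^ (j + 1)) (f x) ∧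
      ∀ i < j, (D.next ^ (i + 1)) (f x) ∈ S) : E.Linearizes (k ∘ f) := by
  refine ⟨hk.injective.comp hinj, fun x => ?_⟩
  obtain ⟨j, hj, hS⟩ := h x
  exact hk.isCyclicSucc_return hf hj hS

end Return

/-- The signed contribution of two passages to the interleaving count. -/
noncomputable def linkTerm {K : Type*} [LinearOrder K] (D : GaussDiagram) (k : D.Passage → K)
    (p q : D.Passage) : ℤ :=
  D.sgn p * D.sgn q * (orderSign k p q * orderSign k (D.mate p) (D.mate q))

section linkTerm

variable {K : Type*} [LinearOrder K] {D E : GaussDiagram} {k : D.Passage → K}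

theorem linking_eq_sum_linkTerm : D.linking k = ∑ p, ∑ q, D.linkTerm k p q := rfl

theorem linkTerm_comm (p q : D.Passage) : D.linkTerm k p q = D.linkTerm k q p := by
  unfold linkTerm
  rw [orderSign_comm p q, orderSign_comm (D.mate p)]
  ring

theorem linkTerm_self (p : D.Passage) : D.linkTerm k p p = 0 := by
  simp [linkTerm, orderSign_self]

theorem linkTerm_mate_mate (p q : D.Passage) :
    D.linkTerm k (D.mate p) (D.mate q) = D.linkTerm k p q := by
  simp only [linkTerm, D.mate_mate, D.sgn_mate]
  ring

theorem linkTerm_mate (hk : Function.Injective k) (p : D.Passage) :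
    D.linkTerm k p (D.mate p) = 1 := by
  have h1 := D.sgn_mul_self p
  have h2 := orderSign_mul_self hk (D.mate_ne p).symm
  rw [linkTerm, D.mate_mate, D.sgn_mate, orderSign_comm (D.mate p)]
  linear_combination orderSign k p (D.mate p) * orderSign k p (D.mate p) * h1 + h2

/-- When the deleted passages cancel against every remaining one, the symmetric double sum splits
into two diagonal blocks. -/
theorem linking_eq_of_deletion {f : E.Passage → D.Passage} (hinj : Function.Injective f)
    (S : Finset D.Passage) (hf : Set.range f = (↑S : Set D.Passage)ᶜ)
    (hmate : ∀ x, f (E.mate x) = D.mate (f x)) (hleft : ∀ x, E.left x = D.left (f x))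
    (h : ∀ y ∉ S, ∑ x ∈ S, D.linkTerm k x y = 0) :
    D.linking k = E.linking (k ∘ f) + ∑ x ∈ S, ∑ y ∈ S, D.linkTerm k x y := by
  classical
  have hsum : ∀ g : D.Passage → ℤ, ∑ x ∈ Sᶜ, g x = ∑ x, g (f x) := by
    intro g
    have : Sᶜ = Finset.univ.map ⟨f, hinj⟩ := by
      ext x
      have := Set.ext_iff.1 hf x
      simp only [Set.mem_range, Set.mem_compl_iff, Finset.mem_coe] at this
      simp [this]
    rw [this, Finset.sum_map]
    rfl
  have hE : E.linking (k ∘ f) = ∑ x ∈ Sᶜ, ∑ y ∈ Sᶜ, D.linkTerm k x y := by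
    rw [hsum]
    refine Finset.sum_congr rfl fun x _ => ?_
    rw [hsum]
    refine Finset.sum_congr rfl fun y _ => ?_
    simp only [linkTerm, sgn, hleft, ← hmate]
    rfl
  have hzero : ∑ x ∈ S, ∑ y ∈ Sᶜ, D.linkTerm k x y = 0 := by
    rw [Finset.sum_comm]
    exact Finset.sum_eq_zero fun y hy => h y (by simpa using hy)
  have hzero' : ∑ x ∈ Sᶜ, ∑ y ∈ S, D.linkTerm k x y = 0 := by
    rw [Finset.sum_comm, ← hzero]
    exact Finset.sum_congr rfl fun y _ => Finset.sum_congr rfl fun x _ => linkTerm_comm _ _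
  rw [linking_eq_sum_linkTerm, hE]
  rw [← Finset.sum_add_sum_compl S]
  have split : ∀ x, ∑ y, D.linkTerm k x y =
      ∑ y ∈ S, D.linkTerm k x y + ∑ y ∈ Sᶜ, D.linkTerm k x y := fun x =>
    (Finset.sum_add_sum_compl S _).symm
  simp only [split, Finset.sum_add_distrib, hzero, hzero']
  ring

end linkTerm

/-- The direction of an edge, as a sign. -/
def dirSign (b : Bool) : ℤ := if b then 1 else -1

/-- The end of a directed edge that is met first along the knot. -/
def edgeStart (D : GaussDiagram) (d : D.Dart) : D.Passage := if d.2 then d.1 else D.head d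

/-- The end of a directed edge that is met last along the knot. -/
def edgeEnd (D : GaussDiagram) (d : D.Dart) : D.Passage := if d.2 then D.head d else d.1

theorem next_edgeStart (D : GaussDiagram) (d : D.Dart) : D.next (D.edgeStart d) = D.edgeEnd d := by
  rcases d with ⟨p, b⟩
  cases b <;> simp [edgeStart, edgeEnd, head]

section edges

variable {K : Type*} [LinearOrder K] {D : GaussDiagram} {k : D.Passage → K}

theorem next_ne (D : GaussDiagram) (x : D.Passage) : D.next x ≠ x := by
  intro h
  have : D.pos x (D.mate x) ≤ D.pos x x := D.pos_le_of_next_eq h _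
  rw [D.pos_self] at this
  have := D.pos_pos (D.mate_ne x)
  omega

/-- No passage lies strictly inside an edge, so its ends compare alike with any third passage. If
the base point is on the edge, one end is last and the other first, the comparisons are opposite,
and the extra factor is -1. -/
theorem orderSign_succ (hk : D.Linearizes k) {a y : D.Passage} (h1 : y ≠ a) (h2 : y ≠ D.next a) :
    orderSign k (D.next a) y = orderSign k a (D.next a) * orderSign k a y := by
  rcases hk.succ a with ⟨h3, h4⟩ | ⟨h3, h4⟩
  · rw [orderSign_of_lt h3, one_mul]
    rcases h4 y with h | h
    · have h' := lt_of_le_of_ne h (hk.injective.ne h1)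
      rw [orderSign_of_gt h', orderSign_of_gt (h'.trans h3)]
    · have h' := lt_of_le_of_ne h (hk.injective.ne h2.symm)
      rw [orderSign_of_lt h', orderSign_of_lt (h3.trans h')]
  · have h5 := lt_of_le_of_ne (h3 (D.next a)) (hk.injective.ne (D.next_ne a))
    have h6 := lt_of_le_of_ne (h3 y) (hk.injective.ne h1)
    have h7 := lt_of_le_of_ne (h4 y) (hk.injective.ne h2.symm)
    rw [orderSign_of_gt h5, orderSign_of_gt h6, orderSign_of_lt h7]
    rfl

theorem orderSign_head (hk : D.Linearizes k) (d : D.Dart) {y : D.Passage}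
    (h1 : y ≠ d.1) (h2 : y ≠ D.head d) :
    orderSign k (D.head d) y = dirSign d.2 * orderSign k d.1 (D.head d) * orderSign k d.1 y := by
  rcases d with ⟨p, b⟩
  cases b
  · simp only [head, dirSign] at *
    simp only [Bool.false_eq_true, if_false] at *
    have h := orderSign_succ hk (a := D.next.symm p) h2 (by simpa using h1)
    rw [Equiv.apply_symm_apply] at h
    have hne : D.next.symm p ≠ p := fun e => D.next_ne (D.next.symm p) (by
      rw [Equiv.apply_symm_apply]; exact e.symm)
    have h3 := orderSign_mul_self hk.injective hne
    rw [h, orderSign_comm p]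
    linear_combination -orderSign k (D.next.symm p) y * h3
  · simp only [head, dirSign] at *
    simp only [if_true, one_mul] at *
    exact orderSign_succ hk h1 h2

/-- The base point lies just before b, so the hypothesis says that it is not on this edge. -/
theorem orderSign_edge (b : D.Passage) (d : D.Dart) (h : D.edgeEnd d ≠ b) :
    orderSign (D.pos b) d.1 (D.head d) = dirSign d.2 := by
  rw [← next_edgeStart] at h
  have h1 := D.pos_next h
  rw [next_edgeStart] at h1
  rcases d with ⟨p, s⟩
  cases s <;> simp only [edgeStart, edgeEnd] at h1 <;> simp only [dirSign] <;>
    simp at h1 ⊢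
  · exact orderSign_of_gt (by omega)
  · exact orderSign_of_lt (by omega)

theorem dirSign_mul_self (b : Bool) : dirSign b * dirSign b = 1 := by cases b <;> rfl

theorem orderSign_head_of_base (b : D.Passage) (d : D.Dart) (h : D.edgeEnd d ≠ b) {y : D.Passage}
    (h1 : y ≠ d.1) (h2 : y ≠ D.head d) :
    orderSign (D.pos b) (D.head d) y = orderSign (D.pos b) d.1 y := by
  rw [orderSign_head (D.linearizes_pos b) d h1 h2, orderSign_edge b d h, dirSign_mul_self, one_mul]

end edges

/-- The contribution of a passage to the complexity. -/
def passageWeight (D : GaussDiagram) (p : D.Passage) : ℤ := if D.positive p then 3 else -1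

theorem exists_linearizes (D : GaussDiagram) : ∃ k : D.Passage → ℕ, D.Linearizes k := by
  rcases isEmpty_or_nonempty D.Passage with he | ⟨⟨b⟩⟩
  · exact ⟨fun _ => 0, fun x => he.elim x, fun x => he.elim x⟩
  · exact ⟨_, D.linearizes_pos b⟩

end GaussDiagram

/-! ### The complexity and its change under the moves. -/

namespace KnotDiagram

open GaussDiagram

/-- Eight times the invariant (in terms of the invariants of curves of Arnold and of the writhe `w`)
`J⁻ / 2 + St + w / 2`, up to sign and normalization. -/
noncomputable def complexity (D : KnotDiagram) : ℤ :=
  D.linking D.exists_linearizes.choose + ∑ p, D.passageWeight p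

theorem complexity_eq {K : Type*} [LinearOrder K] (D : KnotDiagram) {k : D.Passage → K}
    (hk : D.Linearizes k) : D.complexity = D.linking k + ∑ p, D.passageWeight p := by
  rw [complexity, D.linking_eq D.exists_linearizes.choose_spec hk]

theorem complexity_of_deletion {K : Type*} [LinearOrder K] {D E : KnotDiagram}
    {k : D.Passage → K} (hk : D.Linearizes k) (S : Finset D.Passage) (hdel : IsDeletion D E ↑S)
    (h : ∀ y ∉ S, ∑ x ∈ S, D.linkTerm k x y = 0) :
    D.complexity = E.complexity + ∑ x ∈ S, ∑ y ∈ S, D.linkTerm k x y +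
      ∑ x ∈ S, D.passageWeight x := by
  classical
  obtain ⟨f, hinj, hf, hmate, hupper, hleft, hnext⟩ := hdel
  rw [D.complexity_eq hk, E.complexity_eq (hk.comp_of_return hf hinj hnext),
    linking_eq_of_deletion hinj S hf hmate hleft h]
  have : ∑ p, D.passageWeight p = ∑ x ∈ S, D.passageWeight x + ∑ x, E.passageWeight x := by
    rw [← Finset.sum_add_sum_compl S]
    congr 1
    have : Sᶜ = Finset.univ.map ⟨f, hinj⟩ := by
      ext x
      have := Set.ext_iff.1 hf x
      simp only [Set.mem_range, Set.mem_compl_iff, Finset.mem_coe] at this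
      simp [this]
    rw [this, Finset.sum_map]
    exact Finset.sum_congr rfl fun x _ => by simp [passageWeight, positive, hupper, hleft]
  rw [this]
  ring

/-- The two passages of a monogon are joined by an edge, so they compare alike with the others up to
one common factor, and their opposite signs make them cancel. The crossing paired with itself gives
2, its weights give 6 or -2. -/
theorem complexity_of_deletesMonogon {b : Bool} {D E : KnotDiagram} (h : DeletesMonogon b D E) :
    D.complexity = E.complexity + if b then 8 else 0 := by
  classical
  obtain ⟨⟨p, s⟩, hface, hpos, hdel⟩ := h
  obtain ⟨k, hk⟩ := D.exists_linearizes
  have hhead : D.head (p, s) = D.mate p := by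
    have := congrArg Prod.fst hface
    simp only [faceNext] at this
    rw [← this, D.mate_mate]
    simp [this]
  have hne := D.mate_ne p
  have hS : D.crossing p = ↑({p, D.mate p} : Finset D.Passage) := by simp [crossing]
  simp only [hS] at hdel
  have hmem : ∀ y ∉ ({p, D.mate p} : Finset D.Passage), y ≠ p ∧ y ≠ D.mate p := by
    intro y hy
    simpa using hy
  rw [complexity_of_deletion hk _ hdel]
  · have hw : D.passageWeight (D.mate p) = D.passageWeight p := by
      simp [passageWeight, positive, D.upper_mate, D.left_mate]
    have hp : D.passageWeight p = if b then 3 else -1 := by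
      simp only [passageWeight]; simp only at hpos; rw [hpos]
    simp only [Finset.sum_pair hne.symm, linkTerm_self, linkTerm_comm (D.mate p) p,
      linkTerm_mate hk.injective, hw, hp]
    cases b
    · simp
    · simp; ring
  · intro y hy
    obtain ⟨h1, h2⟩ := hmem y hy
    have h3 : D.mate y ≠ p := fun h => h2 (by rw [← h, D.mate_mate])
    have h4 : D.mate y ≠ D.mate p := fun h => h1 (D.mateEquiv.injective h)
    have a1 := orderSign_head hk (p, s) h1 (by rw [hhead]; exact h2)
    have a2 := orderSign_head hk (p, s) h3 (by rw [hhead]; exact h4)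
    rw [hhead] at a1 a2
    rw [Finset.sum_pair hne.symm, linkTerm, linkTerm, a1, D.mate_mate, a2, D.sgn_mate]
    ring

end KnotDiagram

namespace KnotDiagram

open GaussDiagram

/-- The four passages of a bigon one edge of which runs over the other one. -/
theorem bigon_facts (D : KnotDiagram) {d e : D.Dart} (h1 : D.faceNext d = e)
    (h2 : D.faceNext e = d) (h3 : D.upper d.1 = D.upper (D.head d)) :
    D.mate d.1 = D.head e ∧ D.mate e.1 = D.head d ∧ e.1 ≠ d.1 ∧ e.1 ≠ D.mate d.1 ∧
      D.left (D.head d) = (d.2 == e.2) ∧ D.left (D.head e) = (d.2 == e.2) := by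
  have a1 : D.mate d.1 = D.head e := by
    rw [← h2]; exact D.mate_mate _
  have a2 : D.mate e.1 = D.head d := by
    rw [← h1]; exact D.mate_mate _
  refine ⟨a1, a2, ?_, ?_, ?_, ?_⟩
  -- Equality of the two starts would make the edge d join the two passages of one crossing, of
  -- which only one is upper.
  · intro h
    have := D.upper_mate d.1
    rw [← h, a2, ← h3, h] at this
    simp at this
  · intro h
    rw [h, D.mate_mate] at a2
    obtain ⟨p, s⟩ := d
    cases s
    · exact D.next_ne (D.next.symm p) (by
        simp only [head, Bool.false_eq_true, if_false] at a2
        rw [Equiv.apply_symm_apply]; exact a2)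
    · exact D.next_ne p a2.symm
  · have := congrArg Prod.snd h1
    simp only [faceNext] at this
    rw [← this]
    cases D.left (D.head d) <;> cases d.2 <;> rfl
  · have := congrArg Prod.snd h2
    simp only [faceNext] at this
    rw [← this]
    cases D.left (D.head e) <;> cases e.2 <;> rfl

/-- Passages joined by an edge of the bigon compare alike with the others and have opposite signs,
so the rows cancel. With δ the product of the directions of the two edges, the linking terms of the
four passages add up to 4δ and their weights to 4, the two crossings having opposite signs. -/
theorem complexity_of_deletesBigon {b : Bool} {D E : KnotDiagram} (h : DeletesBigon b D E) :
    D.complexity = E.complexity + if b then 0 else 8 := by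
  classical
  obtain ⟨d, e, h1, h2, h3, hb, hdel⟩ := h
  obtain ⟨m1, m2, n1, n2, l1, l2⟩ := D.bigon_facts h1 h2 h3
  have n3 : D.mate d.1 ≠ d.1 := D.mate_ne _
  have n4 : D.mate e.1 ≠ e.1 := D.mate_ne _
  have n5 : D.mate e.1 ≠ d.1 := fun h => n2 (by rw [← h, D.mate_mate])
  have n6 : D.mate e.1 ≠ D.mate d.1 := fun h => n1 (D.mateEquiv.injective h)
  have hS : D.crossing d.1 ∪ D.crossing e.1 =
      ↑({d.1, D.mate e.1, D.mate d.1, e.1} : Finset D.Passage) := by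
    ext x
    simp only [crossing, Set.mem_union, Set.mem_insert_iff, Set.mem_singleton_iff,
      Finset.coe_insert, Finset.coe_singleton]
    tauto
  rw [hS] at hdel
  have hsum : ∀ F : D.Passage → ℤ, ∑ x ∈ ({d.1, D.mate e.1, D.mate d.1, e.1} : Finset _), F x =
      F d.1 + (F (D.mate e.1) + (F (D.mate d.1) + F e.1)) := by
    intro F
    rw [Finset.sum_insert, Finset.sum_insert, Finset.sum_insert, Finset.sum_singleton]
    · simpa using n2.symm
    · simpa using ⟨n6, n4⟩
    · simpa using ⟨n5.symm, n3.symm, n1.symm⟩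
  -- The base point is placed just before one edge of the bigon, so that it is on neither edge.
  have hbase : ∃ c, D.edgeEnd d ≠ c ∧ D.edgeEnd e ≠ c := by
    refine ⟨D.edgeStart d, ?_, ?_⟩
    · rw [← next_edgeStart]; exact D.next_ne _
    · unfold edgeEnd edgeStart
      rw [← m1, ← m2]
      rcases d with ⟨p, s⟩
      rcases e with ⟨q, t⟩
      simp only at *
      cases s <;> cases t <;> simp [n1, n3, n6.symm, n4.symm]
  obtain ⟨c, c1, c2⟩ := hbase
  have hk := D.linearizes_pos c
  have e1 := orderSign_edge c d c1
  have e2 := orderSign_edge c e c2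
  have f1 : ∀ y, y ≠ d.1 → y ≠ D.head d → _ := fun y => orderSign_head_of_base c d c1
  have f2 : ∀ y, y ≠ e.1 → y ≠ D.head e → _ := fun y => orderSign_head_of_base c e c2
  rw [← m2] at e1 f1 l1
  rw [← m1] at e2 f2 l2
  have sq : D.sgn (D.mate d.1) = dirSign d.2 * dirSign e.2 := by
    simp only [sgn, l2, dirSign]
    cases d.2 <;> cases e.2 <;> simp
  have sp : D.sgn d.1 = - (dirSign d.2 * dirSign e.2) := by
    rw [← sq, D.sgn_mate]; ring
  have sm : D.sgn (D.mate e.1) = dirSign d.2 * dirSign e.2 := by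
    simp only [sgn, l1, dirSign]
    cases d.2 <;> cases e.2 <;> simp
  have se : D.sgn e.1 = - (dirSign d.2 * dirSign e.2) := by
    rw [← sm, D.sgn_mate]; ring
  have dd := dirSign_mul_self d.2
  have ee := dirSign_mul_self e.2
  rw [complexity_of_deletion hk _ hdel]
  · have t1 : D.linkTerm (D.pos c) d.1 (D.mate e.1) = dirSign d.2 * dirSign e.2 := by
      rw [linkTerm, sp, sm, D.mate_mate, e1, orderSign_comm, e2]
      linear_combination dirSign d.2 * dirSign e.2 * ((dirSign e.2 * dirSign e.2) * dd + ee)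
    have t2 : D.linkTerm (D.pos c) d.1 e.1 = -1 := by
      have g1 := f1 (D.mate d.1) n3 n6.symm
      have g2 := f2 d.1 n1.symm n3.symm
      have g3 := orderSign_mul_self hk.injective n1
      have h4 : orderSign (D.pos c) (D.mate d.1) (D.mate e.1) = orderSign (D.pos c) e.1 d.1 := by
        rw [orderSign_comm, g1, orderSign_comm, neg_neg, g2]
      rw [linkTerm, h4, sp, se, orderSign_comm]
      linear_combination -(dirSign d.2 * dirSign e.2) * (dirSign d.2 * dirSign e.2) *
        g3 - (dirSign e.2 * dirSign e.2) * dd - ee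
    have t3 : D.linkTerm (D.pos c) (D.mate e.1) (D.mate d.1) = -1 := by
      rw [linkTerm_mate_mate, linkTerm_comm, t2]
    have t4 : D.linkTerm (D.pos c) (D.mate d.1) e.1 = dirSign d.2 * dirSign e.2 := by
      
      have := linkTerm_mate_mate (k := D.pos c) d.1 (D.mate e.1)
      rw [D.mate_mate] at this
      rw [this, t1]
    have t5 : D.linkTerm (D.pos c) d.1 (D.mate d.1) = 1 := linkTerm_mate hk.injective _
    have t6 : D.linkTerm (D.pos c) e.1 (D.mate e.1) = 1 := linkTerm_mate hk.injective _
    have w1 : D.passageWeight (D.mate d.1) = D.passageWeight d.1 := by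
      simp [passageWeight, positive, D.upper_mate, D.left_mate]
    have w2 : D.passageWeight e.1 = D.passageWeight (D.mate e.1) := by
      simp [passageWeight, positive, D.upper_mate, D.left_mate]
    have w3 : D.passageWeight (D.mate e.1) = 2 - D.passageWeight d.1 := by
      have l3 : D.left d.1 = !(d.2 == e.2) := by rw [← l2, D.left_mate, Bool.not_not]
      rw [← m2] at h3
      simp only [passageWeight, positive, l1, l3, ← h3]
      cases D.upper d.1 <;> cases (d.2 == e.2) <;> simp
    simp only [hsum]
    simp only [linkTerm_comm (D.mate e.1) d.1, linkTerm_comm (D.mate d.1) d.1,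
      linkTerm_comm e.1 d.1, linkTerm_comm (D.mate d.1) (D.mate e.1),
      linkTerm_comm (D.mate e.1) e.1, linkTerm_comm e.1 (D.mate d.1), linkTerm_self, t1, t2, t3,
      t4, t5, t6, w1, w2, w3]
    have : 4 + 4 * (dirSign d.2 * dirSign e.2) = if b then 0 else 8 := by
      rcases d with ⟨p, s⟩
      rcases e with ⟨q, t⟩
      simp only at hb
      cases b <;> cases s <;> cases t <;> simp [dirSign] at hb ⊢
    rw [← this]
    ring
  · intro y hy
    simp only [Finset.mem_insert, Finset.mem_singleton, not_or] at hy
    obtain ⟨y1, y2, y3, y4⟩ := hy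
    have z1 : D.mate y ≠ d.1 := fun h => y3 (by rw [← h, D.mate_mate])
    have z2 : D.mate y ≠ D.mate e.1 := fun h => y4 (D.mateEquiv.injective h)
    have z3 : D.mate y ≠ D.mate d.1 := fun h => y1 (D.mateEquiv.injective h)
    have z4 : D.mate y ≠ e.1 := fun h => y2 (by rw [← h, D.mate_mate])
    simp only [hsum]
    simp only [linkTerm, D.mate_mate, sp, sq, sm, se, f1 y y1 y2, f1 _ z1 z2, f2 y y4 y3,
      f2 _ z4 z3]
    ring

/-- The facts about the six passages on the boundary of a 3-gon face that are used below. -/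
structure TriangleEnds (D : GaussDiagram) (d : Fin 3 → D.Dart) (u v : Fin 3 → D.Passage) :
    Prop where
  start_eq : ∀ i, (d i).1 = u i
  head_eq : ∀ i, D.head (d i) = v i
  mate_head : ∀ i, D.mate (v i) = u (i + 1)
  left_head : ∀ i, D.left (v i) = ((d i).2 == (d (i + 1)).2)
  start_ne : ∀ i j, i ≠ j → u i ≠ u j
  head_ne : ∀ i j, i ≠ j → v i ≠ v j
  start_ne_head : ∀ i j, u i ≠ v j

theorem triangleEnds {D : GaussDiagram} {d : Fin 3 → D.Dart} (h : D.IsTriangle d) :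
    TriangleEnds D d (fun i => (d i).1) (fun i => D.head (d i)) := by
  obtain ⟨h1, h2⟩ := h
  have hm : ∀ i, D.mate (D.head (d i)) = (d (i + 1)).1 := fun i => by rw [← h1 i]; rfl
  have hm' : ∀ i, D.head (d i) = D.mate (d (i + 1)).1 := fun i => by rw [← hm, D.mate_mate]
  have hcr : ∀ i j, i ≠ j → (d i).1 ≠ (d j).1 ∧ (d i).1 ≠ D.mate (d j).1 := fun i j hij => by
    have := h2 i j hij
    simpa [crossing] using this
  refine ⟨fun _ => rfl, fun _ => rfl, hm, fun i => ?_, fun i j hij => (hcr i j hij).1, ?_, ?_⟩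
  · have := congrArg Prod.snd (h1 i)
    simp only [faceNext] at this
    rw [← this]
    cases D.left (D.head (d i)) <;> cases (d i).2 <;> rfl
  · intro i j hij h
    refine (hcr (i + 1) (j + 1) (by simpa using hij)).1 ?_
    rw [← hm, ← hm, h]
  · intro i j
    simp only [hm']
    by_cases h : i = j + 1
    · rw [h]; exact (D.mate_ne _).symm
    · exact (hcr i (j + 1) h).2

section exchange

variable {D : KnotDiagram} {d : Fin 3 → D.Dart} {u v : Fin 3 → D.Passage}

theorem exchange_start (h : TriangleEnds D.toGaussDiagram d u v) (i : Fin 3) :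
    D.exchange d (u i) = v i := by
  have a := h.start_ne
  have b := h.head_ne
  have c := h.start_ne_head
  simp only [exchange, h.start_eq, h.head_eq, Equiv.Perm.mul_apply]
  fin_cases i <;> simp [Equiv.swap_apply_def, a, b, c, (c _ _).symm]

theorem exchange_head (h : TriangleEnds D.toGaussDiagram d u v) (i : Fin 3) :
    D.exchange d (v i) = u i := by
  have a := h.start_ne
  have b := h.head_ne
  have c := h.start_ne_head
  simp only [exchange, h.start_eq, h.head_eq, Equiv.Perm.mul_apply]
  fin_cases i <;> simp [Equiv.swap_apply_def, a, b, c, (c _ _).symm]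

theorem exchange_of_ne (h : TriangleEnds D.toGaussDiagram d u v) {x : D.Passage}
    (hu : ∀ i, x ≠ u i) (hv : ∀ i, x ≠ v i) : D.exchange d x = x := by
  simp [exchange, h.start_eq, h.head_eq, Equiv.swap_apply_of_ne_of_ne, hu, hv]

theorem exchange_cases (h : TriangleEnds D.toGaussDiagram d u v) (x : D.Passage) :
    (∃ i, x = u i) ∨ (∃ i, x = v i) ∨
      ((∀ i, x ≠ u i) ∧ (∀ i, x ≠ v i) ∧ D.exchange d x = x) := by
  by_cases hu : ∃ i, x = u i
  · exact Or.inl hu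
  by_cases hv : ∃ i, x = v i
  · exact Or.inr (Or.inl hv)
  push Not at hu hv
  exact Or.inr (Or.inr ⟨hu, hv, exchange_of_ne h hu hv⟩)

theorem exchange_exchange (h : TriangleEnds D.toGaussDiagram d u v) (x : D.Passage) :
    D.exchange d (D.exchange d x) = x := by
  rcases exchange_cases h x with ⟨i, rfl⟩ | ⟨i, rfl⟩ | ⟨-, -, hx⟩
  · rw [exchange_start h, exchange_head h]
  · rw [exchange_head h, exchange_start h]
  · rw [hx, hx]

end exchange

end KnotDiagram

namespace GaussDiagram

theorem meetsInOrder_iff (D : GaussDiagram) (p q r : D.Passage) :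
    D.MeetsInOrder p q r ↔ D.pos p q < D.pos p r := by
  constructor
  · rintro ⟨k, hk, h⟩
    by_contra h'
    exact h _ ((not_lt.1 h').trans (D.pos_le hk)) (D.pow_pos_apply p r)
  · intro h
    refine ⟨D.pos p q, D.pow_pos_apply p q, fun j hj hr => ?_⟩
    have := D.pos_le hr
    omega

theorem Linearizes.lt_of_pos_lt_of_le {K : Type*} [LinearOrder K] {D : GaussDiagram}
    {k : D.Passage → K} (hk : D.Linearizes k) {p x y : D.Passage} (hy : k p ≤ k y)
    (h : D.pos p x < D.pos p y) : k x < k y := by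
  have key : ∀ i ≤ D.pos p y, k ((D.next ^ i) p) ≤ k y := by
    intro i
    induction i with
    | zero => intro _; exact hy
    | succ i ih =>
      intro hi
      have h1 : (D.next ^ i) p ≠ y := fun e => by
        have := D.pos_le e
        omega
      have h2 := lt_of_le_of_ne (ih (by omega)) (hk.injective.ne h1)
      rw [pow_succ', Equiv.Perm.mul_apply]
      rcases hk.succ ((D.next ^ i) p) with ⟨h3, h4⟩ | ⟨h3, h4⟩
      · rcases h4 y with h5 | h5
        · exact absurd h2 h5.not_gt
        · exact h5
      · exact absurd h2 (h3 y).not_gt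
  have h1 := key _ h.le
  rw [D.pow_pos_apply] at h1
  exact lt_of_le_of_ne h1 (hk.injective.ne fun e => by rw [e] at h; exact lt_irrefl _ h)

theorem Linearizes.meetsInOrder_iff {K : Type*} [LinearOrder K] {D : GaussDiagram}
    {k : D.Passage → K} (hk : D.Linearizes k) {p q r : D.Passage} (hq : k p ≤ k q)
    (hr : k p ≤ k r) : D.MeetsInOrder p q r ↔ k q < k r := by
  rw [D.meetsInOrder_iff]
  refine ⟨hk.lt_of_pos_lt_of_le hr, fun h => ?_⟩
  by_contra h'
  rcases Nat.eq_or_lt_of_le (not_lt.1 h') with h1 | h1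
  · rw [D.pos_injective p h1] at h; exact lt_irrefl _ h
  · exact lt_asymm h (hk.lt_of_pos_lt_of_le hq h1)

-- If the edges are met in the order 0, 1, 2, then q counts the edges directed along the knot,
-- otherwise those directed against it; reversing all three directions changes the sign of their
-- product.
open Classical in
theorem triangleSign_eq (D : GaussDiagram) (d : Fin 3 → D.Dart) :
    D.triangleSign d = (if D.MeetsInOrder (d 0).1 (d 1).1 (d 2).1 then 1 else -1) *
      (dirSign (d 0).2 * dirSign (d 1).2 * dirSign (d 2).2) * -1 := by
  have h1 : ∀ (P : Fin 3 → Prop) [DecidablePred P], ((-1 : ℤ)) ^ (Finset.univ.filter P).card =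
      ∏ i, if P i then -1 else 1 := by
    intro P _
    rw [Finset.prod_ite]
    simp
  unfold triangleSign
  rw [h1, Fin.prod_univ_three]
  by_cases hM : D.MeetsInOrder (d 0).1 (d 1).1 (d 2).1 <;> simp only [hM, if_true, if_false] <;>
    cases (d 0).2 <;> cases (d 1).2 <;> cases (d 2).2 <;> simp [dirSign]

theorem sgn_eq_dirSign (D : GaussDiagram) (p : D.Passage) : D.sgn p = dirSign (D.left p) := rfl

theorem dirSign_beq (a b : Bool) : dirSign (a == b) = dirSign a * dirSign b := by
  cases a <;> cases b <;> rfl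

theorem dirSign_not (a : Bool) : dirSign (!a) = -dirSign a := by
  cases a <;> rfl

end GaussDiagram

namespace KnotDiagram

open GaussDiagram

-- After the move the linear order is the old one composed with the exchange of the ends of each
-- edge. Only comparisons of the two ends of an edge are reversed, so the count changes by multiples
-- of the three linking terms of these pairs.
open Classical in
theorem complexity_of_movesTriangle {b : Bool} {D E : KnotDiagram} (h : MovesTriangle b D E) :
    D.complexity = E.complexity + if b then 8 else -8 := by
  obtain ⟨d, f, htri, -, -, hmate, hupper, hleft, hnext, -, hsign⟩ := h
  have T := triangleEnds htri
  set u : Fin 3 → D.Passage := fun i => (d i).1 with hu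
  set v : Fin 3 → D.Passage := fun i => D.head (d i) with hv
  set ex := D.exchange d with hex
  have exu : ∀ i, ex (u i) = v i := exchange_start T
  have exv : ∀ i, ex (v i) = u i := exchange_head T
  have exex : ∀ x, ex (ex x) = x := exchange_exchange T
  -- With this base point no edge of the triangle is cut, and the strand of `d 0` is the first of
  -- the three.
  set c := D.edgeStart (d 0) with hc
  have hends : ∀ i, D.edgeEnd (d i) ≠ c := by
    intro i
    have h1 := T.start_ne i 0
    have h2 := T.head_ne i 0
    have h3 := T.start_ne_head
    by_cases hi : i = 0
    · subst hi
      rw [← next_edgeStart]; exact D.next_ne _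
    · have h4 := h1 hi
      have h5 := h2 hi
      have h6 := h3 i 0
      have h7 := h3 0 i
      simp only [hu, hv] at h4 h5 h6 h7
      simp only [hc, edgeEnd, edgeStart]
      split_ifs <;> first | assumption | exact Ne.symm (by assumption)
  set k := D.pos c with hkdef
  have hk : D.Linearizes k := D.linearizes_pos c
  have huv : ∀ i, orderSign k (u i) (v i) = dirSign (d i).2 := fun i =>
    orderSign_edge c (d i) (hends i)
  have hvz : ∀ i z, z ≠ u i → z ≠ v i → orderSign k (v i) z = orderSign k (u i) z := fun i z =>
    orderSign_head_of_base c (d i) (hends i)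
  have hmv : ∀ i, D.mate (v i) = u (i + 1) := T.mate_head
  have hmu : ∀ i, D.mate (u (i + 1)) = v i := fun i => by rw [← hmv, D.mate_mate]
  have sv : ∀ i, D.sgn (v i) = dirSign (d i).2 * dirSign (d (i + 1)).2 := fun i => by
    rw [sgn_eq_dirSign, T.left_head, dirSign_beq]
  have su : ∀ i, D.sgn (u (i + 1)) = -(dirSign (d i).2 * dirSign (d (i + 1)).2) := fun i => by
    rw [← hmv, D.sgn_mate, sv]
  -- the effect of the exchange on the order
  have hstep : ∀ x z, z ≠ x → z ≠ ex x → orderSign k (ex x) z = orderSign k x z := by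
    intro x z h1 h2
    rcases exchange_cases T x with ⟨i, rfl⟩ | ⟨i, rfl⟩ | ⟨-, -, hx⟩
    · rw [exu] at h2 ⊢
      exact hvz i z h1 h2
    · rw [exv] at h2 ⊢
      exact (hvz i z h2 h1).symm
    · rw [← hex] at hx
      rw [hx]
  have hexsign : ∀ x y, orderSign k (ex x) (ex y) =
      (1 - 2 * if y = ex x then 1 else 0) * orderSign k x y := by
    intro x y
    by_cases h1 : y = ex x
    · subst h1
      rw [exex, orderSign_comm]
      simp
    · by_cases h2 : y = x
      · subst h2
        simp [orderSign_self]
      · have h3 : ex y ≠ x := fun e => h1 (by rw [← e, exex])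
        have h4 : ex y ≠ ex x := fun e => h2 (ex.injective e)
        rw [hstep x _ h3 h4, orderSign_comm, hstep y x (Ne.symm h2) (Ne.symm h3), orderSign_comm]
        simp [h1]
  -- The two order signs in one term are never reversed together: the mates of the ends of an edge
  -- lie on the two other strands.
  have hmex : ∀ x, ex x ≠ x → D.mate (ex x) ≠ ex (D.mate x) := by
    intro x hx
    rcases exchange_cases T x with ⟨i, rfl⟩ | ⟨i, rfl⟩ | ⟨-, -, hx'⟩
    · obtain ⟨j, rfl⟩ : ∃ j, i = j + 1 := ⟨i - 1, by simp⟩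
      rw [exu, hmv, hmu, exv]
      exact T.start_ne _ _ (by fin_cases j <;> decide)
    · obtain ⟨j, rfl⟩ : ∃ j, i = j + 1 := ⟨i - 1, by simp⟩
      rw [exv, hmu, hmv, exu]
      exact T.head_ne _ _ (by fin_cases j <;> decide)
    · exact absurd hx' hx
  -- the order of the passages in `E`
  set l : E.Passage → ℕ := fun x => k (ex (f.symm x)) with hl
  have hE : E.Linearizes l := by
    refine ⟨hk.injective.comp (ex.injective.comp f.symm.injective), fun x => ?_⟩
    obtain ⟨y, rfl⟩ : ∃ y, x = f (ex y) := ⟨ex (f.symm x), by rw [exex]; simp⟩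
    rw [hnext]
    have hsur : ∀ P : ℕ → Prop, (∀ z, P (k z)) → ∀ z, P (l z) := fun P h z => h _
    have e1 : l (f (ex y)) = k y := by simp only [hl, Equiv.symm_apply_apply, exex]
    have e2 : l (f (ex (D.next y))) = k (D.next y) := by
      simp only [hl, Equiv.symm_apply_apply, exex]
    unfold IsCyclicSucc
    rw [e1, e2]
    rcases hk.succ y with ⟨h1, h2⟩ | ⟨h1, h2⟩
    · exact Or.inl ⟨h1, hsur (fun t => t ≤ k y ∨ k (D.next y) ≤ t) h2⟩
    · exact Or.inr ⟨hsur (fun t => t ≤ k y) h1, hsur (fun t => k (D.next y) ≤ t) h2⟩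
  have hlinkE : E.linking l = ∑ x, ∑ y, D.sgn x * D.sgn y *
      (orderSign k (ex x) (ex y) * orderSign k (ex (D.mate x)) (ex (D.mate y))) := by
    unfold linking
    rw [← Equiv.sum_comp f]
    refine Finset.sum_congr rfl fun x _ => ?_
    rw [← Equiv.sum_comp f]
    refine Finset.sum_congr rfl fun y _ => ?_
    have hos : ∀ x y, orderSign l (f x) (f y) = orderSign k (ex x) (ex y) := fun x y => by
      apply orderSign_congr <;> simp [hl]
    rw [hmate, hmate, hos, hos]
    simp [sgn, hleft]
  have hterm : ∀ x y, D.sgn x * D.sgn y *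
      (orderSign k (ex x) (ex y) * orderSign k (ex (D.mate x)) (ex (D.mate y))) =
      D.linkTerm k x y - 2 * (if y = ex x then D.linkTerm k x y else 0) -
        2 * (if D.mate y = ex (D.mate x) then D.linkTerm k (D.mate x) (D.mate y) else 0) := by
    intro x y
    rw [hexsign, hexsign, linkTerm_mate_mate]
    by_cases h1 : y = ex x
    · by_cases h2 : D.mate y = ex (D.mate x)
      · have : ex x = x := by
          by_contra h3
          exact hmex x h3 (by rw [← h1, h2])
        have h4 : y = x := h1.trans this
        subst h4
        simp [orderSign_self, linkTerm_self]
      · simp [← h1, h2, linkTerm]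
        ring
    · by_cases h2 : D.mate y = ex (D.mate x)
      · simp [h1, ← h2, linkTerm]
        ring
      · simp [h1, h2, linkTerm]
  have hsum1 : ∑ x, ∑ y, (if y = ex x then D.linkTerm k x y else 0) =
      ∑ x, D.linkTerm k x (ex x) :=
    Finset.sum_congr rfl fun x _ => by simp
  have hsum2 : ∑ x, ∑ y, (if D.mate y = ex (D.mate x) then
      D.linkTerm k (D.mate x) (D.mate y) else 0) = ∑ x, D.linkTerm k x (ex x) := by
    rw [← hsum1, ← D.sum_mate (fun x => ∑ y, if y = ex x then D.linkTerm k x y else 0)]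
    refine Finset.sum_congr rfl fun x _ => ?_
    exact D.sum_mate (fun y => if y = ex (D.mate x) then D.linkTerm k (D.mate x) y else 0)
  have hsix : ∑ x, D.linkTerm k x (ex x) = 2 * ∑ i, D.linkTerm k (u i) (v i) := by
    let e : Fin 3 ⊕ Fin 3 → D.Passage := Sum.elim u v
    have he : Function.Injective e := by
      apply Function.Injective.sumElim
      · intro i j hij; by_contra h; exact T.start_ne i j h hij
      · intro i j hij; by_contra h; exact T.head_ne i j h hij
      · exact T.start_ne_head
    rw [← Fintype.sum_of_injective e he (fun i => D.linkTerm k (e i) (ex (e i)))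
      (fun x => D.linkTerm k x (ex x)) ?_ (fun _ => rfl), Fintype.sum_sum_type]
    · simp only [e, Sum.elim_inl, Sum.elim_inr, exu, exv, fun i => linkTerm_comm (v i) (u i) (k := k)]
      ring
    · intro x hx
      rcases exchange_cases T x with ⟨i, rfl⟩ | ⟨i, rfl⟩ | ⟨-, -, hx'⟩
      · exact absurd ⟨Sum.inl i, rfl⟩ hx
      · exact absurd ⟨Sum.inr i, rfl⟩ hx
      · rw [← hex] at hx'
        rw [hx', linkTerm_self]
  -- the order of the three strands
  have hvu : ∀ i j, i ≠ j → orderSign k (v i) (u j) = orderSign k (u i) (u j) := fun i j hij =>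
    hvz i _ (T.start_ne j i hij.symm) (T.start_ne_head j i)
  have hvv : ∀ i j, i ≠ j → orderSign k (v i) (v j) = orderSign k (u i) (u j) := fun i j hij => by
    rw [hvz i _ (T.start_ne_head i j).symm (T.head_ne j i hij.symm), orderSign_comm,
      hvu j i hij.symm, ← orderSign_comm]
  have hfirst : ∀ j, j ≠ 0 → orderSign k (u 0) (u j) = 1 := by
    intro j hj
    have hmin : ∀ z, z ≠ c → orderSign k c z = 1 := fun z hz =>
      orderSign_of_lt (by rw [hkdef, D.pos_self]; exact D.pos_pos hz)
    have hcc : c = u 0 ∨ c = v 0 := by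
      simp only [hc, edgeStart]
      split_ifs
      · exact Or.inl rfl
      · exact Or.inr rfl
    rcases hcc with h | h
    · rw [← h]
      exact hmin _ (by rw [h]; exact T.start_ne j 0 hj)
    · rw [← hvu 0 j (Ne.symm hj), ← h]
      exact hmin _ (by rw [h]; exact T.start_ne_head j 0)
  have hlt_of : ∀ x y, orderSign k x y = 1 → k x < k y := by
    intro x y h
    unfold orderSign at h
    split_ifs at h with h1
    · exact h1
    · exact absurd h (by decide)
  have hM : E.MeetsInOrder (f (u 0)) (f (u 1)) (f (u 2)) ↔ k (v 1) < k (v 2) := by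
    have e : ∀ i, l (f (u i)) = k (v i) := fun i => by
      simp only [hl, Equiv.symm_apply_apply, exu]
    rw [hE.meetsInOrder_iff]
    · rw [e, e]
    · rw [e, e]; exact (hlt_of _ _ (by rw [hvv 0 1 (by decide), hfirst 1 (by decide)])).le
    · rw [e, e]; exact (hlt_of _ _ (by rw [hvv 0 2 (by decide), hfirst 2 (by decide)])).le
  have horder : orderSign k (u 2) (u 1) =
      -(if E.MeetsInOrder (f (u 0)) (f (u 1)) (f (u 2)) then 1 else -1) := by
    rw [hM, ← hvv 2 1 (by decide), orderSign_comm]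
    by_cases h : k (v 1) < k (v 2)
    · rw [orderSign_of_lt h, if_pos h]
    · have h1 := lt_of_le_of_ne (not_lt.1 h) (hk.injective.ne (T.head_ne 2 1 (by decide)))
      rw [orderSign_of_gt h1, if_neg h]
  -- The mates of the ends of one edge lie on the two other edges, so this linking term compares the
  -- order of the two other strands.
  have hlink : ∀ i, D.linkTerm k (u (i + 1)) (v (i + 1)) =
      -(dirSign (d 0).2 * dirSign (d 1).2 * dirSign (d 2).2) *
        orderSign k (u i) (u (i + 1 + 1)) := by
    intro i
    have hne : i ≠ i + 1 + 1 := by fin_cases i <;> decide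
    rw [linkTerm, su, sv, huv, hmu, hmv, hvu i _ hne]
    have h1 := dirSign_mul_self (d (i + 1)).2
    have h2 : dirSign (d 0).2 * dirSign (d 1).2 * dirSign (d 2).2 =
        dirSign (d i).2 * dirSign (d (i + 1)).2 * dirSign (d (i + 1 + 1)).2 := by
      fin_cases i
      · rfl
      · change _ = dirSign (d 1).2 * dirSign (d 2).2 * dirSign (d 0).2; ring
      · change _ = dirSign (d 2).2 * dirSign (d 0).2 * dirSign (d 1).2; ring
    rw [h2]
    linear_combination (-(dirSign (d i).2 * dirSign (d (i + 1)).2 * dirSign (d (i + 1 + 1)).2) *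
        orderSign k (u i) (u (i + 1 + 1))) * h1
  -- As strand 0 comes first, the terms of edges 1 and 2 cancel. The remaining one depends on the
  -- order of strands 1 and 2, which also enters the sign of the triangle.
  have hthree : ∑ i, D.linkTerm k (u i) (v i) =
      (dirSign (d 0).2 * dirSign (d 1).2 * dirSign (d 2).2) *
        (if E.MeetsInOrder (f (u 0)) (f (u 1)) (f (u 2)) then 1 else -1) := by
    have h0 : D.linkTerm k (u 1) (v 1) = _ := hlink 0
    have h1 : D.linkTerm k (u 2) (v 2) = _ := hlink 1
    have h2 : D.linkTerm k (u 0) (v 0) = _ := hlink 2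
    have a0 : orderSign k (u 0) (u (0 + 1 + 1)) = 1 := hfirst 2 (by decide)
    have a1 : orderSign k (u 1) (u (1 + 1 + 1)) = -1 := by
      rw [orderSign_comm]; exact congrArg Neg.neg (hfirst 1 (by decide))
    have a2 : orderSign k (u 2) (u (2 + 1 + 1)) = orderSign k (u 2) (u 1) := rfl
    rw [a0] at h0
    rw [a1] at h1
    rw [a2, horder] at h2
    rw [Fin.sum_univ_three, h0, h1, h2]
    ring
  have hts := E.triangleSign_eq (fun i => (f (d i).1, !(d i).2))
  simp only [dirSign_not] at hts
  rw [hsign] at hts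
  have hweight : ∑ x, E.passageWeight x = ∑ x, D.passageWeight x := by
    rw [← Equiv.sum_comp f]
    exact Finset.sum_congr rfl fun x _ => by simp [passageWeight, positive, hupper, hleft]
  rw [D.complexity_eq hk, E.complexity_eq hE, hlinkE, hweight, linking_eq_sum_linkTerm]
  simp only [hterm, Finset.sum_sub_distrib, ← Finset.mul_sum, hsum1, hsum2, hsix, hthree]
  have hfin : (if b = true then (8 : ℤ) else -8) = 8 * if b = true then 1 else -1 := by
    cases b <;> rfl
  rw [hfin, hts]
  ring

/-- The effect of a move on the complexity. -/
theorem complexity_of_unknots {D : KnotDiagram} {ms : List Move} (h : Unknots D ms) :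
    D.complexity = 8 * ((ms.count (.deleteI true) : ℤ) - ms.count (.createI true) +
      ms.count (.deleteII false) - ms.count (.createII false) +
      ms.count (.moveIII true) - ms.count (.moveIII false)) := by
  induction h with
  | nil D hD =>
    simp [complexity, linking]
  | cons D E m ms hstep _ ih =>
    rcases m with b | b | b | b | b
    · rw [complexity_of_deletesMonogon hstep, ih]
      cases b <;> (simp; try ring)
    · have := complexity_of_deletesMonogon hstep
      rw [← sub_eq_iff_eq_add] at this
      rw [← this, ih]
      cases b <;> (simp; try ring)
    · rw [complexity_of_deletesBigon hstep, ih]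
      cases b <;> (simp; try ring)
    · have := complexity_of_deletesBigon hstep
      rw [← sub_eq_iff_eq_add] at this
      rw [← this, ih]
      cases b <;> (simp; try ring)
    · rw [complexity_of_movesTriangle hstep, ih]
      cases b <;> (simp; try ring)

end KnotDiagram

/-! ### Deletions preserve planarity. -/

namespace GaussDiagram

/-- `f` embeds the passages of `E` into those of `D`, and `E` is obtained from `D` by deleting the
passages in `S`. -/
structure DeletionMap (D E : GaussDiagram) (S : Set D.Passage) (f : E.Passage → D.Passage) :
    Prop where
  injective : Function.Injective f
  range_eq : Set.range f = Sᶜ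
  mate : ∀ x, f (E.mate x) = D.mate (f x)
  upper : ∀ x, E.upper x = D.upper (f x)
  left : ∀ x, E.left x = D.left (f x)
  next : ∀ x, ∃ k : ℕ, f (E.next x) = (D.next ^ (k + 1)) (f x) ∧
      ∀ j < k, (D.next ^ (j + 1)) (f x) ∈ S

theorem head_reverse (D : GaussDiagram) (d : D.Dart) : D.head (D.head d, !d.2) = d.1 := by
  rcases d with ⟨p, b⟩
  cases b <;> simp [head]

theorem head_injective (D : GaussDiagram) {x y : D.Passage} {b : Bool}
    (h : D.head (x, b) = D.head (y, b)) : x = y := by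
  cases b <;> simpa [head] using h

section Deletion

variable {D E : GaussDiagram} {S : Set D.Passage} {f : E.Passage → D.Passage}

theorem DeletionMap.notMem (h : DeletionMap D E S f) (x : E.Passage) : f x ∉ S := by
  have : f x ∈ Sᶜ := by rw [← h.range_eq]; exact ⟨x, rfl⟩
  exact this

theorem DeletionMap.exists_eq (h : DeletionMap D E S f) {z : D.Passage} (hz : z ∉ S) :
    ∃ x, f x = z := by
  have : z ∈ Set.range f := by rw [h.range_eq]; exact hz
  exact this

theorem DeletionMap.card_add (h : DeletionMap D E S f) :
    Nat.card E.Passage + S.ncard = Nat.card D.Passage := by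
  rw [← Set.ncard_add_ncard_compl S, ← h.range_eq, Set.ncard_range_of_injective h.injective]
  ring

/-- Labels of the directed edges that are unchanged when passing through a deleted passage give
labels of the faces of the diagram that is left. -/
theorem DeletionMap.ncard_range_le (h : DeletionMap D E S f) (hE : Nonempty E.Passage)
    {α : Type*} (c : D.Dart → α) (h1 : ∀ d, D.head d ∈ S → c (D.head d, d.2) = c d)
    (h2 : ∀ d, D.head d ∉ S → c (D.faceNext d) = c d) :
    (Set.range c).ncard ≤ Nat.card E.Face := by
  -- An edge of E is a chain of edges of D through deleted passages; the label is constant along the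
  -- chain and around the corner at its end.
  have inv : ∀ d : E.Dart, c (f (E.faceNext d).1, (E.faceNext d).2) = c (f d.1, d.2) := by
    rintro ⟨x, b⟩
    simp only [faceNext, h.mate, h.left]
    cases b
    · obtain ⟨y, rfl⟩ := E.next.surjective x
      simp only [head, Bool.false_eq_true, if_false, Equiv.symm_apply_apply]
      obtain ⟨j, hj, hS⟩ := h.next y
      rw [hj]
      have key : ∀ i ≤ j, c ((D.next ^ (i + 1)) (f y), false) = c (D.next (f y), false) := by
        intro i
        induction i with
        | zero => intro _; simp
        | succ i ih =>
          intro hi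
          rw [← ih (by omega)]
          have := h1 ((D.next ^ (i + 1 + 1)) (f y), false)
          rw [pow_succ' D.next (i + 1), Equiv.Perm.mul_apply] at this ⊢
          simp only [head, Bool.false_eq_true, if_false, Equiv.symm_apply_apply] at this
          exact (this (hS i (by omega))).symm
      rw [key j le_rfl]
      have := h2 (D.next (f y), false)
      simp only [head, faceNext, Bool.false_eq_true, if_false, Equiv.symm_apply_apply] at this
      exact this (h.notMem y)
    · simp only [head, if_true]
      obtain ⟨j, hj, hS⟩ := h.next x
      have key : ∀ i ≤ j, c ((D.next ^ i) (f x), true) = c (f x, true) := by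
        intro i
        induction i with
        | zero => intro _; simp
        | succ i ih =>
          intro hi
          rw [← ih (by omega)]
          have := h1 ((D.next ^ i) (f x), true)
          simp only [head, if_true, ← Equiv.Perm.mul_apply, ← pow_succ'] at this
          exact this (hS i (by omega))
      rw [← key j le_rfl]
      have := h2 ((D.next ^ j) (f x), true)
      simp only [head, faceNext, if_true, ← Equiv.Perm.mul_apply, ← pow_succ', ← hj] at this
      exact this (h.notMem _)
  let g : E.Face → α := Quot.lift (fun d => c (f d.1, d.2)) (fun d e hde => by rw [← hde, inv])
  have hg : ∀ x b, c (f x, b) ∈ Set.range g := fun x b => ⟨E.faceOf (x, b), rfl⟩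
  have hsub : Set.range c ⊆ Set.range g := by
    rintro _ ⟨⟨z, b⟩, rfl⟩
    obtain ⟨x⟩ := hE
    cases b
    · obtain ⟨m, hm⟩ := D.exists_pow_next z (f x)
      induction m generalizing z with
      | zero => rw [show z = f x from hm]; exact hg x _
      | succ m ih =>
        rw [pow_succ, Equiv.Perm.mul_apply] at hm
        have h3 := ih (D.next z) hm
        by_cases hz : z ∈ S
        · have := h1 (D.next z, false)
          simp only [head, Bool.false_eq_true, if_false, Equiv.symm_apply_apply] at this
          rw [this hz]
          exact h3
        · obtain ⟨y, rfl⟩ := h.exists_eq hz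
          exact hg y _
    · obtain ⟨m, rfl⟩ := D.exists_pow_next (f x) z
      induction m with
      | zero => exact hg x _
      | succ m ih =>
        by_cases hz : (D.next ^ (m + 1)) (f x) ∈ S
        · have := h1 ((D.next ^ m) (f x), true)
          simp only [head, if_true, ← Equiv.Perm.mul_apply, ← pow_succ'] at this
          rw [this hz]
          exact ih
        · obtain ⟨y, hy⟩ := h.exists_eq hz
          rw [← hy]
          exact hg y _
  calc (Set.range c).ncard ≤ (Set.range g).ncard := Set.ncard_le_ncard hsub (Set.finite_range g)
    _ ≤ Nat.card E.Face := by
      rw [← Set.image_univ, ← Set.ncard_univ]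
      exact Set.ncard_image_le

end Deletion

end GaussDiagram

namespace KnotDiagram

open GaussDiagram

theorem card_le_ncard_of_forall {α : Type*} [Finite α] (T : Set α) (F : Finset α)
    (h : ∀ x, x ∉ F → x ∈ T) : Nat.card α ≤ T.ncard + F.card := by
  classical
  have h1 : (Set.univ : Set α) ⊆ T ∪ ↑F := fun x _ => by
    by_cases hx : x ∈ F
    · exact Or.inr hx
    · exact Or.inl (h x hx)
  have h2 := (Set.ncard_le_ncard h1 (Set.toFinite _)).trans (Set.ncard_union_le _ _)
  rwa [Set.ncard_univ, Set.ncard_coe_finset] at h2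

-- Removing one crossing removes two passages, so it suffices that E has at least F - 1 faces, where
-- F is the number of faces of D.
open Classical in
theorem planar_of_deletesMonogon (D : KnotDiagram) (E : GaussDiagram) {f : E.Passage → D.Passage}
    {d : D.Dart} (hd : D.faceNext d = d) (h : DeletionMap D.toGaussDiagram E (D.crossing d.1) f)
    (hE : Nonempty E.Passage) : 2 * Nat.card E.Face = Nat.card E.Passage + 4 := by
  obtain ⟨p, s⟩ := d
  have a1 : D.mate (D.head (p, s)) = p := congrArg Prod.fst hd
  have a2 : (D.left (D.head (p, s)) == s) = s := congrArg Prod.snd hd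
  have hm : D.head (p, s) = D.mate p := by rw [← D.mate_mate (D.head (p, s)), a1]
  have hr := D.head_reverse (p, s)
  rw [hm] at a2 hr
  simp only at hr
  have hl : D.left (D.mate p) = true := by cases h : D.left (D.mate p) <;> cases s <;> simp_all
  have hl' : D.left p = false := by simpa [D.left_mate] using hl
  have hne := D.mate_ne p
  have hcard := h.card_add
  have hS : (D.crossing p).ncard = 2 := Set.ncard_pair hne.symm
  rw [hS] at hcard
  -- The loop is pulled straight: its inner side takes the face that was outside the loop, its outer
  -- side the corner opposite the monogon. Only the label of the monogon can be lost.
  let c : D.Dart → D.Face := fun δ => if δ = (p, s) then D.faceOf (D.mate p, s) else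
    if δ = (D.mate p, !s) then D.faceOf (p, !s) else D.faceOf δ
  have c1 : c (p, s) = D.faceOf (D.mate p, s) := if_pos rfl
  have c2 : c (D.mate p, !s) = D.faceOf (p, !s) := by
    simp [c, hne]
  have c3 : ∀ δ, δ ≠ (p, s) → δ ≠ (D.mate p, !s) → c δ = D.faceOf δ := fun δ h1 h2 => by
    simp only [c]; rw [if_neg h1, if_neg h2]
  have hface : D.faceOf (D.mate p, !s) = D.faceOf (D.mate p, s) := by
    rw [← D.faceOf_faceNext (D.mate p, !s)]
    simp only [faceNext, hr, hl']
    simp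
  have hrange := h.ncard_range_le hE c ?_ ?_
  · have hF := card_le_ncard_of_forall (Set.range c) {D.faceOf (p, s)} (by
      intro x hx
      simp only [Finset.mem_singleton] at hx
      obtain ⟨δ, rfl⟩ := Quot.exists_rep x
      by_cases e1 : δ = (D.mate p, !s)
      · exact ⟨(p, s), by rw [c1, ← hface, e1]; rfl⟩
      · exact ⟨δ, c3 δ (fun e => hx (by rw [e]; rfl)) e1⟩)
    have hpl := D.planar ⟨p⟩
    apply E.planar_of_le
    simp only [Finset.card_singleton] at hF
    omega
  · rintro ⟨z, b⟩ hz
    simp only [crossing, Set.mem_insert_iff, Set.mem_singleton_iff] at hz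
    rcases hz with hz | hz <;> by_cases hb : b = s
    · subst hb
      rw [hz, c1, c3 (z, b)]
      · rw [← D.faceOf_faceNext (z, b)]
        simp only [faceNext, hz, hl']
        rw [← hface]
        simp
      · intro e
        simp only [Prod.mk.injEq, and_true] at e
        rw [e, hm] at hz
        exact hne hz
      · simp
    · have hb' : b = !s := Bool.eq_not.2 hb
      subst hb'
      have : z = D.mate p := D.head_injective (hz.trans hr.symm)
      simp only
      rw [this, c2, ← this, hz, c3]
      · simp
      · simp [hne.symm]
    · subst hb
      have : z = p := D.head_injective (hz.trans hm.symm)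
      simp only
      rw [hz, this, c1, c3]
      · simp [hne]
      · simp
    · have hb' : b = !s := Bool.eq_not.2 hb
      subst hb'
      simp only
      rw [hz, c2, c3]
      · rw [← D.faceOf_faceNext (z, !s)]
        simp only [faceNext, hz, hl, D.mate_mate]
        simp
      · simp
      · intro e
        simp only [Prod.mk.injEq, and_true] at e
        rw [e, hr] at hz
        exact hne hz.symm
  · intro δ hδ
    have b1 : ∀ t, D.faceNext δ ≠ (p, t) := by
      intro t e
      apply hδ
      have := congrArg Prod.fst e
      simp only [faceNext] at this
      right
      rw [← this, D.mate_mate]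
      rfl
    have b2 : ∀ t, D.faceNext δ ≠ (D.mate p, t) := by
      intro t e
      apply hδ
      have := congrArg Prod.fst e
      simp only [faceNext] at this
      left
      exact D.mateEquiv.injective this
    rw [c3 _ (b1 _) (b2 _), c3 δ, D.faceOf_faceNext]
    · rintro rfl
      exact hδ (Or.inr hm)
    · rintro rfl
      exact hδ (Or.inl hr)

theorem faceOf_eq_of_head (D : GaussDiagram) {δ : D.Dart} {r : D.Passage} (h : D.head δ = r) :
    D.faceOf δ = D.faceOf (D.mate r, D.left r == δ.2) := by
  rw [← D.faceOf_faceNext, faceNext, h]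

-- Four passages disappear, so two faces may be lost: the bigon, and one more because the faces
-- beyond its two corners merge.
open Classical in
theorem planar_of_deletesBigon (D : KnotDiagram) (E : GaussDiagram) {f : E.Passage → D.Passage}
    {d e : D.Dart} (h1 : D.faceNext d = e) (h2 : D.faceNext e = d)
    (h3 : D.upper d.1 = D.upper (D.head d))
    (h : DeletionMap D.toGaussDiagram E (D.crossing d.1 ∪ D.crossing e.1) f)
    (hE : Nonempty E.Passage) : 2 * Nat.card E.Face = Nat.card E.Passage + 4 := by
  obtain ⟨m1, m2, n1, n2, l1, l2⟩ := D.bigon_facts h1 h2 h3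
  have r1 := D.head_reverse d
  have r2 := D.head_reverse e
  obtain ⟨p, s⟩ := d
  obtain ⟨q, t⟩ := e
  simp only at m1 m2 n1 n2 l1 l2 r1 r2 h
  rw [← m2] at l1 r1
  rw [← m1] at l2 r2
  have l3 : D.left p = !(s == t) := by rw [← l2, D.left_mate, Bool.not_not]
  have l4 : D.left q = !(s == t) := by rw [← l1, D.left_mate, Bool.not_not]
  have n3 : D.mate p ≠ p := D.mate_ne _
  have n4 : D.mate q ≠ q := D.mate_ne _
  have n5 : D.mate q ≠ p := fun h => n2 (by rw [← h, D.mate_mate])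
  have n6 : D.mate q ≠ D.mate p := fun h => n1 (D.mateEquiv.injective h)
  have hcard := h.card_add
  have hS : (D.crossing p ∪ D.crossing q).ncard = 4 := by
    rw [Set.ncard_union_eq]
    · rw [crossing, crossing, Set.ncard_pair n3.symm, Set.ncard_pair n4.symm]
    · rw [Set.disjoint_left]
      simp only [crossing, Set.mem_insert_iff, Set.mem_singleton_iff]
      rintro x (rfl | rfl) (h | h)
      · exact n1 h.symm
      · exact n5 h.symm
      · exact n2 h.symm
      · exact n6 h.symm
  rw [hS] at hcard
  have hmem : ∀ x, x ∈ D.crossing p ∪ D.crossing q ↔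
      x = p ∨ x = D.mate q ∨ x = D.mate p ∨ x = q := by
    intro x
    simp only [crossing, Set.mem_union, Set.mem_insert_iff, Set.mem_singleton_iff]
    tauto
  -- The map μ merges the faces at the two corners opposite the bigon. In the labels c below, the
  -- inner side of each edge takes the face across the other edge, and the outer sides take the
  -- merged face.
  let μ : D.Face → D.Face := fun x => if x = D.faceOf (q, !t) then D.faceOf (p, !s) else x
  have μ1 : μ (D.faceOf (q, !t)) = D.faceOf (p, !s) := if_pos rfl
  have μ2 : μ (D.faceOf (p, !s)) = D.faceOf (p, !s) := by
    simp only [μ]; split_ifs <;> rfl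
  let c : D.Dart → D.Face := fun δ =>
    if δ = (p, s) then μ (D.faceOf (D.mate p, !t)) else
    if δ = (D.mate q, !s) then D.faceOf (p, !s) else
    if δ = (q, t) then μ (D.faceOf (D.mate q, !s)) else
    if δ = (D.mate p, !t) then D.faceOf (p, !s) else μ (D.faceOf δ)
  have c1 : c (p, s) = μ (D.faceOf (D.mate p, !t)) := by simp [c]
  have c2 : c (D.mate q, !s) = D.faceOf (p, !s) := by simp [c]
  have c3 : c (q, t) = μ (D.faceOf (D.mate q, !s)) := by simp [c, n1, n4.symm]
  have c4 : c (D.mate p, !t) = D.faceOf (p, !s) := by simp [c, n3, n2.symm]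
  have c5 : ∀ δ, δ ≠ (p, s) → δ ≠ (D.mate q, !s) → δ ≠ (q, t) → δ ≠ (D.mate p, !t) →
      c δ = μ (D.faceOf δ) := fun δ e1 e2 e3 e4 => by
    simp only [c, if_neg e1, if_neg e2, if_neg e3, if_neg e4]
  have eN : D.faceOf (D.mate p, !t) = D.faceOf (D.mate q, s) := by
    have := faceOf_eq_of_head D.toGaussDiagram (δ := (D.mate p, !t)) r2
    rw [this, l4]
    congr 2
    cases s <;> cases t <;> rfl
  have eS : D.faceOf (D.mate q, !s) = D.faceOf (D.mate p, t) := by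
    have := faceOf_eq_of_head D.toGaussDiagram (δ := (D.mate q, !s)) r1
    rw [this, l3]
    congr 2
    cases s <;> cases t <;> rfl
  -- a directed edge that is not on the bigon
  have hout : ∀ z b, (D.head (z, b) = p → b = s) → (D.head (z, b) = D.mate q → b = !s) →
      (D.head (z, b) = q → b = t) → (D.head (z, b) = D.mate p → b = !t) →
      c (z, b) = μ (D.faceOf (z, b)) := by
    intro z b e1 e2 e3 e4
    apply c5
    · rintro h; obtain ⟨rfl, rfl⟩ := Prod.mk.inj h
      have := e2 m2.symm
      simp at this
    · rintro h; obtain ⟨rfl, rfl⟩ := Prod.mk.inj h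
      have := e1 r1
      simp at this
    · rintro h; obtain ⟨rfl, rfl⟩ := Prod.mk.inj h
      have := e4 m1.symm
      simp at this
    · rintro h; obtain ⟨rfl, rfl⟩ := Prod.mk.inj h
      have := e3 r2
      simp at this
  have hrange := h.ncard_range_le hE c ?_ ?_
  · have hF := card_le_ncard_of_forall (Set.range c) {D.faceOf (p, s), D.faceOf (q, !t)} (by
      intro x hx
      simp only [Finset.mem_insert, Finset.mem_singleton, not_or] at hx
      have hμ : μ x = x := if_neg hx.2
      obtain ⟨δ, rfl⟩ := Quot.exists_rep x
      change D.faceOf δ ≠ _ ∧ D.faceOf δ ≠ _ at hx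
      change μ (D.faceOf δ) = D.faceOf δ at hμ
      change D.faceOf δ ∈ _
      by_cases e1 : δ = (p, s)
      · exact absurd (by rw [e1]) hx.1
      by_cases e2 : δ = (q, t)
      · exact absurd (by rw [e2, ← h1, D.faceOf_faceNext]) hx.1
      by_cases e3 : δ = (D.mate q, !s)
      · exact ⟨(q, t), by rw [c3, ← e3, hμ]⟩
      by_cases e4 : δ = (D.mate p, !t)
      · exact ⟨(p, s), by rw [c1, ← e4, hμ]⟩
      exact ⟨δ, by rw [c5 δ e1 e3 e2 e4, hμ]⟩)
    have hpl := D.planar ⟨p⟩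
    have h2' := Finset.card_le_two (a := D.faceOf (p, s)) (b := D.faceOf (q, !t))
    apply E.planar_of_le
    omega
  · rintro ⟨z, b⟩ hz
    rw [hmem] at hz
    simp only
    rcases hz with hz | hz | hz | hz
    · by_cases hb : b = s
      · subst hb
        rw [hz, c1, hout, faceOf_eq_of_head D.toGaussDiagram hz, l3]
        · congr 3
          cases b <;> cases t <;> rfl
        all_goals (intro e; rw [hz] at e)
        · exact absurd e n5.symm
        · exact absurd e.symm n1
        · exact absurd e n3.symm
      · have hb' : b = !s := Bool.eq_not.2 hb
        subst hb'
        obtain rfl : z = D.mate q := D.head_injective (hz.trans r1.symm)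
        rw [hz, c2, c5, μ2]
        all_goals simp [n1.symm, n3.symm, n5.symm]
    · by_cases hb : b = s
      · subst hb
        obtain rfl : z = p := D.head_injective (hz.trans m2)
        rw [hz, c1, c5, eN]
        all_goals simp [n4, n5, n6]
      · have hb' : b = !s := Bool.eq_not.2 hb
        subst hb'
        rw [hz, c2, hout, faceOf_eq_of_head D.toGaussDiagram hz, l1, D.mate_mate, ← μ1]
        · congr 3
          cases s <;> cases t <;> rfl
        all_goals (intro e; rw [hz] at e)
        · exact absurd e n5
        · exact absurd e n4
        · exact absurd e n6
    · by_cases hb : b = t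
      · subst hb
        obtain rfl : z = q := D.head_injective (hz.trans m1)
        rw [hz, c3, c5, eS]
        all_goals simp [n2.symm, n3, n6.symm]
      · have hb' : b = !t := Bool.eq_not.2 hb
        subst hb'
        rw [hz, c4, hout, faceOf_eq_of_head D.toGaussDiagram hz, l2, D.mate_mate, ← μ2]
        · congr 3
          cases s <;> cases t <;> rfl
        all_goals (intro e; rw [hz] at e)
        · exact absurd e n3
        · exact absurd e.symm n6
        · exact absurd e.symm n2
    · by_cases hb : b = t
      · subst hb
        rw [hz, c3, hout, faceOf_eq_of_head D.toGaussDiagram hz, l4]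
        · congr 3
          cases b <;> cases s <;> rfl
        all_goals (intro e; rw [hz] at e)
        · exact absurd e n1
        · exact absurd e.symm n4
        · exact absurd e n2
      · have hb' : b = !t := Bool.eq_not.2 hb
        subst hb'
        obtain rfl : z = D.mate p := D.head_injective (hz.trans r2.symm)
        rw [hz, c4, c5, μ1]
        all_goals simp [n1, n2, n4.symm]
  · intro δ hδ
    rw [hmem] at hδ
    push Not at hδ
    obtain ⟨e1, e2, e3, e4⟩ := hδ
    have hmate : ∀ x, D.mate (D.head δ) = x → D.head δ = D.mate x := fun x hx => by
      rw [← hx, D.mate_mate]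
    rw [c5 (D.faceNext δ), D.faceOf_faceNext, c5 δ]
    · rintro rfl; exact e2 m2.symm
    · rintro rfl; exact e1 r1
    · rintro rfl; exact e3 m1.symm
    · rintro rfl; exact e4 r2
    · exact fun e => e3 (hmate _ (congrArg Prod.fst e))
    · exact fun e => e4 (D.mateEquiv.injective (congrArg Prod.fst e))
    · exact fun e => e2 (hmate _ (congrArg Prod.fst e))
    · exact fun e => e1 (D.mateEquiv.injective (congrArg Prod.fst e))

end KnotDiagram

/-! ### RIII moves preserve planarity. -/

namespace KnotDiagram

open GaussDiagram

theorem TriangleEnds.left_start {D : GaussDiagram} {d : Fin 3 → D.Dart} {u v : Fin 3 → D.Passage}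
    (T : TriangleEnds D d u v) (j : Fin 3) :
    D.left (u (j + 1)) = !((d j).2 == (d (j + 1)).2) := by
  rw [← T.mate_head, D.left_mate, T.left_head]

-- The number of passages does not change, so it suffices to map the faces of E onto those of D. The
-- new triangle is sent to the old one, and the faces around it keep their identity.
open Classical in
theorem planar_of_movesTriangle (D : KnotDiagram) (E : GaussDiagram) (d : Fin 3 → D.Dart)
    (f : D.Passage ≃ E.Passage) (htri : D.IsTriangle d)
    (hmate : ∀ x, E.mate (f x) = f (D.mate x)) (hleft : ∀ x, E.left (f x) = D.left x)
    (hnext : ∀ x, E.next (f (D.exchange d x)) = f (D.exchange d (D.next x))) :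
    2 * Nat.card E.Face = Nat.card E.Passage + 4 := by
  have T := triangleEnds htri
  set u : Fin 3 → D.Passage := fun i => (d i).1 with hu
  set v : Fin 3 → D.Passage := fun i => D.head (d i) with hv
  set s : Fin 3 → Bool := fun i => (d i).2 with hs
  set ex := D.exchange d with hex
  have exu : ∀ i, ex (u i) = v i := exchange_start T
  have exv : ∀ i, ex (v i) = u i := exchange_head T
  have exex : ∀ x, ex (ex x) = x := exchange_exchange T
  have hmv : ∀ i, D.mate (v i) = u (i + 1) := T.mate_head
  have hmu : ∀ i, D.mate (u (i + 1)) = v i := fun i => by rw [← hmv, D.mate_mate]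
  have lv : ∀ i, D.left (v i) = (s i == s (i + 1)) := T.left_head
  have lu : ∀ i, D.left (u (i + 1)) = !(s i == s (i + 1)) := T.left_start
  have hhead : ∀ i, D.head (u i, s i) = v i := fun i => rfl
  have hhead' : ∀ i, D.head (v i, !s i) = u i := fun i => D.head_reverse (d i)
  have nuv : ∀ i j, u i ≠ v j := T.start_ne_head
  have uinj : ∀ {i j}, u i = u j → i = j := fun {i j} h => by
    by_contra h'; exact T.start_ne i j h' h
  have vinj : ∀ {i j}, v i = v j → i = j := fun {i j} h => by
    by_contra h'; exact T.head_ne i j h' h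
  have hsucc : ∀ i : Fin 3, i + 1 + 1 + 1 = i := by decide
  have hpred : ∀ i : Fin 3, ∃ j, i = j + 1 := fun i => ⟨i - 1, by simp⟩
  have b1 : ∀ a b : Bool, ((a == b) == !a) = !b := by decide
  have b2 : ∀ a b : Bool, ((a == b) == a) = b := by decide
  have b3 : ∀ a b : Bool, ((!(a == b)) == b) = !a := by decide
  have b4 : ∀ a b : Bool, ((!(a == b)) == !b) = a := by decide
  -- the faces that meet the triangle
  have F1 : ∀ δ i, D.head δ = u (i + 1) → δ.2 = s (i + 1) → D.faceOf δ = D.faceOf (v i, !s i) := by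
    intro δ i h1 h2
    rw [faceOf_eq_of_head _ h1, hmu, lu, h2, b3]
  have F2 : ∀ δ i, D.head δ = v i → δ.2 = !s i →
      D.faceOf δ = D.faceOf (u (i + 1), !s (i + 1)) := by
    intro δ i h1 h2
    rw [faceOf_eq_of_head _ h1, hmv, lv, h2, b1]
  have F3 : ∀ i, D.faceOf (v (i + 1), !s (i + 1)) = D.faceOf (v i, s i) := by
    intro i
    rw [faceOf_eq_of_head _ (hhead' (i + 1)), hmu, lu, b4]
  have F4 : ∀ i, D.faceOf (d i) = D.faceOf (d 0) := by
    have : ∀ i, D.faceOf (d (i + 1)) = D.faceOf (d i) := fun i => by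
      rw [← htri.1 i, D.faceOf_faceNext]
    intro i
    fin_cases i
    · rfl
    · exact this 0
    · exact (this 1).trans (this 0)
  -- labels of the directed edges after the move
  let lab : D.Dart → D.Face := fun δ =>
    if h : ∃ i, δ = (v (i + 1), s (i + 1)) then D.faceOf (u h.choose, !s h.choose) else
    if ∃ i, δ = (u i, !s i) then D.faceOf (d 0) else D.faceOf (ex δ.1, δ.2)
  have L1 : ∀ i, lab (v (i + 1), s (i + 1)) = D.faceOf (u i, !s i) := by
    intro i
    have h : ∃ j, (v (i + 1), s (i + 1)) = (v (j + 1), s (j + 1)) := ⟨i, rfl⟩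
    have h1 := h.choose_spec
    have h2 : i = h.choose := by simpa using vinj (congrArg Prod.fst h1)
    simp only [lab]
    rw [dif_pos h, ← h2]
  have L2 : ∀ i, lab (u i, !s i) = D.faceOf (d 0) := by
    intro i
    simp only [lab]
    rw [dif_neg, if_pos ⟨i, rfl⟩]
    rintro ⟨j, hj⟩
    exact nuv _ _ (congrArg Prod.fst hj)
  have L3 : ∀ δ : D.Dart, (∀ i, δ ≠ (v i, s i)) → (∀ i, δ ≠ (u i, !s i)) →
      lab δ = D.faceOf (ex δ.1, δ.2) := by
    intro δ h1 h2
    simp only [lab]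
    rw [dif_neg, if_neg]
    · rintro ⟨j, hj⟩; exact h2 j hj
    · rintro ⟨j, hj⟩; exact h1 _ hj
  have L3u : ∀ i, lab (u i, s i) = D.faceOf (v i, s i) := by
    intro i
    rw [L3, exu]
    · intro j hj; exact nuv _ _ (congrArg Prod.fst hj)
    · intro j hj
      have h0 : u i = u j := (Prod.mk.inj hj).1
      have h1 := uinj h0
      have h2 := congrArg Prod.snd hj
      simp [h1] at h2
  have L3v : ∀ i, lab (v i, !s i) = D.faceOf (u i, !s i) := by
    intro i
    rw [L3, exv]
    · intro j hj
      have h1 := vinj (i := i) (j := j) (congrArg Prod.fst hj)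
      have h2 := congrArg Prod.snd hj
      simp [h1] at h2
    · intro j hj; exact nuv _ _ (congrArg Prod.fst hj).symm
  have L3o : ∀ x b, (∀ i, x ≠ u i) → (∀ i, x ≠ v i) → lab (x, b) = D.faceOf (x, b) := by
    intro x b h1 h2
    rw [L3]
    · simp only
      rw [hex, exchange_of_ne T h1 h2]
    · intro j hj; exact h2 j (congrArg Prod.fst hj)
    · intro j hj; exact h1 j (congrArg Prod.fst hj)
  have hEhead : ∀ y b, E.head (f y, b) = f (ex (D.head (ex y, b))) := by
    intro y b
    cases b
    · simp only [head, Bool.false_eq_true, if_false]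
      rw [Equiv.symm_apply_eq, hnext]
      simp [exex]
    · simp only [head, if_true]
      rw [← hnext, exex]
  have inv : ∀ y b, lab (D.mate (ex (D.head (ex y, b))), D.left (ex (D.head (ex y, b))) == b) =
      lab (y, b) := by
    intro y b
    by_cases hy1 : ∃ i, (y, b) = (v i, s i)
    · obtain ⟨i, hi⟩ := hy1
      obtain ⟨rfl, rfl⟩ := Prod.mk.inj hi
      obtain ⟨j, rfl⟩ := hpred i
      rw [exv, hhead, exv, hmu, lu, b3, L3v, L1]
    by_cases hy2 : ∃ i, (y, b) = (u i, !s i)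
    · obtain ⟨i, hi⟩ := hy2
      obtain ⟨rfl, rfl⟩ := Prod.mk.inj hi
      rw [exu, hhead', exu, hmv, lv, b1, L2, L2]
    push Not at hy1 hy2
    rw [L3 _ hy1 hy2]
    simp only
    set z := ex y with hz
    have hy : y = ex z := by rw [hz, exex]
    rcases exchange_cases T (D.head (z, b)) with ⟨i, hi⟩ | ⟨i, hi⟩ | ⟨g1, g2, g3⟩
    · have hb : b = s i := by
        by_contra hb
        have hb' := Bool.eq_not.2 hb
        subst hb'
        have : z = v i := D.head_injective (hi.trans (hhead' i).symm)
        exact hy2 i (by rw [hy, this, exv])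
      obtain ⟨j, rfl⟩ := hpred i
      obtain ⟨k, rfl⟩ := hpred j
      subst hb
      rw [hi, exu, hmv, lv, b2, L3u, F1 _ _ hi rfl, F3, hsucc]
    · have hb : b = !s i := by
        rw [Bool.eq_not]
        intro hb
        subst hb
        have : z = u i := D.head_injective (hi.trans (hhead i).symm)
        exact hy1 i (by rw [hy, this, exu])
      obtain ⟨j, rfl⟩ := hpred i
      obtain ⟨k, rfl⟩ := hpred j
      subst hb
      rw [hi, exv, hmu, lu, b4, L1, F2 _ _ hi rfl, hsucc]
    · rw [← hex] at g3
      rw [g3, L3o, ← D.faceOf_faceNext (z, b)]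
      · rfl
      · intro i h
        apply g2 (i - 1)
        rw [← D.mate_mate (D.head (z, b)), h, ← hmu (i - 1)]
        simp
      · intro i h
        apply g1 (i + 1)
        rw [← D.mate_mate (D.head (z, b)), h, hmv]
  let g : E.Face → D.Face := Quot.lift (fun δ => lab (f.symm δ.1, δ.2)) (by
    rintro ⟨x, b⟩ _ rfl
    obtain ⟨y, rfl⟩ := f.surjective x
    simp only [faceNext, hEhead, hmate, hleft, Equiv.symm_apply_apply]
    exact (inv y b).symm)
  have hg : ∀ y b, g (E.faceOf (f y, b)) = lab (y, b) := fun y b => by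
    change lab (f.symm (f y), b) = _
    rw [Equiv.symm_apply_apply]
  -- Faces of D that touch the triangle are recovered from edges next to the new triangle, all
  -- others from edges away from it.
  have hsurj : Function.Surjective g := by
    intro φ
    obtain ⟨⟨z, b⟩, rfl⟩ := Quot.exists_rep φ
    change ∃ a, g a = D.faceOf (z, b)
    rcases exchange_cases T z with ⟨i, rfl⟩ | ⟨i, rfl⟩ | ⟨g1, g2, g3⟩
    · by_cases hb : b = s i
      · subst hb
        exact ⟨E.faceOf (f (u i), !s i), by rw [hg, L2]; exact (F4 i).symm⟩
      · rw [Bool.eq_not.2 hb]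
        exact ⟨E.faceOf (f (v i), !s i), by rw [hg, L3v]⟩
    · by_cases hb : b = s i
      · subst hb
        exact ⟨E.faceOf (f (u i), s i), by rw [hg, L3u]⟩
      · rw [Bool.eq_not.2 hb]
        obtain ⟨j, rfl⟩ := hpred i
        exact ⟨E.faceOf (f (u j), s j), by rw [hg, L3u, F3]⟩
    · exact ⟨E.faceOf (f z, b), by rw [hg, L3o z b g1 g2]⟩
  have h1 := Nat.card_le_card_of_surjective g hsurj
  have h2 := D.planar ⟨u 0⟩
  have h3 := Nat.card_congr f
  apply E.planar_of_le
  omega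

end KnotDiagram

/-! ### Diagrams presented by pairs of segments. -/

theorem IsCyclicSucc.of_comp {α β K : Type*} [LinearOrder K] {k : β → K} {φ : α → β}
    (hφ : Function.Surjective φ) {x y : α} (h : IsCyclicSucc (k ∘ φ) x y) :
    IsCyclicSucc k (φ x) (φ y) := by
  rcases h with ⟨h1, h2⟩ | ⟨h1, h2⟩
  · exact Or.inl ⟨h1, hφ.forall.2 h2⟩
  · exact Or.inr ⟨hφ.forall.2 h1, hφ.forall.2 h2⟩

theorem finRotate_pow_zero (n : ℕ) (i : Fin (n + 1)) : (finRotate (n + 1) ^ (i : ℕ)) 0 = i := by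
  have : ∀ j (hj : j < n + 1), (finRotate (n + 1) ^ j) 0 = ⟨j, hj⟩ := by
    intro j
    induction j with
    | zero => intro _; rfl
    | succ j ih =>
      intro hj
      rw [pow_succ', Equiv.Perm.mul_apply, ih (by omega)]
      exact finRotate_of_lt (by omega)
  exact this i i.2

/-- Every finite linearly ordered set has a successor permutation. -/
theorem exists_cyclicSucc {α K : Type*} [Finite α] [LinearOrder K] (k : α → K)
    (hk : Function.Injective k) :
    ∃ σ : Equiv.Perm α, (∀ x y, σ.SameCycle x y) ∧ ∀ x, IsCyclicSucc k x (σ x) := by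
  classical
  have : Fintype α := Fintype.ofFinite α
  rcases isEmpty_or_nonempty α with he | hne
  · exact ⟨1, fun x => he.elim x, fun x => he.elim x⟩
  let _ : LinearOrder α := LinearOrder.lift' k hk
  obtain ⟨n, hn⟩ : ∃ n, Fintype.card α = n + 1 :=
    ⟨Fintype.card α - 1, by have := Fintype.card_pos (α := α); omega⟩
  let e : Fin (n + 1) ≃o α := Fintype.orderIsoFinOfCardEq α hn
  let σ : Equiv.Perm α := e.symm.toEquiv.trans ((finRotate (n + 1)).trans e.toEquiv)
  have hσ : ∀ i, σ (e i) = e (finRotate (n + 1) i) := fun i => by simp [σ]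
  have hσp : ∀ (j : ℕ) i, (σ ^ j) (e i) = e ((finRotate (n + 1) ^ j) i) := by
    intro j
    induction j with
    | zero => intro i; rfl
    | succ j ih => intro i; rw [pow_succ', Equiv.Perm.mul_apply, ih, hσ, pow_succ',
        Equiv.Perm.mul_apply]
  have h0 : ∀ x, σ.SameCycle (e 0) x := by
    intro x
    obtain ⟨i, rfl⟩ := e.surjective x
    exact ⟨(i : ℕ), by rw [zpow_natCast, hσp, finRotate_pow_zero]⟩
  have hle : ∀ i j, k (e i) ≤ k (e j) ↔ i ≤ j := fun i j => e.le_iff_le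
  have hlt : ∀ i j, k (e i) < k (e j) ↔ i < j := fun i j => e.lt_iff_lt
  refine ⟨σ, fun x y => (h0 x).symm.trans (h0 y), fun x => ?_⟩
  obtain ⟨i, rfl⟩ := e.surjective x
  rw [hσ]
  have hsur : ∀ P : K → Prop, (∀ j, P (k (e j))) → ∀ z, P (k z) := fun P h z => by
    obtain ⟨j, rfl⟩ := e.surjective z
    exact h j
  rcases Nat.lt_or_ge (i : ℕ) n with h | h
  · have hr : finRotate (n + 1) i = ⟨i + 1, by omega⟩ := finRotate_of_lt h
    refine Or.inl ⟨?_, hsur (fun t => t ≤ k (e i) ∨ k (e (finRotate (n + 1) i)) ≤ t) fun j => ?_⟩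
    · rw [hlt, hr, Fin.lt_def]; simp
    · rw [hle, hle, hr, Fin.le_def, Fin.le_def]
      simp only
      omega
  · have hi : i = Fin.last n := Fin.ext (by simp; omega)
    have hr : finRotate (n + 1) i = 0 := by rw [hi, finRotate_last]
    refine Or.inr ⟨hsur (fun t => t ≤ k (e i)) fun j => ?_,
      hsur (fun t => k (e (finRotate (n + 1) i)) ≤ t) fun j => ?_⟩
    · rw [hle, hi]; exact Fin.le_last j
    · rw [hle, hr]; exact Fin.zero_le j

namespace GaussDiagram

/-- The passages of `D` correspond to the pairs in `A`, and are met along the knot in the order of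
increasing `key`. The passage through the crossing of the `i`-th and the `j`-th segment of the knot
on the `i`-th segment corresponds to `(i, j)`: higher segments run over lower ones, and segments of
odd index cross those of even index from the right to the left. -/
structure Presents {K : Type*} [LinearOrder K] (D : GaussDiagram) (A : Finset (ℕ × ℕ))
    (key : ℕ × ℕ → K) (g : D.Passage → ℕ × ℕ) : Prop where
  injective : Function.Injective g
  range_eq : Set.range g = ↑A
  mate : ∀ x, g (D.mate x) = (g x).swap
  upper : ∀ x, D.upper x = decide ((g x).2 < (g x).1)
  left : ∀ x, D.left x = decide ((g x).1 % 2 = 1)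
  linearizes : D.Linearizes (key ∘ g)

/-- The conditions under which a set of pairs of segments and a key describe a diagram. -/
structure Admissible {K : Type*} [LinearOrder K] (A : Finset (ℕ × ℕ)) (key : ℕ × ℕ → K) :
    Prop where
  swap_mem : ∀ z ∈ A, z.swap ∈ A
  odd_add : ∀ z ∈ A, (z.1 + z.2) % 2 = 1
  injOn : Set.InjOn key A

/-- The result is only a Gauss diagram; planarity is supplied separately, by the move that leads to
it or by counting faces. Opposite parity of the indices makes the two passages of a crossing
distinct and gives them opposite values of `left`. -/
theorem Admissible.exists_presents {K : Type*} [LinearOrder K] {A : Finset (ℕ × ℕ)}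
    {key : ℕ × ℕ → K} (h : Admissible A key) :
    ∃ (E : GaussDiagram) (g : E.Passage → ℕ × ℕ), Presents E A key g := by
  obtain ⟨σ, hσ, hsucc⟩ := exists_cyclicSucc (fun z : A => key z)
    (fun x y hxy => Subtype.ext (h.injOn x.2 y.2 hxy))
  refine ⟨⟨A, inferInstance, σ, fun z => ⟨z.1.swap, h.swap_mem _ z.2⟩,
    fun z => decide (z.1.2 < z.1.1), fun z => decide (z.1.1 % 2 = 1), hσ, ?_, ?_, ?_, ?_⟩,
    Subtype.val, ⟨Subtype.val_injective, ?_, fun _ => rfl, fun _ => rfl, fun _ => rfl, ?_⟩⟩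
  · rintro ⟨⟨i, j⟩, hz⟩ e
    have h1 := h.odd_add _ hz
    have h2 := congrArg (fun z => z.1.1) e
    simp only [Prod.swap] at h1 h2
    omega
  · intro z; simp
  · rintro ⟨⟨i, j⟩, hz⟩
    have h1 := h.odd_add _ hz
    simp only [Prod.swap] at h1 ⊢
    by_cases h2 : i < j
    · simp [h2, h2.le]
    · simp only [h2, decide_false]
      simp
      omega
  · rintro ⟨⟨i, j⟩, hz⟩
    have h1 := h.odd_add _ hz
    simp only [Prod.swap] at h1 ⊢
    rw [← decide_not]
    congr 1
    apply propext
    omega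
  · simp
  · exact ⟨fun x y hxy => Subtype.ext (h.injOn x.2 y.2 hxy), hsucc⟩

section Presents

variable {K : Type*} [LinearOrder K] {D : GaussDiagram} {A : Finset (ℕ × ℕ)}
  {key : ℕ × ℕ → K} {g : D.Passage → ℕ × ℕ}

theorem Presents.mem (h : D.Presents A key g) (x : D.Passage) : g x ∈ A := by
  have : g x ∈ (↑A : Set (ℕ × ℕ)) := by rw [← h.range_eq]; exact ⟨x, rfl⟩
  exact this

theorem Presents.exists_eq (h : D.Presents A key g) {z : ℕ × ℕ} (hz : z ∈ A) : ∃ x, g x = z := by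
  have : z ∈ Set.range g := by rw [h.range_eq]; exact hz
  exact this

theorem Presents.eq_mate (h : D.Presents A key g) {x y : D.Passage} (hxy : g y = (g x).swap) :
    y = D.mate x :=
  h.injective (by rw [hxy, h.mate])

/-- `a` and `b` are consecutive elements of `A` in the order given by `key`. -/
def Consecutive (A : Finset (ℕ × ℕ)) (key : ℕ × ℕ → K) (a b : ℕ × ℕ) : Prop :=
  key a < key b ∧ ∀ c ∈ A, key c ≤ key a ∨ key b ≤ key c

theorem Presents.next_eq (h : D.Presents A key g) {x y : D.Passage}
    (hxy : Consecutive A key (g x) (g y)) : D.next x = y :=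
  h.linearizes.next_eq (Or.inl ⟨hxy.1, fun z => hxy.2 _ (h.mem z)⟩)

theorem Presents.exists_deletionMap {L : Type*} [LinearOrder L] {E : GaussDiagram}
    {A' : Finset (ℕ × ℕ)} {key' : ℕ × ℕ → L} {g' : E.Passage → ℕ × ℕ}
    (h : D.Presents A key g) (h' : E.Presents A' key' g') (hA : A' ⊆ A)
    (hkey : ∀ a ∈ A', ∀ b ∈ A', key' a < key' b ↔ key a < key b) :
    ∃ f, DeletionMap D E {x | g x ∉ A'} f := by
  have hex : ∀ y, ∃ x, g x = g' y := fun y => h.exists_eq (hA (h'.mem y))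
  choose f hf using hex
  have hrange : Set.range f = {x | g x ∉ A'}ᶜ := by
    ext x
    simp only [Set.mem_range, Set.mem_compl_iff, Set.mem_ofPred_eq, not_not]
    constructor
    · rintro ⟨y, rfl⟩
      rw [hf]; exact h'.mem y
    · intro hx
      obtain ⟨y, hy⟩ := h'.exists_eq hx
      exact ⟨y, h.injective (by rw [hf, hy])⟩
  refine ⟨f, ⟨fun x y hxy => h'.injective (by rw [← hf, ← hf, hxy]), hrange, fun x => ?_,
    fun x => ?_, fun x => ?_, ?_⟩⟩
  · exact h.eq_mate (by rw [hf, hf, h'.mate])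
  · rw [h.upper, h'.upper, hf]
  · rw [h.left, h'.left, hf]
  · refine h.linearizes.exists_next_eq hrange h'.linearizes fun x y => ?_
    simp only [Function.comp_apply, hf]
    exact hkey _ (h'.mem x) _ (h'.mem y)

end Presents

end GaussDiagram

/-! ### Moves read off from the order of the pairs. -/

namespace KnotDiagram

open GaussDiagram

theorem isDeletion_of_deletionMap {D E : KnotDiagram} {S : Set D.Passage}
    {f : E.Passage → D.Passage} (h : DeletionMap D.toGaussDiagram E.toGaussDiagram S f) :
    IsDeletion D E S :=
  ⟨f, h.injective, h.range_eq, h.mate, h.upper, h.left, h.next⟩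

section moves

variable {K L : Type*} [LinearOrder K] [LinearOrder L] {A : Finset (ℕ × ℕ)} {key : ℕ × ℕ → K}
  {key' : ℕ × ℕ → L} {D : KnotDiagram} {g : D.Passage → ℕ × ℕ}

/-- Consecutive passages of one crossing bound a loop; the parities put its face on the left and,
with the heights, make the crossing positive. -/
theorem exists_deletesMonogon (h : D.Presents A key g) {a : ℕ × ℕ} (ha : a ∈ A)
    (h' : Admissible ((A.erase a).erase a.swap) key')
    (hswap : a.swap ∈ A) (hc : Consecutive A key a a.swap) (heven : a.1 % 2 = 0)
    (hodd : a.2 % 2 = 1) (hlt : a.1 < a.2)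
    (hkey : ∀ x ∈ (A.erase a).erase a.swap, ∀ y ∈ (A.erase a).erase a.swap,
      key' x < key' y ↔ key x < key y) :
    ∃ (E : KnotDiagram) (g' : E.Passage → ℕ × ℕ),
      E.Presents ((A.erase a).erase a.swap) key' g' ∧ DeletesMonogon true D E := by
  obtain ⟨E, g', hE⟩ := h'.exists_presents
  obtain ⟨f, hf⟩ := h.exists_deletionMap hE
    ((Finset.erase_subset _ _).trans (Finset.erase_subset _ _)) hkey
  obtain ⟨p, rfl⟩ := h.exists_eq ha
  have hS : {x | g x ∉ (A.erase (g p)).erase (g p).swap} = D.crossing p := by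
    ext x
    simp only [crossing, Set.mem_ofPred_eq, Finset.mem_erase, ne_eq, h.mem x, not_and,
      Set.mem_insert_iff, Set.mem_singleton_iff, ← h.mate, h.injective.eq_iff]
    tauto
  rw [hS] at hf
  have hnext : D.next p = D.mate p := h.next_eq (by rw [h.mate]; exact hc)
  have hl : D.left (D.mate p) = true := by
    rw [h.left, h.mate]; simp [hodd]
  have hface : D.faceNext (p, true) = (p, true) := by
    simp [faceNext, head, hnext, D.mate_mate, hl]
  let E' : KnotDiagram := ⟨E, fun hne => planar_of_deletesMonogon D E hface hf hne⟩
  refine ⟨E', g', hE, (p, true), hface, ?_, isDeletion_of_deletionMap (E := E') hf⟩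
  simp only [positive, h.upper, h.left]
  simp [heven, hlt.le]

theorem exists_deletesBigon (h : D.Presents A key g) {a b : ℕ × ℕ} (ha : a ∈ A) (hb : b ∈ A)
    (hbs : b.swap ∈ A) {A' : Finset (ℕ × ℕ)}
    (hA' : ∀ x, x ∈ A' ↔ x ∈ A ∧ x ≠ a ∧ x ≠ a.swap ∧ x ≠ b ∧ x ≠ b.swap)
    (h' : Admissible A' key')
    (hc : Consecutive A key a b) (hc' : Consecutive A key b.swap a.swap) (hodd : b.1 % 2 = 1)
    (hodd' : a.2 % 2 = 1) (hlt : a.2 < a.1) (hlt' : b.2 < b.1)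
    (hkey : ∀ x ∈ A', ∀ y ∈ A', key' x < key' y ↔ key x < key y) :
    ∃ (E : KnotDiagram) (g' : E.Passage → ℕ × ℕ),
      E.Presents A' key' g' ∧ DeletesBigon false D E := by
  obtain ⟨E, g', hE⟩ := h'.exists_presents
  obtain ⟨f, hf⟩ := h.exists_deletionMap hE (fun x hx => ((hA' x).1 hx).1) hkey
  obtain ⟨p, rfl⟩ := h.exists_eq ha
  obtain ⟨q, rfl⟩ := h.exists_eq hb
  have hS : {x | g x ∉ A'} = D.crossing p ∪ D.crossing (D.mate q) := by
    ext x
    simp only [crossing, Set.mem_ofPred_eq, hA', ne_eq, h.mem x, true_and, Set.mem_union,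
      Set.mem_insert_iff, Set.mem_singleton_iff, ← h.mate, h.injective.eq_iff, D.mate_mate]
    tauto
  rw [hS] at hf
  have hnext : D.next p = q := h.next_eq hc
  have hnext' : D.next (D.mate q) = D.mate p := h.next_eq (by rw [h.mate, h.mate]; exact hc')
  have hl : D.left q = true := by rw [h.left]; simp [hodd]
  have hl' : D.left (D.mate p) = true := by rw [h.left, h.mate]; simp [hodd']
  have hface : D.faceNext (p, true) = (D.mate q, true) := by
    simp [faceNext, head, hnext, hl]
  have hface' : D.faceNext (D.mate q, true) = (p, true) := by
    simp [faceNext, head, hnext', D.mate_mate, hl']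
  have hup : D.upper p = D.upper (D.head (p, true)) := by
    simp [head, hnext, h.upper, hlt, hlt']
  let E' : KnotDiagram := ⟨E, fun hne => planar_of_deletesBigon D E hface hface' hup hf hne⟩
  exact ⟨E', g', hE, (p, true), (D.mate q, true), hface, hface', hup, by simp,
    isDeletion_of_deletionMap (E := E') hf⟩

/-- The 3-gon that an RIII move creates. -/
theorem isTriangle_of_exchange {E : GaussDiagram} {d : Fin 3 → D.Dart}
    (f : D.Passage ≃ E.Passage) (htri : D.IsTriangle d)
    (hmate : ∀ x, E.mate (f x) = f (D.mate x)) (hleft : ∀ x, E.left (f x) = D.left x)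
    (hnext : ∀ x, E.next (f (D.exchange d x)) = f (D.exchange d (D.next x))) :
    E.IsTriangle (fun i => (f (d i).1, !(d i).2)) := by
  have T := triangleEnds htri
  refine ⟨fun i => ?_, fun i j hij => ?_⟩
  · have h3 := exchange_start T i
    have h4 := exchange_head T i
    beta_reduce at h3 h4
    have h1 : ∀ s, (d i).2 = s → E.head (f (d i).1, !s) = f (D.head (d i)) := by
      intro s hs
      cases s
      · have h5 : D.next (D.head (d i)) = (d i).1 := by simp [hs, head]
        have h6 := hnext (D.head (d i))
        rw [h4, h5, h3] at h6
        exact h6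
      · have h5 : D.next (d i).1 = D.head (d i) := by simp [head, hs]
        have h6 := hnext (d i).1
        rw [h3, h5, h4] at h6
        change E.next.symm _ = _
        rw [Equiv.symm_apply_eq, h6]
    have h6 : ∀ s t : Bool, ((s == t) == !s) = !t := by decide
    rw [faceNext, h1 _ rfl, hmate, hleft, T.mate_head, T.left_head]
    exact Prod.ext rfl (h6 _ _)
  · have := htri.2 i j hij
    simp only [crossing, Set.mem_insert_iff, Set.mem_singleton_iff, hmate] at this ⊢
    simpa using this

/-- The edge from a is lowest, the edge from b highest, and the third one, from a.swap to c, is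
traversed backwards. The last two hypotheses fix the order of the strands after the move, and hence
the positive sign. -/
theorem exists_movesTriangle (h : D.Presents A key g) (h' : Admissible A key')
    {a b c : ℕ × ℕ} (ha : a ∈ A) (hb : b ∈ A) (hc : c ∈ A)
    (hab : a ≠ b ∧ a ≠ b.swap) (hbc : b ≠ c ∧ b ≠ c.swap) (hca : c ≠ a ∧ c ≠ a.swap)
    (e0 : Consecutive A key a b.swap) (e1 : Consecutive A key b c.swap)
    (e2 : Consecutive A key a.swap c) (o0 : b.2 % 2 = 1) (o1 : c.2 % 2 = 0) (o2 : a.2 % 2 = 0)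
    (u0 : a.1 < a.2) (u1 : b.2 < b.1) (u2 : c.1 < c.2)
    (hkey : ∀ x ∈ A, ∀ y ∈ A, key' x < key' y ↔
      key ((Equiv.swap a b.swap * Equiv.swap b c.swap * Equiv.swap c a.swap) x) <
      key ((Equiv.swap a b.swap * Equiv.swap b c.swap * Equiv.swap c a.swap) y))
    (k0 : key' a ≤ key' c) (k1 : key' c ≤ key' b) :
    ∃ (E : KnotDiagram) (g' : E.Passage → ℕ × ℕ),
      E.Presents A key' g' ∧ MovesTriangle true D E := by
  obtain ⟨E, g', hE⟩ := h'.exists_presents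
  obtain ⟨p, rfl⟩ := h.exists_eq ha
  obtain ⟨q, rfl⟩ := h.exists_eq hb
  obtain ⟨r, rfl⟩ := h.exists_eq hc
  simp only [← h.mate] at *
  have hex : ∀ x, ∃ y, g' y = g x := fun x => hE.exists_eq (h.mem x)
  choose f0 hf0 using hex
  have hbij : Function.Bijective f0 := by
    constructor
    · intro x y hxy; exact h.injective (by rw [← hf0, hxy, hf0])
    · intro y
      obtain ⟨x, hx⟩ := h.exists_eq (hE.mem y)
      exact ⟨x, hE.injective (by rw [hf0, hx])⟩
  let f : D.Passage ≃ E.Passage := Equiv.ofBijective f0 hbij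
  have hf : ∀ x, g' (f x) = g x := hf0
  have n0 : D.next p = D.mate q := h.next_eq e0
  have n1 : D.next q = D.mate r := h.next_eq e1
  have n2 : D.next (D.mate p) = r := h.next_eq e2
  let d : Fin 3 → D.Dart := ![(p, true), (q, true), (r, false)]
  have hd0 : D.head (d 0) = D.mate q := by simp [d, head, n0]
  have hd1 : D.head (d 1) = D.mate r := by simp [d, head, n1]
  have hd2 : D.head (d 2) = D.mate p := by simp [d, head, ← n2]
  have l0 : D.left (D.mate q) = true := by rw [h.left, h.mate]; simp [o0]
  have l1 : D.left (D.mate r) = false := by rw [h.left, h.mate]; simp [o1]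
  have l2 : D.left (D.mate p) = false := by rw [h.left, h.mate]; simp [o2]
  have htri : D.IsTriangle d := by
    constructor
    · intro i
      fin_cases i
      · change D.faceNext (d 0) = _
        rw [faceNext, hd0, D.mate_mate, l0]; rfl
      · change D.faceNext (d 1) = _
        rw [faceNext, hd1, D.mate_mate, l1]; rfl
      · change D.faceNext (d 2) = _
        rw [faceNext, hd2, D.mate_mate, l2]; rfl
    · have key : ∀ x y, g x ≠ g y → g x ≠ g (D.mate y) →
          x ∉ D.crossing y ∧ y ∉ D.crossing x := by
        intro x y h1 h2
        simp only [crossing, Set.mem_insert_iff, Set.mem_singleton_iff, not_or]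
        refine ⟨⟨fun e => h1 (by rw [e]), fun e => h2 (by rw [← e])⟩,
          fun e => h1 (by rw [e]), fun e => h2 (by rw [e, D.mate_mate])⟩
      have k01 := key p q hab.1 hab.2
      have k12 := key q r hbc.1 hbc.2
      have k20 := key r p hca.1 hca.2
      intro i j hij
      fin_cases i <;> fin_cases j <;> first | exact absurd rfl hij | skip
      · exact k01.1
      · exact k20.2
      · exact k01.2
      · exact k12.1
      · exact k20.1
      · exact k12.2
  have hexch : ∀ x, g (D.exchange d x) = (Equiv.swap (g p) (g (D.mate q)) *
      Equiv.swap (g q) (g (D.mate r)) * Equiv.swap (g r) (g (D.mate p))) (g x) := by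
    classical
    intro x
    rw [exchange, hd0, hd1, hd2]
    simp only [Equiv.Perm.mul_apply]
    rw [h.injective.map_swap, h.injective.map_swap, h.injective.map_swap]
    rfl
  have T := triangleEnds htri
  have hnext : ∀ x, E.next (f (D.exchange d x)) = f (D.exchange d (D.next x)) := by
    intro x
    apply hE.linearizes.next_eq
    have h1 : IsCyclicSucc ((key' ∘ g') ∘ fun x => f (D.exchange d x)) x (D.next x) := by
      refine (h.linearizes.succ x).congr fun y z => ?_
      simp only [Function.comp_apply, hf]
      rw [hkey _ (h.mem _) _ (h.mem _), ← hexch, ← hexch, exchange_exchange T, exchange_exchange T]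
    exact h1.of_comp (f.surjective.comp (D.exchange d).surjective)
  have hmate : ∀ x, E.mate (f x) = f (D.mate x) := fun x =>
    (hE.eq_mate (by rw [hf, hf, h.mate])).symm
  have hupper : ∀ x, E.upper (f x) = D.upper x := fun x => by rw [h.upper, hE.upper, hf]
  have hleft : ∀ x, E.left (f x) = D.left x := fun x => by rw [h.left, hE.left, hf]
  let E' : KnotDiagram := ⟨E, fun _ => planar_of_movesTriangle D E d f htri hmate hleft hnext⟩
  refine ⟨E', g', hE, d, f, htri, ⟨1, ?_, ?_⟩, ⟨0, ?_, ?_⟩, hmate, hupper, hleft, hnext,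
    isTriangle_of_exchange f htri hmate hleft hnext, ?_⟩
  · change D.upper q = true
    rw [h.upper]; simpa using u1
  · rw [hd1, h.upper, h.mate]; simpa using u2
  · change D.upper p = false
    rw [h.upper]; simpa using u0.le
  · rw [hd0, h.upper, h.mate]; simpa using u1.le
  · classical
    -- The strands are met in the order p, r, q. Two of the three reversed directions are negative,
    -- so the order alone determines the sign.
    have hM : ¬ E.MeetsInOrder (f p) (f q) (f r) := by
      rw [hE.linearizes.meetsInOrder_iff] <;> simp only [Function.comp_apply, hf]
      · exact k1.not_gt
      · exact k0.trans k1
      · exact k0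
    change E.triangleSign _ = 1
    rw [E.triangleSign_eq]
    change (if E.MeetsInOrder (f p) (f q) (f r) then 1 else -1) * _ * -1 = (1 : ℤ)
    rw [if_neg hM]
    rfl

end moves

end KnotDiagram

/-! ### Reversing three adjacent pairs of a linear order. -/

section order

variable {α K : Type*} [LinearOrder K]

/-- No element of `A` lies between `u` and `v` in the order given by `key`. -/
def Adjacent (A : Finset α) (key : α → K) (u v : α) : Prop :=
  ∀ z ∈ A, z ≠ u → z ≠ v → key z < key u ∧ key z < key v ∨ key u < key z ∧ key v < key z

variable [DecidableEq α]

/-- Replace the second element of each of three pairs by the first one. -/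
def representative (u v : Fin 3 → α) (z : α) : α :=
  if z = v 0 then u 0 else if z = v 1 then u 1 else if z = v 2 then u 2 else z

theorem representative_cases (u v : Fin 3 → α) (z : α) :
    (∃ i, z = v i ∧ representative u v z = u i) ∨
      (∀ i, z ≠ v i) ∧ representative u v z = z := by
  unfold representative
  split_ifs with h0 h1 h2
  · exact Or.inl ⟨0, h0, rfl⟩
  · exact Or.inl ⟨1, h1, rfl⟩
  · exact Or.inl ⟨2, h2, rfl⟩
  · refine Or.inr ⟨fun i => ?_, rfl⟩
    fin_cases i <;> assumption

theorem representative_snd {u v : Fin 3 → α} (hv : Function.Injective v) (i : Fin 3) :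
    representative u v (v i) = u i := by
  rcases representative_cases u v (v i) with ⟨j, h1, h2⟩ | h
  · rw [h2, hv h1]
  · exact absurd rfl (h.1 i)

theorem representative_fst {u v : Fin 3 → α} (huv : ∀ i j, u i ≠ v j) (i : Fin 3) :
    representative u v (u i) = u i := by
  rcases representative_cases u v (u i) with ⟨j, h1, _⟩ | h
  · exact absurd h1 (huv i j)
  · exact h.2

/-- Collapsing each adjacent pair to its first element does not affect comparisons between elements
that stay distinct. -/
theorem Adjacent.lt_iff_representative {A : Finset α} {key : α → K} {u v : Fin 3 → α}
    (hv : Function.Injective v) (huv : ∀ i j, u i ≠ v j) (hA : ∀ i, u i ∈ A)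
    (h : ∀ i, Adjacent A key (u i) (v i)) {x y : α} (hx : x ∈ A) (hy : y ∈ A)
    (hxy : representative u v x ≠ representative u v y) :
    key x < key y ↔ key (representative u v x) < key (representative u v y) := by
  have hru := representative_fst huv
  have hrv := representative_snd (u := u) hv
  have h1 : key x < key y ↔ key (representative u v x) < key y := by
    rcases representative_cases u v x with ⟨i, rfl, h2⟩ | h2
    · rw [h2] at hxy ⊢
      have := h i y hy (fun e => hxy (by rw [e, hru])) (fun e => hxy (by rw [e, hrv]))
      grind
    · rw [h2.2]
  rw [h1]
  have hxA : representative u v x ∈ A := by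
    rcases representative_cases u v x with ⟨i, _, h2⟩ | h2
    · rw [h2]; exact hA i
    · rw [h2.2]; exact hx
  have hne : ∀ i, representative u v x ≠ v i := by
    rcases representative_cases u v x with ⟨i, _, h2⟩ | h2
    · rw [h2]; exact huv i
    · rw [h2.2]; exact h2.1
  rcases representative_cases u v y with ⟨i, rfl, h2⟩ | h2
  · rw [h2] at hxy ⊢
    have := h i _ hxA hxy (hne i)
    grind
  · rw [h2.2]

/-- Exchange the elements of each of three pairs. -/
def tripleSwap (u v : Fin 3 → α) : Equiv.Perm α :=
  Equiv.swap (u 0) (v 0) * Equiv.swap (u 1) (v 1) * Equiv.swap (u 2) (v 2)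

section tripleSwap

variable {u v : Fin 3 → α}

theorem tripleSwap_fst (hu : Function.Injective u) (hv : Function.Injective v)
    (huv : ∀ i j, u i ≠ v j) (i : Fin 3) :
    tripleSwap u v (u i) = v i := by
  have h : ∀ i j, u i = u j ↔ i = j := fun i j => hu.eq_iff
  have h' : ∀ i j, v i = v j ↔ i = j := fun i j => hv.eq_iff
  fin_cases i <;> simp [tripleSwap, Equiv.swap_apply_def, h, h', huv, fun i j => (huv i j).symm]

theorem tripleSwap_snd (hu : Function.Injective u) (hv : Function.Injective v)
    (huv : ∀ i j, u i ≠ v j) (i : Fin 3) :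
    tripleSwap u v (v i) = u i := by
  have h : ∀ i j, u i = u j ↔ i = j := fun i j => hu.eq_iff
  have h' : ∀ i j, v i = v j ↔ i = j := fun i j => hv.eq_iff
  fin_cases i <;> simp [tripleSwap, Equiv.swap_apply_def, h, h', huv, fun i j => (huv i j).symm]

theorem tripleSwap_of_ne {x : α} (hu : ∀ i, x ≠ u i) (hv : ∀ i, x ≠ v i) :
    tripleSwap u v x = x := by
  simp [tripleSwap, Equiv.swap_apply_of_ne_of_ne, hu, hv]

theorem tripleSwap_cases (x : α) :
    (∃ i, x = u i) ∨ (∃ i, x = v i) ∨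
      ((∀ i, x ≠ u i) ∧ (∀ i, x ≠ v i) ∧ tripleSwap u v x = x) := by
  by_cases hu : ∃ i, x = u i
  · exact Or.inl hu
  by_cases hv : ∃ i, x = v i
  · exact Or.inr (Or.inl hv)
  push Not at hu hv
  exact Or.inr (Or.inr ⟨hu, hv, tripleSwap_of_ne hu hv⟩)

theorem tripleSwap_mem (hu : Function.Injective u) (hv : Function.Injective v)
    (huv : ∀ i j, u i ≠ v j) {A : Finset α} (hA : ∀ i, u i ∈ A) (hA' : ∀ i, v i ∈ A) {x : α}
    (hx : x ∈ A) : tripleSwap u v x ∈ A := by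
  rcases tripleSwap_cases (u := u) (v := v) x with ⟨i, rfl⟩ | ⟨i, rfl⟩ | ⟨-, -, h⟩
  · rw [tripleSwap_fst hu hv huv]; exact hA' i
  · rw [tripleSwap_snd hu hv huv]; exact hA i
  · rwa [h]

theorem representative_tripleSwap (hu : Function.Injective u) (hv : Function.Injective v)
    (huv : ∀ i j, u i ≠ v j) (x : α) :
    representative u v (tripleSwap u v x) = representative u v x := by
  rcases tripleSwap_cases (u := u) (v := v) x with ⟨i, rfl⟩ | ⟨i, rfl⟩ | ⟨-, -, h⟩
  · rw [tripleSwap_fst hu hv huv, representative_snd hv, representative_fst huv]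
  · rw [tripleSwap_snd hu hv huv, representative_snd hv, representative_fst huv]
  · rw [h]

/-- If three disjoint pairs of adjacent elements are reversed, then the new order is the old one
up to exchanging the elements of each pair. -/
theorem lt_iff_tripleSwap (hu : Function.Injective u) (hv : Function.Injective v)
    (huv : ∀ i j, u i ≠ v j) {A : Finset α} {key key' : α → K} (hA : ∀ i, u i ∈ A)
    (hA' : ∀ i, v i ∈ A) (h : ∀ i, Adjacent A key (u i) (v i))
    (h' : ∀ i, Adjacent A key' (u i) (v i)) (hlt : ∀ i, key (u i) < key (v i))
    (hlt' : ∀ i, key' (v i) < key' (u i)) (heq : ∀ z ∈ A, (∀ i, z ≠ v i) → key' z = key z)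
    {x y : α} (hx : x ∈ A) (hy : y ∈ A) :
    key' x < key' y ↔ key (tripleSwap u v x) < key (tripleSwap u v y) := by
  have hmem := fun {x} => tripleSwap_mem hu hv huv hA hA' (x := x)
  have hrep := representative_tripleSwap hu hv huv
  -- Inside a collapsed pair the order is reversed; between different classes both keys agree on the
  -- representatives.
  by_cases hxy : representative u v x = representative u v y
  · rcases representative_cases u v x with ⟨i, rfl, h1⟩ | ⟨h1, h2⟩ <;>
    rcases representative_cases u v y with ⟨j, rfl, h3⟩ | ⟨h3, h4⟩
    · rw [h1, h3] at hxy
      rw [hu hxy]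
      simp
    · rw [h1, h4] at hxy
      rw [← hxy, tripleSwap_fst hu hv huv, tripleSwap_snd hu hv huv]
      exact iff_of_true (hlt' i) (hlt i)
    · rw [h2, h3] at hxy
      rw [hxy, tripleSwap_fst hu hv huv, tripleSwap_snd hu hv huv]
      exact iff_of_false (hlt' j).not_gt (hlt j).not_gt
    · rw [h2, h4] at hxy
      rw [hxy]
      simp
  · have hr : ∀ z ∈ A, key' (representative u v z) = key (representative u v z) := by
      intro z hz
      rcases representative_cases u v z with ⟨i, _, h2⟩ | ⟨h1, h2⟩
      · rw [h2]; exact heq _ (hA i) (huv i)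
      · rw [h2]; exact heq z hz h1
    rw [Adjacent.lt_iff_representative hv huv hA h' hx hy hxy, hr x hx, hr y hy,
      Adjacent.lt_iff_representative hv huv hA h (hmem hx) (hmem hy) (by rwa [hrep, hrep]),
      hrep, hrep]

end tripleSwap

end order

open GaussDiagram

theorem GaussDiagram.Consecutive.adjacent {K : Type*} [LinearOrder K] {A : Finset (ℕ × ℕ)} {key : ℕ × ℕ → K}
    (hinj : Set.InjOn key A) {a b : ℕ × ℕ} (ha : a ∈ A) (hb : b ∈ A)
    (h : Consecutive A key a b) : Adjacent A key a b := by
  intro z hz h1 h2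
  have h3 : key z ≠ key a := fun e => h1 (hinj hz ha e)
  have h4 : key z ≠ key b := fun e => h2 (hinj hz hb e)
  have := h.1
  have := h.2 z hz
  grind

/-! ### The order of the passages during the sweep. -/

/-- Lexicographically ordered triples. -/
abbrev Triple : Type := ℕ ×ₗ ℕ ×ₗ ℤ

/-- The triple with the given components. -/
def triple (i c : ℕ) (t : ℤ) : Triple := toLex (i, toLex (c, t))

theorem triple_lt {i c i' c' : ℕ} {t t' : ℤ} :
    triple i c t < triple i' c' t' ↔ i < i' ∨ i ≤ i' ∧ (c < c' ∨ c ≤ c' ∧ t < t') := by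
  simp only [triple, Prod.Lex.lt_iff, ofLex_toLex]
  omega

theorem triple_le {i c i' c' : ℕ} {t t' : ℤ} :
    triple i c t ≤ triple i' c' t' ↔ i < i' ∨ i ≤ i' ∧ (c < c' ∨ c ≤ c' ∧ t ≤ t') := by
  simp only [triple, Prod.Lex.le_iff, ofLex_toLex]
  omega

/-- The order in which the passages of the ascending diagram are met. -/
def naturalKey (z : ℕ × ℕ) : Triple := triple z.1 (if z.2 < z.1 then 1 else 0) z.2

/-- The order in which the passages are met while the segment with index `2 * m` is moved over the
diagram. -/
def sweepKey (m b a : ℕ) (z : ℕ × ℕ) : Triple :=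
  if z.1 = 2 * m ∧ z.2 < 2 * m then
    -- Crossings already swept stand at the start of the segment 2m in reverse order. The one with
    -- 2b + 1 is in transit, and the value 2a puts it between the crossings with 2a - 1 and 2a + 1.
    triple (2 * m) 1 (if 2 * b + 1 < z.2 then -z.2 else if z.2 < 2 * b + 1 then z.2 else
      if a = b then z.2 else if a = 0 then -z.2 else 2 * a)
  else if z.2 = 2 * m ∧ z.1 < 2 * m then
    if 2 * b + 1 < z.1 then triple (z.1 - 1) 1 0
    -- On a lower odd segment the crossing with 2m stands just before or just after the one with 2b,
    -- according to whether it has been pushed past it. The crossing with 2b + 1 starts at the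
    -- beginning of that segment, passes the inner turn and slides back along 2b, keeping its name
    -- (2b + 1, 2m).
    else if z.1 < 2 * b + 1 then triple z.1 0 (if 2 * a ≤ z.1 then 2 * b - 1 else 2 * b + 1)
    else if a < b then triple (z.1 - 1) 1 (2 * a) else triple z.1 0 (2 * b + 1)
  else naturalKey z

/-- The pairs of segments that cross each other. -/
def pairs (N : ℕ) : Finset (ℕ × ℕ) :=
  (Finset.range N ×ˢ Finset.range N).filter fun z => (z.1 + z.2) % 2 = 1

theorem mem_pairs {N : ℕ} {z : ℕ × ℕ} :
    z ∈ pairs N ↔ z.1 < N ∧ z.2 < N ∧ (z.1 + z.2) % 2 = 1 := by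
  simp [pairs, and_assoc]

theorem eq_of_mem_pairs {m : ℕ} {z : ℕ × ℕ} (hz : z ∈ pairs (2 * m + 2)) :
    ∃ x y, x ≤ m ∧ y ≤ m ∧ (z = (2 * x, 2 * y + 1) ∨ z = (2 * x + 1, 2 * y)) := by
  obtain ⟨i, j⟩ := z
  rw [mem_pairs] at hz
  simp only at hz
  refine ⟨i / 2, j / 2, by omega, by omega, ?_⟩
  simp only [Prod.mk.injEq]
  omega

theorem sweepKey_of_lt {m b a : ℕ} {z : ℕ × ℕ} (h1 : z.1 < 2 * m) (h2 : z.2 < 2 * m) :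
    sweepKey m b a z = naturalKey z := by
  rw [sweepKey, if_neg (by omega), if_neg (by omega)]

/-- The end of one row of the sweep is the beginning of the next, so no move is needed in between.
-/
theorem sweepKey_zero {m b : ℕ} {z : ℕ × ℕ} (hz : z ∈ pairs (2 * m + 2)) :
    sweepKey m (b + 1) 0 z = sweepKey m b b z := by
  rw [mem_pairs] at hz
  obtain ⟨i, j⟩ := z
  simp only at hz
  simp only [sweepKey]
  split_ifs <;> first | rfl | omega | contradiction | (congr 1; push_cast; omega)

/-- The keys differ, since 2m - 1 replaces 2m at crossings with the segment 2m, but by parity no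
other crossing has a key between these values. -/
theorem naturalKey_lt_iff {m : ℕ} {z w : ℕ × ℕ} (hz : z ∈ pairs (2 * m + 2))
    (hw : w ∈ pairs (2 * m + 2)) :
    sweepKey m m 0 z < sweepKey m m 0 w ↔ naturalKey z < naturalKey w := by
  have h : ∀ z ∈ pairs (2 * m + 2), sweepKey m m 0 z = triple z.1 (if z.2 < z.1 then 1 else 0)
      (if z.2 = 2 * m ∧ z.1 < 2 * m then 2 * m - 1 else z.2) := by
    rintro ⟨i, j⟩ hz
    rw [mem_pairs] at hz
    simp only at hz
    simp only [sweepKey, naturalKey]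
    split_ifs <;> first | omega | (congr 1; try omega)
  rw [h z hz, h w hw]
  obtain ⟨x, y, hx, hy, rfl | rfl⟩ := eq_of_mem_pairs hz <;>
  obtain ⟨x', y', hx', hy', rfl | rfl⟩ := eq_of_mem_pairs hw <;>
  clear hz hw <;>
  simp only [naturalKey, triple_lt] <;>
  split_ifs <;> omega

/-- The first ends of the edges of the triangle that is moved. -/
def triangleFst (m b a : ℕ) : Fin 3 → ℕ × ℕ :=
  ![(2 * a + 1, 2 * b), (2 * m, 2 * a + 1), (2 * b, 2 * a + 1)]

/-- The second ends of the edges of the triangle that is moved. -/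
def triangleSnd (m b a : ℕ) : Fin 3 → ℕ × ℕ :=
  ![(2 * a + 1, 2 * m), (2 * m, 2 * b + 1), (2 * b + 1, 2 * m)]

section triangle

variable {m b a : ℕ}

theorem sweepKey_fst_succ (h : a < b) (h' : b < m) :
    sweepKey m b (a + 1) (2 * a + 1, 2 * b) = triple (2 * a + 1) 0 (2 * b) ∧
    sweepKey m b (a + 1) (2 * m, 2 * a + 1) = triple (2 * m) 1 (2 * a + 1) ∧
    sweepKey m b (a + 1) (2 * b, 2 * a + 1) = triple (2 * b) 1 (2 * a + 1) := by
  refine ⟨?_, ?_, ?_⟩ <;> simp only [sweepKey, naturalKey, true_and] <;> split_ifs <;>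
    first | rfl | contradiction | omega

theorem sweepKey_snd_succ (h : a < b) (h' : b < m) :
    sweepKey m b (a + 1) (2 * a + 1, 2 * m) = triple (2 * a + 1) 0 (2 * b + 1) ∧
    (sweepKey m b (a + 1) (2 * m, 2 * b + 1) = triple (2 * m) 1 (2 * a + 2) ∨
      a + 1 = b ∧ sweepKey m b (a + 1) (2 * m, 2 * b + 1) = triple (2 * m) 1 (2 * b + 1)) ∧
    (a + 1 < b ∧ sweepKey m b (a + 1) (2 * b + 1, 2 * m) = triple (2 * b) 1 (2 * a + 2) ∨
      a + 1 = b ∧ sweepKey m b (a + 1) (2 * b + 1, 2 * m) = triple (2 * b + 1) 0 (2 * b + 1)) := by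
  refine ⟨?_, ?_, ?_⟩
  · simp only [sweepKey, naturalKey, true_and]
    split_ifs <;> first | rfl | contradiction | omega
  · rcases Nat.lt_or_ge (a + 1) b with hb | hb
    · left
      simp only [sweepKey, naturalKey, true_and]
      split_ifs <;> first | rfl | contradiction | omega
    · right
      refine ⟨by omega, ?_⟩
      simp only [sweepKey, naturalKey, true_and]
      split_ifs <;> first | rfl | contradiction | omega
  · rcases Nat.lt_or_ge (a + 1) b with hb | hb
    · left
      refine ⟨hb, ?_⟩
      simp only [sweepKey, naturalKey, true_and]
      split_ifs <;> first | rfl | contradiction | omega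
    · right
      refine ⟨by omega, ?_⟩
      simp only [sweepKey, naturalKey, true_and]
      split_ifs <;> first | rfl | contradiction | omega

theorem sweepKey_fst (h : a < b) (h' : b < m) :
    sweepKey m b a (2 * a + 1, 2 * b) = triple (2 * a + 1) 0 (2 * b) ∧
    sweepKey m b a (2 * m, 2 * a + 1) = triple (2 * m) 1 (2 * a + 1) ∧
    sweepKey m b a (2 * b, 2 * a + 1) = triple (2 * b) 1 (2 * a + 1) := by
  refine ⟨?_, ?_, ?_⟩ <;> simp only [sweepKey, naturalKey, true_and] <;> split_ifs <;>
    first | rfl | contradiction | omega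

theorem sweepKey_snd (h : a < b) (h' : b < m) :
    sweepKey m b a (2 * a + 1, 2 * m) = triple (2 * a + 1) 0 (2 * b - 1) ∧
    (0 < a ∧ sweepKey m b a (2 * m, 2 * b + 1) = triple (2 * m) 1 (2 * a) ∨
      a = 0 ∧ sweepKey m b a (2 * m, 2 * b + 1) = triple (2 * m) 1 (-(2 * b + 1))) ∧
    sweepKey m b a (2 * b + 1, 2 * m) = triple (2 * b) 1 (2 * a) := by
  refine ⟨?_, ?_, ?_⟩
  · simp only [sweepKey, naturalKey, true_and]
    split_ifs <;> first | rfl | contradiction | omega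
  · rcases Nat.eq_zero_or_pos a with hb | hb
    · right
      refine ⟨hb, ?_⟩
      simp only [sweepKey, naturalKey, true_and]
      split_ifs <;> first | rfl | contradiction | omega
    · left
      refine ⟨hb, ?_⟩
      simp only [sweepKey, naturalKey, true_and]
      split_ifs <;> first | rfl | contradiction | omega
  · simp only [sweepKey, naturalKey, true_and]
    split_ifs <;> first | rfl | contradiction | omega

/-- These are the three edges of the triangle before the move. For a + 1 = b the third one contains
the inner turn from 2b to 2b + 1, which accounts for the case distinctions. -/
theorem consecutive_succ (h : a < b) (h' : b < m) :
    Consecutive (pairs (2 * m + 2)) (sweepKey m b (a + 1)) (2 * a + 1, 2 * b) (2 * a + 1, 2 * m) ∧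
    Consecutive (pairs (2 * m + 2)) (sweepKey m b (a + 1)) (2 * m, 2 * a + 1) (2 * m, 2 * b + 1) ∧
    Consecutive (pairs (2 * m + 2)) (sweepKey m b (a + 1)) (2 * b, 2 * a + 1) (2 * b + 1, 2 * m) := by
  obtain ⟨f0, f1, f2⟩ := sweepKey_fst_succ h h'
  obtain ⟨s0, s1, s2⟩ := sweepKey_snd_succ h h'
  refine ⟨⟨?_, ?_⟩, ⟨?_, ?_⟩, ⟨?_, ?_⟩⟩
  · rw [f0, s0, triple_lt]; omega
  · intro z hz
    obtain ⟨x, y, hx, hy, rfl | rfl⟩ := eq_of_mem_pairs hz <;> clear hz <;>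
    rw [f0, s0] <;>
    simp only [sweepKey, naturalKey] <;>
    split_ifs <;> simp only [triple_le] <;> omega
  · rcases s1 with s1 | ⟨hb, s1⟩ <;> rw [f1, s1, triple_lt] <;> omega
  · intro z hz
    obtain ⟨x, y, hx, hy, rfl | rfl⟩ := eq_of_mem_pairs hz <;> clear hz <;>
    rcases s1 with s1 | ⟨hb, s1⟩ <;> rw [f1, s1] <;>
    simp only [sweepKey, naturalKey] <;>
    split_ifs <;> simp only [triple_le] <;> omega
  · rcases s2 with ⟨hb, s2⟩ | ⟨hb, s2⟩ <;> rw [f2, s2, triple_lt] <;> omega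
  · intro z hz
    obtain ⟨x, y, hx, hy, rfl | rfl⟩ := eq_of_mem_pairs hz <;> clear hz <;>
    rcases s2 with ⟨hb, s2⟩ | ⟨hb, s2⟩ <;> rw [f2, s2] <;>
    simp only [sweepKey, naturalKey] <;>
    split_ifs <;> simp only [triple_le] <;> omega

/-- The passages of the triangle are adjacent after the move, too. -/
theorem adjacent_sweepKey (h : a < b) (h' : b < m) (i : Fin 3) :
    Adjacent (pairs (2 * m + 2)) (sweepKey m b a) (triangleFst m b a i) (triangleSnd m b a i) := by
  obtain ⟨f0, f1, f2⟩ := sweepKey_fst h h'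
  obtain ⟨s0, s1, s2⟩ := sweepKey_snd h h'
  fin_cases i
  · intro z hz h1 h2
    simp only [triangleFst, triangleSnd] at h1 h2 ⊢
    obtain ⟨x, y, hx, hy, rfl | rfl⟩ := eq_of_mem_pairs hz <;> clear hz <;>
    simp at h1 h2 ⊢ <;>
    rw [f0, s0] <;>
    simp only [sweepKey, naturalKey] <;>
    split_ifs <;> simp only [triple_lt] <;> omega
  · intro z hz h1 h2
    simp only [triangleFst, triangleSnd] at h1 h2 ⊢
    obtain ⟨x, y, hx, hy, rfl | rfl⟩ := eq_of_mem_pairs hz <;> clear hz <;>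
    simp at h1 h2 ⊢ <;>
    rcases s1 with ⟨hb, s1⟩ | ⟨hb, s1⟩ <;> rw [f1, s1] <;>
    simp only [sweepKey, naturalKey] <;>
    split_ifs <;> simp only [triple_lt] <;> omega
  · intro z hz h1 h2
    simp only [triangleFst, triangleSnd] at h1 h2 ⊢
    obtain ⟨x, y, hx, hy, rfl | rfl⟩ := eq_of_mem_pairs hz <;> clear hz <;>
    simp at h1 h2 ⊢ <;>
    rw [f2, s2] <;>
    simp only [sweepKey, naturalKey] <;>
    split_ifs <;> simp only [triple_lt] <;> omega

theorem sweepKey_snd_lt (h : a < b) (h' : b < m) (i : Fin 3) :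
    sweepKey m b a (triangleSnd m b a i) < sweepKey m b a (triangleFst m b a i) := by
  obtain ⟨f0, f1, f2⟩ := sweepKey_fst h h'
  obtain ⟨s0, s1, s2⟩ := sweepKey_snd h h'
  fin_cases i <;> simp only [triangleFst, triangleSnd]
  · change sweepKey m b a (_, _) < sweepKey m b a (_, _)
    rw [f0, s0, triple_lt]; omega
  · change sweepKey m b a (_, _) < sweepKey m b a (_, _)
    rcases s1 with ⟨hb, s1⟩ | ⟨hb, s1⟩ <;> rw [f1, s1, triple_lt] <;> omega
  · change sweepKey m b a (_, _) < sweepKey m b a (_, _)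
    rw [f2, s2, triple_lt]; omega

theorem sweepKey_eq_succ (h : a < b) (h' : b < m) {z : ℕ × ℕ} (hz : z ∈ pairs (2 * m + 2))
    (hne : ∀ i, z ≠ triangleSnd m b a i) : sweepKey m b a z = sweepKey m b (a + 1) z := by
  have h0 := hne 0
  have h1 := hne 1
  have h2 := hne 2
  obtain ⟨i, j⟩ := z
  rw [mem_pairs] at hz
  simp [triangleSnd] at h0 h1 h2 hz
  simp only [sweepKey]
  split_ifs <;> first | rfl | omega

end triangle

namespace GaussDiagram

section

variable {K L : Type*} [LinearOrder K] [LinearOrder L] {D : GaussDiagram} {A B : Finset (ℕ × ℕ)}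
  {key : ℕ × ℕ → K} {g : D.Passage → ℕ × ℕ}

theorem Presents.injOn (h : D.Presents A key g) : Set.InjOn key A := by
  intro z hz w hw e
  obtain ⟨x, rfl⟩ := h.exists_eq hz
  obtain ⟨y, rfl⟩ := h.exists_eq hw
  rw [h.linearizes.injective e]

theorem Presents.congr_key {key' : ℕ × ℕ → L} (h : D.Presents A key g)
    (hkey : ∀ x ∈ A, ∀ y ∈ A, key' x < key' y ↔ key x < key y) : D.Presents A key' g := by
  have hk : ∀ x y, (key' ∘ g) x < (key' ∘ g) y ↔ (key ∘ g) x < (key ∘ g) y :=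
    fun x y => hkey _ (h.mem x) _ (h.mem y)
  refine ⟨h.injective, h.range_eq, h.mate, h.upper, h.left, ⟨fun x y e => ?_, fun x => ?_⟩⟩
  · apply h.linearizes.injective
    have h1 := hk x y
    have h2 := hk y x
    rw [e] at h1 h2
    exact le_antisymm (not_lt.1 (h2.not.1 (lt_irrefl _))) (not_lt.1 (h1.not.1 (lt_irrefl _)))
  · exact (h.linearizes.succ x).congr hk

theorem Presents.congr_key_eq {key' : ℕ × ℕ → K} (h : D.Presents A key g)
    (hkey : ∀ x ∈ A, key' x = key x) : D.Presents A key' g :=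
  h.congr_key fun x hx y hy => by rw [hkey x hx, hkey y hy]

theorem Presents.isEmpty (h : D.Presents ∅ key g) : IsEmpty D.Passage :=
  ⟨fun x => absurd (h.mem x) (Finset.notMem_empty _)⟩

end

theorem admissible_of_subset {K : Type*} [LinearOrder K] {A : Finset (ℕ × ℕ)} {key : ℕ × ℕ → K}
    {N : ℕ} (hA : A ⊆ pairs N) (hswap : ∀ z ∈ A, z.swap ∈ A) (hinj : Set.InjOn key A) :
    Admissible A key :=
  ⟨hswap, fun _ hz => (mem_pairs.1 (hA hz)).2.2, hinj⟩

theorem swap_mem_pairs {N : ℕ} {z : ℕ × ℕ} (hz : z ∈ pairs N) : z.swap ∈ pairs N := by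
  rw [mem_pairs] at hz ⊢
  simp only [Prod.fst_swap, Prod.snd_swap]
  omega

end GaussDiagram

/-! ### The unknotting sequence. -/

namespace KnotDiagram

open GaussDiagram

variable {m : ℕ} {D : KnotDiagram} {g : D.Passage → ℕ × ℕ}

/-- The segment 2m is the upper strand, 2b the middle and 2a + 1 the lower one. The move pushes the
crossing of the upper two past the crossing of the lower two. -/
theorem exists_movesTriangle_sweep {b a : ℕ} (hab : a < b) (hbm : b < m)
    (h : D.Presents (pairs (2 * m + 2)) (sweepKey m b (a + 1)) g) :
    ∃ (E : KnotDiagram) (g' : E.Passage → ℕ × ℕ),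
      E.Presents (pairs (2 * m + 2)) (sweepKey m b a) g' ∧ MovesTriangle true D E := by
  obtain ⟨c0, c1, c2⟩ := consecutive_succ hab hbm
  obtain ⟨f0, f1, -⟩ := sweepKey_fst hab hbm
  obtain ⟨-, -, s2⟩ := sweepKey_snd hab hbm
  have hA : ∀ i, triangleFst m b a i ∈ pairs (2 * m + 2) := by
    intro i
    rw [mem_pairs]
    fin_cases i <;> simp [triangleFst] <;> omega
  have hA' : ∀ i, triangleSnd m b a i ∈ pairs (2 * m + 2) := by
    intro i
    rw [mem_pairs]
    fin_cases i <;> simp [triangleSnd] <;> omega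
  have hu : Function.Injective (triangleFst m b a) := by
    intro i j
    fin_cases i <;> fin_cases j <;> simp [triangleFst] <;> omega
  have hv : Function.Injective (triangleSnd m b a) := by
    intro i j
    fin_cases i <;> fin_cases j <;> simp [triangleSnd] <;> omega
  have huv : ∀ i j, triangleFst m b a i ≠ triangleSnd m b a j := by
    intro i j
    fin_cases i <;> fin_cases j <;> simp [triangleFst, triangleSnd] <;> omega
  have hc : ∀ i, Consecutive (pairs (2 * m + 2)) (sweepKey m b (a + 1)) (triangleFst m b a i)
      (triangleSnd m b a i) := by
    intro i
    fin_cases i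
    exacts [c0, c1, c2]
  have hkey : ∀ x ∈ pairs (2 * m + 2), ∀ y ∈ pairs (2 * m + 2), _ :=
    fun x hx y hy => lt_iff_tripleSwap hu hv huv hA hA'
      (fun i => (hc i).adjacent h.injOn (hA i) (hA' i)) (adjacent_sweepKey hab hbm)
      (fun i => (hc i).1) (sweepKey_snd_lt hab hbm)
      (fun z hz hne => sweepKey_eq_succ hab hbm hz hne) hx hy
  have hinj : Set.InjOn (sweepKey m b a) (pairs (2 * m + 2)) := by
    intro x hx y hy e
    have h1 := hkey x hx y hy
    have h2 := hkey y hy x hx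
    rw [e] at h1 h2
    apply (tripleSwap (triangleFst m b a) (triangleSnd m b a)).injective
    apply h.injOn (tripleSwap_mem hu hv huv hA hA' hx) (tripleSwap_mem hu hv huv hA hA' hy)
    exact le_antisymm (not_lt.1 (h2.not.1 (lt_irrefl _))) (not_lt.1 (h1.not.1 (lt_irrefl _)))
  refine exists_movesTriangle h (admissible_of_subset subset_rfl (fun _ => swap_mem_pairs) hinj)
    (a := (2 * a + 1, 2 * b)) (b := (2 * m, 2 * a + 1)) (c := (2 * b + 1, 2 * m))
    (hA 0) (hA 1) (hA' 2) ?_ ?_ ?_ c0 c1 c2 ?_ ?_ ?_ ?_ ?_ ?_ ?_ ?_ ?_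
  · simp only [ne_eq, Prod.swap, Prod.mk.injEq]; omega
  · simp only [ne_eq, Prod.swap, Prod.mk.injEq]; omega
  · simp only [ne_eq, Prod.swap, Prod.mk.injEq]; omega
  · simp only; omega
  · simp only; omega
  · simp only; omega
  · simp only; omega
  · simp only; omega
  · simp only; omega
  -- The third edge is traversed backwards, so its named end c is the second element of the third
  -- pair.
  · rw [Equiv.swap_comm (2 * b + 1, 2 * m)]
    exact hkey
  · rw [f0, s2, triple_le]; omega
  · rw [f1, s2, triple_le]; omega

theorem exists_unknots_row {b : ℕ} (hbm : b < m) (a : ℕ) :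
    ∀ {D : KnotDiagram} {g : D.Passage → ℕ × ℕ}, a ≤ b →
      D.Presents (pairs (2 * m + 2)) (sweepKey m b a) g →
      ∃ (E : KnotDiagram) (g' : E.Passage → ℕ × ℕ),
        E.Presents (pairs (2 * m + 2)) (sweepKey m b 0) g' ∧
        ∀ ms, E.Unknots ms → D.Unknots (List.replicate a (.moveIII true) ++ ms) := by
  induction a with
  | zero => exact fun {D g} _ h => ⟨D, g, h, fun ms hms => hms⟩
  | succ a ih =>
    intro D g hab h
    obtain ⟨E, g', hE, hDE⟩ := exists_movesTriangle_sweep hab hbm h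
    obtain ⟨F, g'', hF, hEF⟩ := ih (by omega) hE
    exact ⟨F, g'', hF, fun ms hms => .cons _ E _ _ hDE (hEF ms hms)⟩

theorem exists_unknots_sweep (b : ℕ) :
    ∀ {D : KnotDiagram} {g : D.Passage → ℕ × ℕ}, b ≤ m →
      D.Presents (pairs (2 * m + 2)) (sweepKey m b 0) g →
      ∃ (E : KnotDiagram) (g' : E.Passage → ℕ × ℕ),
        E.Presents (pairs (2 * m + 2)) (sweepKey m 0 0) g' ∧
        ∀ ms, E.Unknots ms → D.Unknots (List.replicate (b.choose 2) (.moveIII true) ++ ms) := by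
  induction b with
  | zero => exact fun {D g} _ h => ⟨D, g, h, fun ms hms => hms⟩
  | succ b ih =>
    intro D g hb h
    obtain ⟨E, g', hE, hDE⟩ := exists_unknots_row hb b le_rfl
      (h.congr_key_eq fun z hz => (sweepKey_zero hz).symm)
    obtain ⟨F, g'', hF, hEF⟩ := ih (by omega) hE
    refine ⟨F, g'', hF, fun ms hms => ?_⟩
    rw [Nat.choose_succ_succ' b 1, Nat.choose_one_right, List.replicate_add, List.append_assoc]
    exact hDE _ (hEF ms hms)

/-- The crossings that are left after deleting the first `x` bigons. -/
def remaining (m x : ℕ) : Finset (ℕ × ℕ) :=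
  (pairs (2 * m + 2)).filter fun z => (2 * m ≤ z.1 → 2 * x ≤ z.2) ∧ (2 * m ≤ z.2 → 2 * x ≤ z.1)

theorem mem_remaining {x : ℕ} {z : ℕ × ℕ} : z ∈ remaining m x ↔
    (z.1 < 2 * m + 2 ∧ z.2 < 2 * m + 2 ∧ (z.1 + z.2) % 2 = 1) ∧
      (2 * m ≤ z.1 → 2 * x ≤ z.2) ∧ (2 * m ≤ z.2 → 2 * x ≤ z.1) := by
  rw [remaining, Finset.mem_filter, mem_pairs]

theorem remaining_subset {x : ℕ} : remaining m x ⊆ pairs (2 * m + 2) := Finset.filter_subset _ _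

theorem remaining_zero : remaining m 0 = pairs (2 * m + 2) := by
  simp [remaining]

theorem swap_mem_remaining {x : ℕ} {z : ℕ × ℕ} (hz : z ∈ remaining m x) :
    z.swap ∈ remaining m x := by
  rw [mem_remaining] at hz ⊢
  simp only [Prod.fst_swap, Prod.snd_swap]
  omega

theorem sweepKey_zero_zero_first {x : ℕ} (hx : x < m) :
    sweepKey m 0 0 (2 * m, 2 * x + 1) = triple (2 * m) 1 (if x = 0 then 1 else -(2 * x + 1)) := by
  simp only [sweepKey, true_and]
  split_ifs <;> first | rfl | contradiction | omega | (congr 1; omega)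

theorem sweepKey_zero_zero_second {x : ℕ} (hx : x < m) :
    sweepKey m 0 0 (2 * x + 1, 2 * m) = if x = 0 then triple 1 0 1 else triple (2 * x) 1 0 := by
  simp only [sweepKey, true_and]
  rcases Nat.eq_zero_or_pos x with rfl | h0
  · split_ifs <;> first | rfl | contradiction | omega
  · split_ifs <;> first | rfl | contradiction | omega

/-- After the sweep, (2m, 2x + 1) and (2m + 1, 2x) are separated on the upper arc only by the turn
from 2m to 2m + 1 once the previous bigons are gone; the lower edge lies on 2x. -/
theorem exists_deletesBigon_sweep {x : ℕ} (hx : x < m)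
    (h : D.Presents (remaining m x) (sweepKey m 0 0) g) :
    ∃ (E : KnotDiagram) (g' : E.Passage → ℕ × ℕ),
      E.Presents (remaining m (x + 1)) (sweepKey m 0 0) g' ∧ DeletesBigon false D E := by
  have hmem : ∀ z, z ∈ remaining m (x + 1) ↔ z ∈ remaining m x ∧ z ≠ (2 * m, 2 * x + 1) ∧
      z ≠ (2 * x + 1, 2 * m) ∧ z ≠ (2 * m + 1, 2 * x) ∧ z ≠ (2 * x, 2 * m + 1) := by
    rintro ⟨i, j⟩
    simp only [mem_remaining, ne_eq, Prod.mk.injEq]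
    omega
  have hcases : ∀ z ∈ remaining m x, ∃ i j, i ≤ m ∧ j ≤ m ∧
      ((m ≤ i → x ≤ j) ∧ (m ≤ j → x ≤ i)) ∧
      (z = (2 * i, 2 * j + 1) ∨ z = (2 * i + 1, 2 * j)) := by
    intro z hz
    obtain ⟨i, j, hi, hj, hz'⟩ := eq_of_mem_pairs (remaining_subset hz)
    rw [mem_remaining] at hz
    refine ⟨i, j, hi, hj, ?_, hz'⟩
    rcases hz' with rfl | rfl <;> simp only at hz <;> omega
  have f := sweepKey_zero_zero_first hx
  have s := sweepKey_zero_zero_second hx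
  have f' : sweepKey m 0 0 (2 * m + 1, 2 * x) = triple (2 * m + 1) 1 (2 * x) := by
    simp only [sweepKey, naturalKey]
    split_ifs <;> first | omega | rfl
  have s' : sweepKey m 0 0 (2 * x, 2 * m + 1) = triple (2 * x) 0 (2 * m + 1) := by
    simp only [sweepKey, naturalKey]
    split_ifs <;> first | omega | rfl
  refine exists_deletesBigon h (a := (2 * m, 2 * x + 1)) (b := (2 * m + 1, 2 * x)) ?_ ?_ ?_ hmem
    (admissible_of_subset remaining_subset (fun _ => swap_mem_remaining)
      (h.injOn.mono fun z hz => ((hmem z).1 hz).1)) ⟨?_, ?_⟩ ⟨?_, ?_⟩ ?_ ?_ ?_ ?_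
    fun _ _ _ _ => Iff.rfl
  · rw [mem_remaining]; simp only; omega
  · rw [mem_remaining]; simp only; omega
  · rw [mem_remaining]; simp only [Prod.swap]; omega
  · rw [f, f', triple_lt]; omega
  · intro z hz
    obtain ⟨i, j, hi, hj, hij, rfl | rfl⟩ := hcases z hz <;> clear hz <;> rw [f, f'] <;>
    simp only [sweepKey, naturalKey] <;>
    split_ifs <;> simp only [triple_le] <;> omega
  · change sweepKey m 0 0 (2 * x, 2 * m + 1) < sweepKey m 0 0 (2 * x + 1, 2 * m)
    rw [s, s']
    split_ifs <;> rw [triple_lt] <;> omega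
  · intro z hz
    change _ ≤ sweepKey m 0 0 (2 * x, 2 * m + 1) ∨ sweepKey m 0 0 (2 * x + 1, 2 * m) ≤ _
    obtain ⟨i, j, hi, hj, hij, rfl | rfl⟩ := hcases z hz <;> clear hz <;> rw [s, s'] <;>
    simp only [sweepKey, naturalKey] <;>
    split_ifs <;> simp only [triple_le] <;> omega
  all_goals simp only; omega

theorem exists_unknots_bigons (k : ℕ) :
    ∀ {x : ℕ} {D : KnotDiagram} {g : D.Passage → ℕ × ℕ}, x + k = m →
      D.Presents (remaining m x) (sweepKey m 0 0) g →
      ∃ (E : KnotDiagram) (g' : E.Passage → ℕ × ℕ),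
        E.Presents (remaining m m) (sweepKey m 0 0) g' ∧
        ∀ ms, E.Unknots ms → D.Unknots (List.replicate k (.deleteII false) ++ ms) := by
  induction k with
  | zero =>
    intro x D g hx h
    obtain rfl : x = m := hx
    exact ⟨D, g, h, fun ms hms => hms⟩
  | succ k ih =>
    intro x D g hx h
    obtain ⟨E, g', hE, hDE⟩ := exists_deletesBigon_sweep (by omega) h
    obtain ⟨F, g'', hF, hEF⟩ := ih (by omega) hE
    exact ⟨F, g'', hF, fun ms hms => .cons _ E _ _ hDE (hEF ms hms)⟩

theorem exists_deletesMonogon_sweep (h : D.Presents (remaining m m) (sweepKey m 0 0) g) :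
    ∃ (E : KnotDiagram) (g' : E.Passage → ℕ × ℕ),
      E.Presents (pairs (2 * m)) naturalKey g' ∧ DeletesMonogon true D E := by
  have hset : ((remaining m m).erase (2 * m, 2 * m + 1)).erase
      (Prod.swap (2 * m, 2 * m + 1)) = pairs (2 * m) := by
    ext ⟨i, j⟩
    simp only [Finset.mem_erase, mem_remaining, mem_pairs, ne_eq, Prod.mk.injEq, Prod.swap]
    omega
  have hsub : pairs (2 * m) ⊆ remaining m m := by
    rw [← hset]
    exact (Finset.erase_subset _ _).trans (Finset.erase_subset _ _)
  have f : sweepKey m 0 0 (2 * m, 2 * m + 1) = triple (2 * m) 0 (2 * m + 1) := by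
    simp only [sweepKey, naturalKey]
    split_ifs <;> first | omega | rfl
  have s : sweepKey m 0 0 (2 * m + 1, 2 * m) = triple (2 * m + 1) 1 (2 * m) := by
    simp only [sweepKey, naturalKey]
    split_ifs <;> first | omega | rfl
  have hmon := exists_deletesMonogon (key' := sweepKey m 0 0) h (a := (2 * m, 2 * m + 1))
    (by rw [mem_remaining]; simp only; omega)
    (hset ▸ admissible_of_subset subset_rfl (fun _ => swap_mem_pairs) (h.injOn.mono hsub))
    (by rw [mem_remaining]; simp only [Prod.swap]; omega) ⟨?_, ?_⟩ (by simp only; omega)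
    (by simp only; omega) (by simp only; omega) fun _ _ _ _ => Iff.rfl
  · rw [hset] at hmon
    obtain ⟨E, g', hE, hDE⟩ := hmon
    refine ⟨E, g', hE.congr_key_eq fun z hz => ?_, hDE⟩
    rw [mem_pairs] at hz
    exact (sweepKey_of_lt hz.1 hz.2.1).symm
  · change _ < sweepKey m 0 0 (2 * m + 1, 2 * m)
    rw [f, s, triple_lt]; omega
  · intro z hz
    change _ ∨ sweepKey m 0 0 (2 * m + 1, 2 * m) ≤ _
    obtain ⟨i, j, hi, hj, hz'⟩ := eq_of_mem_pairs (remaining_subset hz)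
    rw [mem_remaining] at hz
    have hij : (m ≤ i → m ≤ j) ∧ (m ≤ j → m ≤ i) := by
      rcases hz' with rfl | rfl <;> simp only at hz <;> omega
    clear hz
    rcases hz' with rfl | rfl <;> rw [f, s] <;>
    simp only [sweepKey, naturalKey] <;>
    split_ifs <;> simp only [triple_le] <;> omega

/-- The moves that unknot the ascending diagram with `2 * n` segments. -/
def unknottingMoves : ℕ → List Move
  | 0 => []
  | n + 1 => List.replicate (n.choose 2) (.moveIII true) ++
      (List.replicate n (.deleteII false) ++ .deleteI true :: unknottingMoves n)

theorem unknots_of_presents (n : ℕ) :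
    ∀ {D : KnotDiagram} {g : D.Passage → ℕ × ℕ}, D.Presents (pairs (2 * n)) naturalKey g →
      D.Unknots (unknottingMoves n) := by
  induction n with
  | zero => exact fun {D g} h => .nil D (Presents.isEmpty h)
  | succ m ih =>
    intro D g h
    obtain ⟨E, g₁, hE, hDE⟩ := exists_unknots_sweep m le_rfl
      (h.congr_key fun x hx y hy => naturalKey_lt_iff hx hy)
    rw [← remaining_zero] at hE
    obtain ⟨F, g₂, hF, hEF⟩ := exists_unknots_bigons m (zero_add m) hE
    obtain ⟨G, g₃, hG, hFG⟩ := exists_deletesMonogon_sweep hF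
    exact hDE _ (hEF _ (.cons F G _ _ hFG (ih hG)))

theorem count_unknottingMoves (n : ℕ) :
    (unknottingMoves n).count (.deleteI true) = n.choose 1 ∧
    (unknottingMoves n).count (.deleteII false) = n.choose 2 ∧
    (unknottingMoves n).count (.moveIII true) = n.choose 3 ∧
    (unknottingMoves n).count (.createI true) = 0 ∧
    (unknottingMoves n).count (.createII false) = 0 ∧
    (unknottingMoves n).count (.moveIII false) = 0 ∧
    (unknottingMoves n).length = n.choose 1 + n.choose 2 + n.choose 3 := by
  induction n with
  | zero => simp [unknottingMoves]
  | succ n ih =>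
    obtain ⟨h1, h2, h3, h4, h5, h6, h7⟩ := ih
    simp [unknottingMoves, List.count_replicate, h1, h2, h3, h4, h5, h6, h7,
      Nat.choose_succ_succ' n 1, Nat.choose_succ_succ' n 2]
    omega

/-- Clearing the denominator 6 keeps the bound in the natural numbers. -/
theorem six_mul_choose_sum (n : ℕ) :
    6 * (n.choose 1 + n.choose 2 + n.choose 3) = n * (n ^ 2 + 5) := by
  have h : ∀ n : ℕ, 2 * n.choose 2 + n = n * n := by
    intro n
    induction n with
    | zero => rfl
    | succ n ih =>
      rw [Nat.choose_succ_succ' n 1, Nat.choose_one_right]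
      linarith
  induction n with
  | zero => rfl
  | succ n ih =>
    have h := h n
    rw [Nat.choose_succ_succ' n 0, Nat.choose_succ_succ' n 1, Nat.choose_succ_succ' n 2]
    simp only [zero_add, Nat.choose_one_right, Nat.choose_zero_right] at *
    linarith

/-- Every diagram that is unknotted by the moves `unknottingMoves n` has this complexity. -/
theorem le_of_unknots {n : ℕ} {D : KnotDiagram} (h : D.Unknots (unknottingMoves n))
    {ms : List Move} (hms : D.Unknots ms) :
    n * (n ^ 2 + 5) ≤ 6 * (ms.count (.deleteI true) + ms.count (.deleteII false) +
      ms.count (.moveIII true)) := by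
  have h1 := complexity_of_unknots h
  have h2 := complexity_of_unknots hms
  obtain ⟨c1, c2, c3, c4, c5, c6, -⟩ := count_unknottingMoves n
  rw [c1, c2, c3, c4, c5, c6] at h1
  rw [← six_mul_choose_sum]
  omega

theorem count_le_length (ms : List Move) :
    ms.count (.deleteI true) + ms.count (.deleteII false) + ms.count (.moveIII true) ≤
      ms.length := by
  induction ms with
  | nil => rfl
  | cons m ms ih =>
    simp only [List.count_cons, List.length_cons]
    cases m <;> simp <;> (try split_ifs) <;> omega

end KnotDiagram

/-! ### Planarity of the ascending diagram. -/

namespace GaussDiagram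

/-- The pair that follows `z` along the ascending diagram with `N` segments. -/
def followingPair (N : ℕ) (z : ℕ × ℕ) : ℕ × ℕ :=
  if z.2 + 1 = z.1 ∨ z.1 = 0 ∧ z.2 + 1 = N then
    (if z.1 + 1 < N then z.1 + 1 else 0, if z.1 + 2 < N then z.1 + 2 else z.1 + 2 - N)
  else (z.1, if z.2 + 2 < N then z.2 + 2 else z.2 + 2 - N)

theorem followingPair_mem {m : ℕ} {z : ℕ × ℕ} (hz : z ∈ pairs (2 * m + 2)) :
    followingPair (2 * m + 2) z ∈ pairs (2 * m + 2) := by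
  obtain ⟨x, y, hx, hy, rfl | rfl⟩ := eq_of_mem_pairs hz <;> clear hz <;>
  simp only [followingPair] <;> split_ifs <;> rw [mem_pairs] <;> simp only <;> omega

theorem isCyclicSucc_followingPair {m : ℕ} {z : ℕ × ℕ} (hz : z ∈ pairs (2 * m + 2)) :
    (naturalKey z < naturalKey (followingPair (2 * m + 2) z) ∧ ∀ w ∈ pairs (2 * m + 2),
      naturalKey w ≤ naturalKey z ∨ naturalKey (followingPair (2 * m + 2) z) ≤ naturalKey w) ∨
    (∀ w ∈ pairs (2 * m + 2), naturalKey w ≤ naturalKey z) ∧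
      ∀ w ∈ pairs (2 * m + 2), naturalKey (followingPair (2 * m + 2) z) ≤ naturalKey w := by
  by_cases hlast : z = (2 * m + 1, 2 * m)
  · right
    have h : followingPair (2 * m + 2) z = (0, 1) := by
      rw [hlast]
      rw [followingPair, if_pos (Or.inl rfl), if_neg (by simp), if_neg (by simp)]
      exact Prod.ext rfl (by simp only; omega)
    rw [h, hlast]
    constructor <;> intro w hw <;>
    obtain ⟨x', y', hx', hy', rfl | rfl⟩ := eq_of_mem_pairs hw <;> clear hw <;>
    simp only [naturalKey, triple_le] <;> split_ifs <;> omega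
  · left
    obtain ⟨x, y, hx, hy, rfl | rfl⟩ := eq_of_mem_pairs hz <;> clear hz <;>
    simp only [Prod.mk.injEq] at hlast
    · refine ⟨?_, fun w hw => ?_⟩
      · simp only [followingPair]
        split_ifs <;> simp only [naturalKey, triple_lt] <;> split_ifs <;> omega
      · obtain ⟨x', y', hx', hy', rfl | rfl⟩ := eq_of_mem_pairs hw <;> clear hw <;>
        simp only [followingPair] <;>
        split_ifs <;> simp only [naturalKey, triple_le] <;> split_ifs <;> omega
    · refine ⟨?_, fun w hw => ?_⟩
      · simp only [followingPair]
        split_ifs <;> simp only [naturalKey, triple_lt] <;> split_ifs <;> omega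
      · obtain ⟨x', y', hx', hy', rfl | rfl⟩ := eq_of_mem_pairs hw <;> clear hw <;>
        simp only [followingPair] <;>
        split_ifs <;> simp only [naturalKey, triple_le] <;> split_ifs <;> omega

theorem naturalKey_injective : Function.Injective naturalKey := by
  rintro ⟨i, j⟩ ⟨i', j'⟩ h
  have h1 := h.le
  have h2 := h.ge
  simp only [naturalKey, triple_le] at h1 h2
  simp only [Prod.mk.injEq]
  split_ifs at h1 h2 <;> omega

section planar

variable {m : ℕ} {D : GaussDiagram} {g : D.Passage → ℕ × ℕ}

theorem Presents.next_natural (h : D.Presents (pairs (2 * m + 2)) naturalKey g) (x : D.Passage) :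
    g (D.next x) = followingPair (2 * m + 2) (g x) := by
  obtain ⟨y, hy⟩ := h.exists_eq (followingPair_mem (h.mem x))
  rw [← hy]
  congr 1
  apply h.linearizes.next_eq
  have h1 := isCyclicSucc_followingPair (h.mem x)
  rw [← hy] at h1
  rcases h1 with h1 | h1
  · exact Or.inl ⟨h1.1, fun z => h1.2 _ (h.mem z)⟩
  · exact Or.inr ⟨fun z => h1.1 _ (h.mem z), fun z => h1.2 _ (h.mem z)⟩

/-- Modulo the number of segments the base point disappears: on the segment u the partner v advances
by 2 until v = u - 1, and then the knot turns to (u + 1, u + 2). -/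
theorem followingPair_cases {m : ℕ} {z : ℕ × ℕ} (hz : z ∈ pairs (2 * m + 2)) :
    ((z.2 : ZMod (2 * m + 2)) = z.1 - 1 ∧
      ((followingPair (2 * m + 2) z).1 : ZMod (2 * m + 2)) = z.1 + 1 ∧
      ((followingPair (2 * m + 2) z).2 : ZMod (2 * m + 2)) = z.1 + 2 ∧
      (followingPair (2 * m + 2) z).1 % 2 = 1 - z.1 % 2) ∨
    ((z.2 : ZMod (2 * m + 2)) ≠ z.1 - 1 ∧
      ((followingPair (2 * m + 2) z).1 : ZMod (2 * m + 2)) = z.1 ∧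
      ((followingPair (2 * m + 2) z).2 : ZMod (2 * m + 2)) = z.2 + 2 ∧
      (followingPair (2 * m + 2) z).1 % 2 = z.1 % 2) := by
  have hN : ((2 * m + 2 : ℕ) : ZMod (2 * m + 2)) = 0 := ZMod.natCast_self _
  have hcast : ∀ k, ((if k < 2 * m + 2 then k else k - (2 * m + 2) : ℕ) : ZMod (2 * m + 2)) = k := by
    intro k
    split_ifs with hk
    · rfl
    · rw [Nat.cast_sub (by omega), hN, sub_zero]
  obtain ⟨i, j⟩ := z
  rw [mem_pairs] at hz
  simp only at hz
  by_cases hc : j + 1 = i ∨ i = 0 ∧ j + 1 = 2 * m + 2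
  · left
    simp only [followingPair, if_pos hc]
    refine ⟨?_, ?_, ?_, ?_⟩
    · rcases hc with hc | ⟨rfl, hc⟩
      · rw [← hc]; push_cast; ring
      · have : ((j + 1 : ℕ) : ZMod (2 * m + 2)) = 0 := by rw [hc, hN]
        rw [eq_sub_iff_add_eq]
        exact_mod_cast this
    · have := hcast (i + 1)
      rw [← Nat.cast_succ, Nat.succ_eq_add_one, ← this]
      congr 1
      split_ifs <;> omega
    · exact (hcast (i + 2)).trans (by push_cast; ring)
    · split_ifs <;> omega
  · right
    simp only [followingPair, if_neg hc]
    refine ⟨?_, trivial, ?_, trivial⟩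
    · intro e
      have e : ((j + 1 : ℕ) : ZMod (2 * m + 2)) = (i : ℕ) := by push_cast; rw [e]; ring
      rw [ZMod.natCast_eq_natCast_iff'] at e
      rw [Nat.mod_eq_of_lt (a := i) hz.1] at e
      rcases Nat.lt_or_ge (j + 1) (2 * m + 2) with h | h
      · rw [Nat.mod_eq_of_lt h] at e; omega
      · have : j + 1 = 2 * m + 2 := by omega
        rw [this, Nat.mod_self] at e; omega
    · exact (hcast (j + 2)).trans (by push_cast; ring)

open Classical in
/-- The label of the face on the left of a directed edge that starts at the passage on the segment
`u` through its crossing with the segment `v`, where `o` says that `u` is odd. -/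
noncomputable def ringLabel {R : Type*} [CommRing R] (o : Bool) (u v : R) (s : Bool) :
    Option (Option (R × R)) :=
  if o then if s then some (some (v, u)) else some (some (v - 2, u - 2))
  else if s then if v = u - 1 then none else some (some (u - 2, v))
  else if v = u + 1 then some none else some (some (u, v - 2))

theorem ringLabel_eq {R : Type*} [CommRing R] {o o' : Bool} {u v u' v' : R}
    (h : (v = u - 1 ∧ u' = u + 1 ∧ v' = u + 2 ∧ o' = !o) ∨
      (v ≠ u - 1 ∧ u' = u ∧ v' = v + 2 ∧ o' = o)) :
    ringLabel (!o') v' u' (o' == true) = ringLabel o u v true ∧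
    ringLabel (!o) v u (o == false) = ringLabel o' u' v' false := by
  rcases h with ⟨rfl, rfl, rfl, rfl⟩ | ⟨h, rfl, rfl, rfl⟩
  · cases o <;> simp [ringLabel] <;> grind
  · have h1 : u' ≠ v + 1 := fun e => h (by rw [e]; ring)
    have h2 : u' ≠ v + 2 - 1 := fun e => h (by rw [e]; ring)
    have h3 : v + 2 ≠ u' + 1 := fun e => h (by linear_combination e)
    cases o' <;> simp [ringLabel, h, h1, h2, h3]

/-- The faces of the ascending diagram: the innermost one, the outermost one, and one at each
crossing. -/
noncomputable def faceLabel (m : ℕ) (z : ℕ × ℕ) (s : Bool) :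
    Option (Option (ZMod (2 * m + 2) × ZMod (2 * m + 2))) :=
  ringLabel (decide (z.1 % 2 = 1)) z.1 z.2 s

theorem faceLabel_followingPair {z w : ℕ × ℕ} (hz : z ∈ pairs (2 * m + 2))
    (hw : w = followingPair (2 * m + 2) z) :
    faceLabel m w.swap (decide (w.1 % 2 = 1) == true) = faceLabel m z true ∧
    faceLabel m z.swap (decide (z.1 % 2 = 1) == false) = faceLabel m w false := by
  have h1 := followingPair_cases hz
  have h2 := followingPair_mem hz
  rw [← hw] at h1 h2
  rw [mem_pairs] at hz h2
  have h3 : ∀ z : ℕ × ℕ, (z.1 + z.2) % 2 = 1 → decide (z.2 % 2 = 1) = !decide (z.1 % 2 = 1) := by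
    intro z hz
    rw [← decide_not]
    congr 1
    apply propext
    omega
  simp only [faceLabel, Prod.fst_swap, Prod.snd_swap]
  rw [h3 z hz.2.2, h3 w h2.2.2]
  apply ringLabel_eq
  rcases h1 with ⟨a1, a2, a3, a4⟩ | ⟨a1, a2, a3, a4⟩
  · refine Or.inl ⟨a1, a2, a3, ?_⟩
    rw [← decide_not]
    congr 1
    apply propext
    omega
  · exact Or.inr ⟨a1, a2, a3, by rw [a4]⟩

theorem Presents.faceLabel_faceNext (h : D.Presents (pairs (2 * m + 2)) naturalKey g)
    (d : D.Dart) : faceLabel m (g (D.faceNext d).1) (D.faceNext d).2 =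
      faceLabel m (g d.1) d.2 := by
  obtain ⟨x, s⟩ := d
  cases s
  · obtain ⟨y, rfl⟩ := D.next.surjective x
    simp only [faceNext, head, Bool.false_eq_true, if_false, Equiv.symm_apply_apply, h.mate, h.left]
    exact (faceLabel_followingPair (h.mem y) (h.next_natural y)).2
  · simp only [faceNext, head, if_true, h.mate, h.left]
    exact (faceLabel_followingPair (h.mem x) (h.next_natural x)).1

/-- The labels distinguish the innermost face, the outermost face, and the face on the left of the
edge leaving each crossing along its odd segment. This gives two faces more than crossings, and the
genus inequality does the rest. -/
theorem Presents.planar (h : D.Presents (pairs (2 * m + 2)) naturalKey g) :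
    2 * Nat.card D.Face = Nat.card D.Passage + 4 := by
  apply planar_of_le
  let lab : D.Face → Option (Option (ZMod (2 * m + 2) × ZMod (2 * m + 2))) :=
    Quot.lift (fun d : D.Dart => faceLabel m (g d.1) d.2) (by
      rintro d _ rfl
      exact (h.faceLabel_faceNext d).symm)
  have hlab : ∀ d, lab (D.faceOf d) = faceLabel m (g d.1) d.2 := fun _ => rfl
  have hN : ((2 * m + 2 : ℕ) : ZMod (2 * m + 2)) = 0 := ZMod.natCast_self _
  obtain ⟨c, hc⟩ := h.exists_eq (z := (0, 2 * m + 1))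
    (mem_pairs.2 ⟨Nat.succ_pos _, Nat.lt_succ_self _, by change (0 + (2 * m + 1)) % 2 = 1; omega⟩)
  obtain ⟨o, ho⟩ := h.exists_eq (z := (0, 1))
    (mem_pairs.2 ⟨Nat.succ_pos _, Nat.succ_lt_succ (Nat.succ_pos _), rfl⟩)
  have hcl : lab (D.faceOf (c, true)) = none := by
    rw [hlab, hc]
    have : ((2 * m + 1 : ℕ) : ZMod (2 * m + 2)) = (0 : ℕ) - 1 := by
      rw [eq_sub_iff_add_eq]
      exact_mod_cast hN
    simp [faceLabel, ringLabel, this]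
  have hol : lab (D.faceOf (o, false)) = some none := by
    rw [hlab, ho]
    simp [faceLabel, ringLabel]
  have hpl : ∀ p : D.LeftPassage, lab (D.faceOf (p, true)) =
      some (some (((g p).2 : ZMod (2 * m + 2)), ((g p).1 : ZMod (2 * m + 2)))) := by
    intro p
    have hp := p.2
    rw [h.left, decide_eq_true_iff] at hp
    rw [hlab]
    simp [faceLabel, ringLabel, hp]
  let face : Option (Option D.LeftPassage) → D.Face
    | none => D.faceOf (c, true)
    | some none => D.faceOf (o, false)
    | some (some p) => D.faceOf (p, true)
  have hinj : Function.Injective face := by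
    have hcast : ∀ a b : ℕ, a < 2 * m + 2 → b < 2 * m + 2 →
        (a : ZMod (2 * m + 2)) = b → a = b := by
      intro a b ha hb e
      rwa [ZMod.natCast_eq_natCast_iff', Nat.mod_eq_of_lt ha, Nat.mod_eq_of_lt hb] at e
    intro a b e
    have e := congrArg lab e
    rcases a with _ | _ | p <;> rcases b with _ | _ | q <;> simp only [face, hcl, hol, hpl] at e
    any_goals rfl
    any_goals simp at e
    have hp := mem_pairs.1 (h.mem p)
    have hq := mem_pairs.1 (h.mem q)
    congr 2
    exact Subtype.ext (h.injective (Prod.ext (hcast _ _ hp.1 hq.1 e.2) (hcast _ _ hp.2.1 hq.2.1 e.1)))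
  have h1 := Nat.card_le_card_of_injective face hinj
  have h2 := D.two_mul_card_leftPassage
  rw [Finite.card_option, Finite.card_option] at h1
  rw [← Nat.card_eq_fintype_card, ← Nat.card_eq_fintype_card] at h2
  omega

end planar

/-- The ascending diagram with `2 * n` segments. -/
theorem exists_presents_natural (n : ℕ) :
    ∃ (D : KnotDiagram) (g : D.Passage → ℕ × ℕ), D.Presents (pairs (2 * n)) naturalKey g := by
  obtain ⟨E, g, hE⟩ := (admissible_of_subset (subset_refl (pairs (2 * n)))
    (fun _ => swap_mem_pairs) naturalKey_injective.injOn).exists_presents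
  refine ⟨⟨E, fun hne => ?_⟩, g, hE⟩
  rcases n with _ | m
  · exact absurd hne (not_nonempty_iff.2 (Presents.isEmpty hE))
  · exact hE.planar

end GaussDiagram

/-! ### Arithmetic of the crossing parameters. -/

open GaussDiagram

/-- The position, on the segment `z.1` of the curve, of its crossing with the segment `z.2`. -/
def crossingPosition (n : ℕ) (z : ℕ × ℕ) : ℤ :=
  ((z.2 : ℤ) - z.1 + 1 + if z.2 < z.1 then 2 * n else 0) / 2

/-- The parameter, in multiples of `π / n`, of the crossing of the segments `z.1` and `z.2`. -/
def crossingTime (n : ℕ) (z : ℕ × ℕ) : ℤ := z.1 * (n + 1) + crossingPosition n z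

section crossingTime

variable {n : ℕ} {z w : ℕ × ℕ}

theorem two_mul_crossingPosition (hz : z ∈ pairs (2 * n)) :
    2 * crossingPosition n z = (z.2 : ℤ) - z.1 + 1 + if z.2 < z.1 then 2 * n else 0 := by
  rw [mem_pairs] at hz
  rw [crossingPosition]
  split_ifs <;> omega

theorem crossingPosition_pos (hz : z ∈ pairs (2 * n)) : 0 < crossingPosition n z := by
  have h := two_mul_crossingPosition hz
  rw [mem_pairs] at hz
  split_ifs at h <;> omega

theorem crossingPosition_le (hz : z ∈ pairs (2 * n)) : crossingPosition n z ≤ n := by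
  have h := two_mul_crossingPosition hz
  rw [mem_pairs] at hz
  split_ifs at h <;> omega

theorem crossingPosition_swap (hz : z ∈ pairs (2 * n)) :
    crossingPosition n z.swap = n + 1 - crossingPosition n z := by
  have h := two_mul_crossingPosition hz
  have h' := two_mul_crossingPosition (swap_mem_pairs hz)
  rw [mem_pairs] at hz
  simp only [Prod.fst_swap, Prod.snd_swap] at h'
  split_ifs at h h' <;> omega

theorem crossingTime_nonneg (hz : z ∈ pairs (2 * n)) : 0 ≤ crossingTime n z := by
  have := crossingPosition_pos hz
  rw [crossingTime]
  positivity

theorem crossingTime_lt (hz : z ∈ pairs (2 * n)) : crossingTime n z < 2 * n * (n + 1) := by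
  have h1 := crossingPosition_le hz
  have h2 : (z.1 : ℤ) + 1 ≤ 2 * n := by rw [mem_pairs] at hz; omega
  rw [crossingTime]
  nlinarith

theorem crossingTime_lt_of_fst_lt (hz : z ∈ pairs (2 * n)) (hw : w ∈ pairs (2 * n))
    (h : z.1 < w.1) : crossingTime n z < crossingTime n w := by
  have h1 := crossingPosition_le hz
  have h2 := crossingPosition_pos hw
  have h3 : (z.1 : ℤ) + 1 ≤ w.1 := by omega
  rw [crossingTime, crossingTime]
  nlinarith

theorem crossingTime_lt_iff (hz : z ∈ pairs (2 * n)) (hw : w ∈ pairs (2 * n)) :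
    crossingTime n z < crossingTime n w ↔ naturalKey z < naturalKey w := by
  simp only [naturalKey, triple_lt]
  rcases lt_trichotomy z.1 w.1 with h | h | h
  · exact iff_of_true (crossingTime_lt_of_fst_lt hz hw h) (Or.inl h)
  · have h1 := two_mul_crossingPosition hz
    have h2 := two_mul_crossingPosition hw
    rw [mem_pairs] at hz hw
    rw [crossingTime, crossingTime, h, add_lt_add_iff_left]
    rw [h] at h1 hz
    split_ifs at h1 h2 ⊢ <;> omega
  · exact iff_of_false (crossingTime_lt_of_fst_lt hw hz h).not_gt (by omega)

theorem crossingTime_injOn : Set.InjOn (crossingTime n) (pairs (2 * n)) := by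
  intro z hz w hw e
  have h1 := (crossingTime_lt_iff hz hw).not.1 e.not_lt
  have h2 := (crossingTime_lt_iff hw hz).not.1 e.not_gt
  exact naturalKey_injective (le_antisymm (not_lt.1 h2) (not_lt.1 h1))

theorem crossingTime_swap_lt (hz : z ∈ pairs (2 * n)) :
    crossingTime n z.swap < crossingTime n z ↔ z.2 < z.1 := by
  have h : z.1 ≠ z.2 := by
    rw [mem_pairs] at hz
    omega
  rcases lt_or_gt_of_ne h with h | h
  · exact iff_of_false (crossingTime_lt_of_fst_lt hz (swap_mem_pairs hz) h).not_gt h.not_gt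
  · exact iff_of_true (crossingTime_lt_of_fst_lt (swap_mem_pairs hz) hz h) h

/-- Multiples of n + 1 are the turning points. Every other grid point is a crossing: the quotient by
n + 1 gives the segment i, the remainder p its position, and the partner is i + 2p - 1 modulo 2n. -/
theorem exists_crossingTime_eq {S : ℤ} (h0 : 0 ≤ S) (h1 : S < 2 * n * (n + 1))
    (hdvd : ¬ (n + 1 : ℤ) ∣ S) : ∃ z ∈ pairs (2 * n), crossingTime n z = S := by
  have hn : (0 : ℤ) < n + 1 := by omega
  have hi0 : 0 ≤ S / (n + 1) := Int.ediv_nonneg h0 hn.le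
  have hi1 : S / (n + 1) < 2 * n := Int.ediv_lt_of_lt_mul hn h1
  have hp0 : 0 ≤ S % (n + 1) := Int.emod_nonneg _ hn.ne'
  have hp1 : S % (n + 1) < n + 1 := Int.emod_lt_of_pos _ hn
  have hp2 : S % (n + 1) ≠ 0 := fun h => hdvd (Int.dvd_of_emod_eq_zero h)
  have hS := Int.mul_ediv_add_emod S (n + 1)
  obtain ⟨i, hi⟩ := Int.eq_ofNat_of_zero_le hi0
  generalize S % (n + 1) = p at *
  rw [hi] at hS hi1
  obtain ⟨p, rfl⟩ := Int.eq_ofNat_of_zero_le hp0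
  have hz : (i, if i + 2 * p - 1 < 2 * n then i + 2 * p - 1 else i + 2 * p - 1 - 2 * n) ∈
      pairs (2 * n) := by
    rw [mem_pairs]
    simp only
    split_ifs <;> omega
  refine ⟨_, hz, ?_⟩
  have h2 := two_mul_crossingPosition hz
  simp only [crossingTime] at h2 ⊢
  rw [← hS, mul_comm]
  congr 1
  split_ifs at h2 ⊢ <;> omega

theorem dvd_crossingTime_sub (hz : z ∈ pairs (2 * n)) :
    (2 * n : ℤ) ∣ crossingTime n z.swap - crossingTime n z := by
  have h := two_mul_crossingPosition hz
  have hs := crossingPosition_swap hz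
  rw [mem_pairs] at hz
  rw [crossingTime, crossingTime, hs, Prod.fst_swap]
  split_ifs at h with hlt
  · push_cast at h
    obtain ⟨k, hk⟩ : ∃ k : ℤ, (z.2 : ℤ) - z.1 = 2 * k + 1 := ⟨((z.2 : ℤ) - z.1) / 2, by omega⟩
    exact ⟨k, by linear_combination (n + 1 : ℤ) * hk - h - hk⟩
  · obtain ⟨k, hk⟩ : ∃ k : ℤ, (z.2 : ℤ) - z.1 = 2 * k + 1 := ⟨((z.2 : ℤ) - z.1) / 2, by omega⟩
    exact ⟨k + 1, by linear_combination (n + 1 : ℤ) * hk - h - hk⟩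

theorem dvd_crossingTime_add (hz : z ∈ pairs (2 * n)) :
    (2 * (n + 1) : ℤ) ∣ crossingTime n z.swap + crossingTime n z := by
  have hs := crossingPosition_swap hz
  rw [mem_pairs] at hz
  rw [crossingTime, crossingTime, hs, Prod.fst_swap]
  obtain ⟨k, hk⟩ : ∃ k : ℤ, (z.2 : ℤ) + z.1 + 1 = 2 * k := ⟨((z.2 : ℤ) + z.1 + 1) / 2, by omega⟩
  exact ⟨k, by linear_combination (n + 1 : ℤ) * hk⟩

/-- A partner of S is determined modulo 2n by its angle and modulo 2(n + 1) by its radius, hence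
modulo 2n(n + 1), which is the period. -/
theorem eq_of_two_mul_dvd {S S' S'' : ℤ} (h1 : (2 * n : ℤ) ∣ S' - S) (h2 : (2 * n : ℤ) ∣ S'' - S)
    (h3 : (2 * (n + 1) : ℤ) ∣ S' + S) (h4 : (2 * (n + 1) : ℤ) ∣ S'' + S) (h0 : 0 ≤ S')
    (h0' : 0 ≤ S'') (hlt : S' < 2 * n * (n + 1)) (hlt' : S'' < 2 * n * (n + 1)) : S' = S'' := by
  obtain ⟨a, ha⟩ : (2 * n : ℤ) ∣ S' - S'' := by
    have := dvd_sub h1 h2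
    rwa [sub_sub_sub_cancel_right] at this
  have h5 : (2 * (n + 1) : ℤ) ∣ S' - S'' := by
    have := dvd_sub h3 h4
    rwa [add_sub_add_right_eq_sub] at this
  have h6 : (n + 1 : ℤ) ∣ n * a := by
    rw [ha, mul_assoc] at h5
    exact (mul_dvd_mul_iff_left two_ne_zero).1 h5
  have h7 : (n + 1 : ℤ) ∣ a := by
    have h8 : (n + 1 : ℤ) ∣ (n + 1) * a := Dvd.intro _ rfl
    have := dvd_sub h8 h6
    rwa [add_mul, one_mul, add_sub_cancel_left] at this
  obtain ⟨c, rfl⟩ := h7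
  have h8 : S' - S'' = 2 * n * (n + 1) * c := by rw [ha]; ring
  have hpos : (0 : ℤ) < 2 * n * (n + 1) := by linarith
  have h9 : c < 1 := by nlinarith
  have h10 : -1 < c := by nlinarith
  obtain rfl : c = 0 := by omega
  linarith

end crossingTime

/-! ### Double points and tangents of the polar curve. -/

open GaussDiagram

namespace KnotDiagram

section polarCurve

variable {n : ℕ}

/-- The derivative of the radius of the polar curve. -/
noncomputable def radiusDeriv (n : ℕ) (t : ℝ) : ℝ :=
  -(n / (n + 1)) * Real.sin (n * t / (n + 1))

/-- The radius of the polar curve. -/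
noncomputable def radius (n : ℕ) (t : ℝ) : ℝ := 2 + Real.cos (n * t / (n + 1))

theorem radius_pos (t : ℝ) : 0 < radius n t := by
  have := Real.neg_one_le_cos (n * t / (n + 1))
  rw [radius]
  linarith

theorem polarCurve_eq (t : ℝ) : polarCurve n t = (radius n t : ℂ) * Complex.exp (t * Complex.I) :=
  rfl

theorem norm_polarCurve (t : ℝ) : ‖polarCurve n t‖ = radius n t := by
  rw [polarCurve_eq, norm_mul, Complex.norm_exp_ofReal_mul_I, mul_one, Complex.norm_real,
    Real.norm_of_nonneg (radius_pos t).le]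

theorem contDiff_polarCurve : ContDiff ℝ (⊤ : ℕ∞) (polarCurve n) := by
  have h1 : ContDiff ℝ (⊤ : ℕ∞) (radius n) := by
    unfold radius
    fun_prop
  have h2 : ContDiff ℝ (⊤ : ℕ∞) fun t : ℝ => (t : ℂ) := Complex.ofRealCLM.contDiff
  exact (h2.comp h1).mul ((h2.mul contDiff_const).cexp)

theorem hasDerivAt_radius (t : ℝ) : HasDerivAt (radius n) (radiusDeriv n t) t := by
  have h : HasDerivAt (fun t : ℝ => (n : ℝ) * t / (n + 1)) (n / (n + 1)) t := by
    simpa using ((hasDerivAt_id t).const_mul (n : ℝ)).div_const ((n : ℝ) + 1)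
  exact ((h.cos).const_add 2).congr_deriv (by rw [radiusDeriv]; ring)

theorem deriv_polarCurve (t : ℝ) : deriv (polarCurve n) t =
    (radiusDeriv n t + radius n t * Complex.I) * Complex.exp (t * Complex.I) := by
  have h1 : HasDerivAt (fun t : ℝ => (radius n t : ℂ)) (radiusDeriv n t : ℂ) t :=
    (hasDerivAt_radius t).ofReal_comp
  have h2 : HasDerivAt (fun t : ℝ => (t : ℂ) * Complex.I) Complex.I t := by
    simpa using ((hasDerivAt_id t).ofReal_comp).mul_const Complex.I
  have h3 := h1.mul h2.cexp
  have h4 : deriv (polarCurve n) t = _ := h3.deriv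
  rw [h4]
  ring

theorem deriv_polarCurve_ne_zero (t : ℝ) : deriv (polarCurve n) t ≠ 0 := by
  rw [deriv_polarCurve]
  refine mul_ne_zero (fun h => ?_) (Complex.exp_ne_zero _)
  have := congrArg Complex.im h
  simp at this
  exact (radius_pos t).ne' this

theorem radius_add_period (t : ℝ) (k : ℤ) :
    radius n (t + 2 * (n + 1) * Real.pi * k) = radius n t := by
  have h : (n : ℝ) * (t + 2 * (n + 1) * Real.pi * k) / (n + 1) =
      n * t / (n + 1) + ((n * k : ℤ) : ℝ) * (2 * Real.pi) := by
    push_cast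
    field_simp
  rw [radius, radius, h, Real.cos_add_int_mul_two_pi]

theorem exp_eq_exp_iff {s t : ℝ} : Complex.exp (s * Complex.I) = Complex.exp (t * Complex.I) ↔
    ∃ k : ℤ, s = t + 2 * k * Real.pi := by
  rw [Complex.exp_eq_exp_iff_exists_int]
  refine exists_congr fun k => ?_
  have h : (t * Complex.I + k * (2 * Real.pi * Complex.I) : ℂ) =
      ((t + 2 * k * Real.pi : ℝ) : ℂ) * Complex.I := by push_cast; ring
  rw [h, mul_left_inj' Complex.I_ne_zero]
  exact Complex.ofReal_inj

theorem polarCurve_eq_iff {s t : ℝ} : polarCurve n s = polarCurve n t ↔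
    radius n s = radius n t ∧ ∃ k : ℤ, s = t + 2 * k * Real.pi := by
  rw [← exp_eq_exp_iff]
  constructor
  · intro h
    have h1 : radius n s = radius n t := by rw [← norm_polarCurve, h, norm_polarCurve]
    refine ⟨h1, ?_⟩
    rw [polarCurve_eq, polarCurve_eq, h1] at h
    exact mul_left_cancel₀ (Complex.ofReal_ne_zero.2 (radius_pos t).ne') h
  · rintro ⟨h1, h2⟩
    rw [polarCurve_eq, polarCurve_eq, h1, h2]

theorem periodic_polarCurve : Function.Periodic (polarCurve n) (2 * (n + 1) * Real.pi) := by
  intro t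
  rw [polarCurve_eq_iff]
  exact ⟨by simpa using radius_add_period t 1, n + 1, by push_cast; ring⟩

/-- The parameter `π * S / n`. -/
noncomputable def gridTime (n : ℕ) (S : ℤ) : ℝ := Real.pi / n * S

theorem gridTime_lt_iff (hn : 0 < n) {S S' : ℤ} : gridTime n S < gridTime n S' ↔ S < S' := by
  rw [gridTime, gridTime, mul_lt_mul_iff_right₀ (by positivity), Int.cast_lt]

theorem gridTime_inj (hn : 0 < n) {S S' : ℤ} : gridTime n S = gridTime n S' ↔ S = S' := by
  have : Real.pi / n ≠ 0 := by positivity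
  rw [gridTime, gridTime, mul_right_inj' this, Int.cast_inj]

theorem gridTime_period (hn : 0 < n) :
    gridTime n (2 * n * (n + 1)) = 2 * (n + 1) * Real.pi := by
  rw [gridTime]
  push_cast
  field_simp

theorem gridTime_mem_Ico (hn : 0 < n) {S : ℤ} :
    gridTime n S ∈ Set.Ico 0 (2 * (n + 1) * Real.pi) ↔ 0 ≤ S ∧ S < 2 * n * (n + 1) := by
  rw [← gridTime_period hn, Set.mem_Ico, gridTime_lt_iff hn]
  refine and_congr_left fun _ => ?_
  rw [gridTime, mul_nonneg_iff_of_pos_left (by positivity), Int.cast_nonneg_iff]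

theorem polarCurve_gridTime_eq (hn : 0 < n) {S S' : ℤ} (h1 : (2 * n : ℤ) ∣ S - S')
    (h2 : (2 * (n + 1) : ℤ) ∣ S + S') :
    polarCurve n (gridTime n S) = polarCurve n (gridTime n S') := by
  obtain ⟨k, hk⟩ := h1
  obtain ⟨l, hl⟩ := h2
  have hk' : (S : ℝ) - S' = 2 * n * k := by exact_mod_cast hk
  have hl' : (S : ℝ) + S' = 2 * (n + 1) * l := by exact_mod_cast hl
  have hn' : (n : ℝ) ≠ 0 := by positivity
  refine polarCurve_eq_iff.2 ⟨?_, k, ?_⟩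
  · rw [radius, radius, add_right_inj, Real.cos_eq_cos_iff]
    refine ⟨l, Or.inr ?_⟩
    rw [gridTime, gridTime]
    field_simp
    linear_combination hl'
  · rw [gridTime, gridTime]
    field_simp
    linear_combination hk'

/-- A double point satisfies s - t = 2kπ and n(s + t) = 2lπ(n + 1), which forces both parameters to
be multiples of π/n. -/
theorem exists_gridTime_eq (hn : 0 < n) {s t : ℝ} (hs : s ∈ Set.Ico 0 (2 * (n + 1) * Real.pi))
    (ht : t ∈ Set.Ico 0 (2 * (n + 1) * Real.pi)) (hne : s ≠ t)
    (h : polarCurve n s = polarCurve n t) :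
    ∃ S S' : ℤ, s = gridTime n S ∧ t = gridTime n S' ∧ (2 * n : ℤ) ∣ S - S' ∧
      (2 * (n + 1) : ℤ) ∣ S + S' ∧ ¬ (n + 1 : ℤ) ∣ S' := by
  obtain ⟨h1, k, hk⟩ := polarCurve_eq_iff.1 h
  have hn' : (n : ℝ) ≠ 0 := by positivity
  have hpi := Real.pi_pos
  have hk0 : k ≠ 0 := by
    rintro rfl
    simp at hk
    exact hne hk
  have hklt : |k| < n + 1 := by
    have h2 : |(k : ℝ)| < n + 1 := by
      rw [abs_lt]
      constructor <;> nlinarith [hs.1, hs.2, ht.1, ht.2]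
    exact_mod_cast h2
  have hdvd : ¬ (n + 1 : ℤ) ∣ k := fun hd =>
    absurd (Int.le_of_dvd (abs_pos.2 hk0) ((dvd_abs _ _).2 hd)) (by omega)
  have hcop : ∀ a : ℤ, (n + 1 : ℤ) ∣ n * a → (n + 1 : ℤ) ∣ a := by
    intro a ha
    have := dvd_sub (Dvd.intro a rfl : (n + 1 : ℤ) ∣ (n + 1) * a) ha
    rwa [add_mul, one_mul, add_sub_cancel_left] at this
  rw [radius, radius, add_right_inj, Real.cos_eq_cos_iff] at h1
  obtain ⟨l, hl | hl⟩ := h1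
  -- If the arguments of the cosines agreed modulo 2π, then n + 1 would divide nk, hence k, although
  -- 0 < |k| < n + 1.
  · exfalso
    apply hdvd
    apply hcop
    rw [hk] at hl
    field_simp at hl
    refine ⟨-l, ?_⟩
    have : (n : ℝ) * k = (n + 1) * -l := by
      have h2 : (2 * Real.pi) * ((n : ℝ) * k - (n + 1) * -l) = 0 := by linear_combination -hl
      have h3 := (mul_eq_zero.1 h2).resolve_left (by positivity)
      linarith
    exact_mod_cast this
  · have h2 : (n : ℝ) * t + n * s = 2 * l * Real.pi * (n + 1) := by
      field_simp at hl
      linear_combination hl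
    refine ⟨l * (n + 1) + k * n, l * (n + 1) - k * n, ?_, ?_, ⟨k, by ring⟩, ⟨l, by ring⟩, ?_⟩
    · rw [gridTime]
      push_cast
      field_simp
      rw [hk] at h2 ⊢
      linarith
    · rw [gridTime]
      push_cast
      field_simp
      rw [hk] at h2
      linarith
    · intro hd
      apply hdvd
      apply hcop
      have h3 := dvd_sub (Dvd.intro_left l rfl : (n + 1 : ℤ) ∣ l * (n + 1)) hd
      rwa [sub_sub_cancel, mul_comm] at h3

/-- In the rotating frame, which is the same at both parameters, the tangent vectors are (r', r)
with the same r. -/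
theorem det_deriv_polarCurve {s t : ℝ} (h : polarCurve n s = polarCurve n t) :
    (deriv (polarCurve n) s).re * (deriv (polarCurve n) t).im -
      (deriv (polarCurve n) s).im * (deriv (polarCurve n) t).re =
    radius n t * (radiusDeriv n s - radiusDeriv n t) := by
  obtain ⟨h1, k, hk⟩ := polarCurve_eq_iff.1 h
  have hc : Complex.exp (s * Complex.I) = Complex.exp (t * Complex.I) := exp_eq_exp_iff.2 ⟨k, hk⟩
  rw [deriv_polarCurve, deriv_polarCurve, hc, h1, Complex.exp_mul_I, ← Complex.ofReal_cos,
    ← Complex.ofReal_sin]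
  simp only [Complex.mul_re, Complex.mul_im, Complex.add_re, Complex.add_im, Complex.ofReal_re,
    Complex.ofReal_im, Complex.I_re, Complex.I_im]
  linear_combination (radius n t * (radiusDeriv n s - radiusDeriv n t)) * Real.cos_sq_add_sin_sq t

theorem radiusDeriv_gridTime (hn : 0 < n) {z : ℕ × ℕ} :
    radiusDeriv n (gridTime n (crossingTime n z)) =
      -(n / (n + 1)) * ((-1) ^ z.1 * Real.sin (Real.pi * crossingPosition n z / (n + 1))) := by
  have hn' : (n : ℝ) ≠ 0 := by positivity
  rw [radiusDeriv, ← Real.sin_add_nat_mul_pi, gridTime, crossingTime]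
  congr 2
  push_cast
  field_simp
  ring

theorem radiusDeriv_pos_iff (hn : 0 < n) {z : ℕ × ℕ} (hz : z ∈ pairs (2 * n)) :
    (z.1 % 2 = 1 → 0 < radiusDeriv n (gridTime n (crossingTime n z))) ∧
    (z.1 % 2 = 0 → radiusDeriv n (gridTime n (crossingTime n z)) < 0) := by
  have hpos : 0 < Real.sin (Real.pi * crossingPosition n z / (n + 1)) := by
    have h1 : (0 : ℝ) < crossingPosition n z := by exact_mod_cast crossingPosition_pos hz
    have h2 : (crossingPosition n z : ℝ) < n + 1 := by
      exact_mod_cast Int.lt_add_one_iff.2 (crossingPosition_le hz)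
    apply Real.sin_pos_of_pos_of_lt_pi
    · positivity
    · rw [div_lt_iff₀ (by positivity)]
      exact mul_lt_mul_of_pos_left h2 Real.pi_pos
  have hc : (0 : ℝ) < n / (n + 1) := by positivity
  rw [radiusDeriv_gridTime hn]
  constructor <;> intro h
  · rw [(Nat.odd_iff.2 h).neg_one_pow]
    nlinarith [mul_pos hc hpos]
  · rw [(Nat.even_iff.2 h).neg_one_pow]
    nlinarith [mul_pos hc hpos]

theorem polarCurve_swap (hn : 0 < n) {z : ℕ × ℕ} (hz : z ∈ pairs (2 * n)) :
    polarCurve n (gridTime n (crossingTime n z.swap)) =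
      polarCurve n (gridTime n (crossingTime n z)) :=
  polarCurve_gridTime_eq hn (dvd_crossingTime_sub hz) (dvd_crossingTime_add hz)

theorem det_pos_iff (hn : 0 < n) {z : ℕ × ℕ} (hz : z ∈ pairs (2 * n)) :
    0 < (deriv (polarCurve n) (gridTime n (crossingTime n z))).re *
        (deriv (polarCurve n) (gridTime n (crossingTime n z.swap))).im -
      (deriv (polarCurve n) (gridTime n (crossingTime n z))).im *
        (deriv (polarCurve n) (gridTime n (crossingTime n z.swap))).re ↔ z.1 % 2 = 1 := by
  rw [det_deriv_polarCurve (polarCurve_swap hn hz).symm,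
    mul_pos_iff_of_pos_left (radius_pos _)]
  have h1 := radiusDeriv_pos_iff hn hz
  have h2 := radiusDeriv_pos_iff hn (swap_mem_pairs hz)
  rw [Prod.fst_swap] at h2
  have h3 := (mem_pairs.1 hz).2.2
  rcases Nat.mod_two_eq_zero_or_one z.1 with h | h
  · have h4 := h1.2 h
    have h5 := h2.1 (by omega)
    exact iff_of_false (by linarith) (by omega)
  · have h4 := h1.1 h
    have h5 := h2.2 (by omega)
    exact iff_of_true (by linarith) h

/-- The double points of the polar curve. -/
theorem polarCurve_eq_crossing (hn : 0 < n) {s t : ℝ}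
    (hs : s ∈ Set.Ico 0 (2 * (n + 1) * Real.pi)) (ht : t ∈ Set.Ico 0 (2 * (n + 1) * Real.pi))
    (hne : s ≠ t) (h : polarCurve n s = polarCurve n t) :
    ∃ z ∈ pairs (2 * n), t = gridTime n (crossingTime n z) ∧
      s = gridTime n (crossingTime n z.swap) := by
  obtain ⟨S, S', rfl, rfl, h1, h2, h3⟩ := exists_gridTime_eq hn hs ht hne h
  rw [gridTime_mem_Ico hn] at hs ht
  obtain ⟨z, hz, rfl⟩ := exists_crossingTime_eq ht.1 ht.2 h3
  refine ⟨z, hz, rfl, ?_⟩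
  rw [eq_of_two_mul_dvd h1 (dvd_crossingTime_sub hz) h2 (dvd_crossingTime_add hz) hs.1
    (crossingTime_nonneg (swap_mem_pairs hz)) hs.2 (crossingTime_lt (swap_mem_pairs hz))]

variable {D : KnotDiagram}

/-- The geometric description leaves no freedom: each passage is named by its crossing time, and the
order, heights and crossing directions follow from arithmetic. -/
theorem presents_of_isAscending (hn : 0 < n) (h : D.IsAscendingPolarDiagram n) :
    ∃ g : D.Passage → ℕ × ℕ, D.Presents (pairs (2 * n)) naturalKey g := by
  obtain ⟨time, hcurve, hupper⟩ := h
  have hex : ∀ p, ∃ z ∈ pairs (2 * n), time p = gridTime n (crossingTime n z) := by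
    intro p
    have hp : time p ∈ Set.range time := ⟨p, rfl⟩
    rw [hcurve.range_time] at hp
    obtain ⟨hp, s, hs, hne, heq⟩ := hp
    obtain ⟨z, hz, h1, -⟩ := polarCurve_eq_crossing hn hs hp hne heq
    exact ⟨z, hz, h1⟩
  choose g hg htime using hex
  have hinj : Function.Injective g := fun p q e => hcurve.injective (by rw [htime, htime, e])
  have htime_inj : ∀ {z w}, z ∈ pairs (2 * n) → w ∈ pairs (2 * n) →
      gridTime n (crossingTime n z) = gridTime n (crossingTime n w) → z = w :=
    fun hz hw e => crossingTime_injOn hz hw ((gridTime_inj hn).1 e)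
  have htime_mem : ∀ {z}, z ∈ pairs (2 * n) →
      gridTime n (crossingTime n z) ∈ Set.Ico 0 (2 * (n + 1) * Real.pi) :=
    fun hz => (gridTime_mem_Ico hn).2 ⟨crossingTime_nonneg hz, crossingTime_lt hz⟩
  have hne_swap : ∀ {z}, z ∈ pairs (2 * n) → z.swap ≠ z := by
    rintro ⟨i, j⟩ hz e
    have := (mem_pairs.1 hz).2.2
    simp only [Prod.swap, Prod.mk.injEq] at e this
    omega
  have hmate : ∀ p, g (D.mate p) = (g p).swap := by
    intro p
    have h1 := (hcurve.double p _ (htime_mem (swap_mem_pairs (hg p)))).1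
      (by rw [htime, polarCurve_swap hn (hg p)])
    rcases h1 with h1 | h1
    · rw [htime] at h1
      exact absurd (htime_inj (swap_mem_pairs (hg p)) (hg p) h1) (hne_swap (hg p))
    · rw [htime] at h1
      exact (htime_inj (swap_mem_pairs (hg p)) (hg _) h1).symm
  have hlt : ∀ p q, (naturalKey ∘ g) p < (naturalKey ∘ g) q ↔ time p < time q := by
    intro p q
    rw [htime, htime, gridTime_lt_iff hn, crossingTime_lt_iff (hg p) (hg q)]
    rfl
  refine ⟨g, ⟨hinj, ?_, hmate, fun p => ?_, fun p => ?_,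
    naturalKey_injective.comp hinj, fun p => ?_⟩⟩
  · ext z
    refine ⟨?_, fun hz => ?_⟩
    · rintro ⟨p, rfl⟩
      exact hg p
    · have h1 : gridTime n (crossingTime n z) ∈ Set.range time := by
        rw [hcurve.range_time]
        refine ⟨htime_mem hz, _, htime_mem (swap_mem_pairs hz), fun e => ?_, polarCurve_swap hn hz⟩
        exact hne_swap hz (htime_inj (swap_mem_pairs hz) hz e)
      obtain ⟨p, hp⟩ := h1
      rw [htime] at hp
      exact ⟨p, htime_inj (hg p) hz hp⟩
  · rw [Bool.eq_iff_iff, hupper, htime, htime, hmate, gridTime_lt_iff hn,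
      crossingTime_swap_lt (hg p), decide_eq_true_iff]
  · rw [Bool.eq_iff_iff, hcurve.left_iff, htime, htime, hmate, det_pos_iff hn (hg p),
      decide_eq_true_iff]
  · have h1 : IsCyclicSucc time p (D.next p) := by
      by_cases hlast : ∃ q, time p < time q
      · obtain ⟨q, hq⟩ := hlast
        refine Or.inl ⟨(hcurve.next_of_lt p q hq).1, fun z => ?_⟩
        rcases le_or_gt (time z) (time p) with h | h
        · exact Or.inl h
        · exact Or.inr (hcurve.next_of_lt p z h).2
      · push Not at hlast
        exact Or.inr ⟨hlast, hcurve.next_of_last p hlast⟩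
    exact h1.congr hlt

/-- The converse shows that the combinatorial model realizes the polar curve, so a diagram as in the
theorem exists. -/
theorem isAscending_of_presents (hn : 0 < n) {g : D.Passage → ℕ × ℕ}
    (h : D.Presents (pairs (2 * n)) naturalKey g) : D.IsAscendingPolarDiagram n := by
  have htime_inj : ∀ {z w}, z ∈ pairs (2 * n) → w ∈ pairs (2 * n) →
      gridTime n (crossingTime n z) = gridTime n (crossingTime n w) → z = w :=
    fun hz hw e => crossingTime_injOn hz hw ((gridTime_inj hn).1 e)
  have htime_mem : ∀ {z}, z ∈ pairs (2 * n) →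
      gridTime n (crossingTime n z) ∈ Set.Ico 0 (2 * (n + 1) * Real.pi) :=
    fun hz => (gridTime_mem_Ico hn).2 ⟨crossingTime_nonneg hz, crossingTime_lt hz⟩
  have hinj : Function.Injective fun p => gridTime n (crossingTime n (g p)) :=
    fun p q e => h.injective (htime_inj (h.mem p) (h.mem q) e)
  have hsucc : ∀ p, IsCyclicSucc (fun p => gridTime n (crossingTime n (g p))) p (D.next p) :=
    fun p => (h.linearizes.succ p).congr fun x y => by
      rw [gridTime_lt_iff hn, crossingTime_lt_iff (h.mem x) (h.mem y)]
      rfl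
  refine ⟨fun p => gridTime n (crossingTime n (g p)),
    ⟨by positivity, periodic_polarCurve, contDiff_polarCurve, deriv_polarCurve_ne_zero, hinj, ?_,
      fun p s hs => ?_, fun p q hpq => ?_, fun p hp q => ?_, fun p => ?_⟩, fun p => ?_⟩
  · ext t
    constructor
    · rintro ⟨p, rfl⟩
      refine ⟨htime_mem (h.mem p), _, htime_mem (swap_mem_pairs (h.mem p)), fun e => ?_,
        polarCurve_swap hn (h.mem p)⟩
      have h1 := htime_inj (swap_mem_pairs (h.mem p)) (h.mem p) e
      rw [← h.mate] at h1
      exact D.mate_ne p (h.injective h1)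
    · rintro ⟨ht, s, hs, hne, heq⟩
      obtain ⟨z, hz, rfl, -⟩ := polarCurve_eq_crossing hn hs ht hne heq
      obtain ⟨p, rfl⟩ := h.exists_eq hz
      exact ⟨p, rfl⟩
  · rw [h.mate]
    constructor
    · intro e
      by_cases hne : s = gridTime n (crossingTime n (g p))
      · exact Or.inl hne
      · obtain ⟨z, hz, h1, h2⟩ := polarCurve_eq_crossing hn hs (htime_mem (h.mem p)) hne e
        rw [htime_inj (h.mem p) hz h1]
        exact Or.inr h2
    · rintro (rfl | rfl)
      · rfl
      · exact polarCurve_swap hn (h.mem p)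
  · rcases hsucc p with h1 | h1
    · exact ⟨h1.1, (h1.2 q).resolve_left hpq.not_ge⟩
    · exact absurd (h1.1 q) hpq.not_ge
  · rcases hsucc p with h1 | h1
    · exact absurd (hp (D.next p)) h1.1.not_ge
    · exact h1.2 q
  · rw [h.left, h.mate, decide_eq_true_iff, det_pos_iff hn (h.mem p)]
  · beta_reduce
    rw [h.upper, h.mate, decide_eq_true_iff, gridTime_lt_iff hn, crossingTime_swap_lt (h.mem p)]

end polarCurve

end KnotDiagram

/-! ### The theorem. -/

theorem theorem1p1 (n : ℕ) (hn : 3 ≤ n) :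
    (∃ D : KnotDiagram, D.IsAscendingPolarDiagram n) ∧
    ∀ D : KnotDiagram, D.IsAscendingPolarDiagram n →
      (∃ ms : List KnotDiagram.Move, D.Unknots ms ∧
        6 * ms.length = n * (n ^ 2 + 5) ∧
        ms.length = n.choose 1 + n.choose 2 + n.choose 3 ∧
        ms.count (.deleteI true) = n.choose 1 ∧
        ms.count (.deleteII false) = n.choose 2 ∧
        ms.count (.moveIII true) = n.choose 3) ∧
      (∀ ms : List KnotDiagram.Move, D.Unknots ms →
        n * (n ^ 2 + 5) ≤
          6 * (ms.count (.deleteI true) + ms.count (.deleteII false) + ms.count (.moveIII true))) ∧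
      (∀ ms : List KnotDiagram.Move, D.Unknots ms → n * (n ^ 2 + 5) ≤ 6 * ms.length) := by
  have hpos : 0 < n := by omega
  obtain ⟨D₀, g₀, h₀⟩ := GaussDiagram.exists_presents_natural n
  refine ⟨⟨D₀, KnotDiagram.isAscending_of_presents hpos h₀⟩, fun D hD => ?_⟩
  obtain ⟨g, hg⟩ := KnotDiagram.presents_of_isAscending hpos hD
  have hun := KnotDiagram.unknots_of_presents n hg
  obtain ⟨c1, c2, c3, -, -, -, hlen⟩ := KnotDiagram.count_unknottingMoves n
  refine ⟨⟨_, hun, ?_, hlen, c1, c2, c3⟩, fun ms hms => KnotDiagram.le_of_unknots hun hms,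
    fun ms hms => (KnotDiagram.le_of_unknots hun hms).trans
      (Nat.mul_le_mul_left 6 (KnotDiagram.count_le_length ms))⟩
  rw [hlen, KnotDiagram.six_mul_choose_sum]
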